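/- Let $\mathbb K=\mathbb R$ or $\mathbb C$ and let $(M,\omega)$ be a symplectic manifold of dimension $2n$ over $\mathbb K$: a $C^\infty$ manifold if $\mathbb K=\mathbb R$, a complex manifold if $\mathbb K=\mathbb C$, with a closed non-degenerate $2$-form $\omega$ (smooth, resp. holomorphic). Let $\mathcal O_M$ be the sheaf of smooth (resp. holomorphic) functions with the Poisson bracket $\{f,g\}=H_f(g)$, where $i_{H_f}\omega=df$. Let $\mathcal I\subset\mathcal O_M$ be an involutive ideal sheaf, i.e. $\{\mathcal I,\mathcal I\}\subset\mathcal I$, and let $L$ be the subspace that it defines, $\mathcal O_L=\mathcal O_M/\mathcal I$. A point $p\in L$ is a smooth point of dimension $d$ if near $p$ the ideal $\mathcal I$ is generated by $2n-d$ functions whose differentials at $p$ are linearly independent. Assume that $\dim L\le n$ in the sense that every smooth point of $L$ has dimension at most $n$. Let $\Omega^p_L=\Omega^p_M/(\mathcal I\,\Omega^p_M+d\mathcal I\wedge\Omega^{p-1}_M)$ with the induced $d$ and $\wedge$. Let $\mathcal L=\mathcal I/\mathcal I^2$ and $\mathcal C^p_L=\mathcal Hom_{\mathcal O_L}(\bigwedge^p\mathcal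 L,\mathcal O_L)$, with the differential $$\delta(\phi)(h_1\wedge\dots\wedge h_{p+1})=\sum_{i}(-1)^i\{h_i,\phi(h_1\wedge\dots\widehat{h_i}\dots\wedge h_{p+1})\}+\sum_{i<j}(-1)^{i+j-1}\phi(\{h_i,h_j\}\wedge h_1\wedge\dots\widehat{h_i}\dots\widehat{h_j}\dots\wedge h_{p+1})$$ and the product $$(\Phi\wedge\Psi)(f_1\wedge\dots\wedge f_{p+q})=\sum \operatorname{sgn}(i_1,\dots,i_p,j_1,\dots,j_q)\,\Phi(f_{i_1}\wedge\dots\wedge f_{i_p})\,\Psi(f_{j_1}\wedge\dots\wedge f_{j_q}),$$ the sum being over all disjoint decompositions $\{i_1<\dots<i_p\}\sqcup\{j_1<\dots<j_q\}=\{1,\dots,p+q\}$. Then there is an $\mathcal O_L$-linear morphism of sheaves of differential graded algebras $$J:(\Omega^\bullet_L,d,\wedge)\longrightarrow(\mathcal C^\bullet_L,\delta,\wedge),$$ equal to the identity of $\mathcal O_L$ in degree $0$ and given by $J(df)=(g\mapsto\{f,g\})$ on exact $1$-forms, and for every smooth point $p$ of $L$ it is an isomorphism of sheaves, in every degree, on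 a neighbourhood of $p$. -/

import Mathlib

set_option linter.unusedSectionVars false

namespace LagrangianDeRham

section Algebroid

variable {A N : Type*} [CommRing A] [AddCommGroup N] [Module A N]

/-- The wedge product of alternating forms. `AlternatingMap.domCoprod` is the sum over all
`(k, l)`-shuffles with their signs, so that `altWedge Φ Ψ v` is the sum over all
`i_1 < ... < i_k`, `j_1 < ... < j_l` of `sgn (I, J) * Φ (v_I) * Ψ (v_J)`. -/
noncomputable def altWedge {k l : ℕ} (Φ : N [⋀^Fin k]→ₗ[A] A) (Ψ : N [⋀^Fin l]→ₗ[A] A) :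
    N [⋀^Fin (k + l)]→ₗ[A] A :=
  ((LinearMap.mul' A A).compAlternatingMap (Φ.domCoprod Ψ)).domDomCongr finSumFinEquiv

variable (A N) in
/-- The data that the differential of a Lie algebroid is built from: an `A`-module `N` that acts on
`A` by derivations, and an alternating bracket on `N` that satisfies the Leibniz rule. -/
structure AnchoredBracket where
  anchor : N →+ A →+ A
  bracket : N →+ N →+ N
  anchor_smul : ∀ a x b, anchor (a • x) b = a * anchor x b
  anchor_mul : ∀ x a b, anchor x (a * b) = a * anchor x b + b * anchor x a
  bracket_self : ∀ x, bracket x x = 0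
  bracket_smul : ∀ x a y, bracket x (a • y) = a • bracket x y + anchor x a • y

namespace AnchoredBracket

variable (B : AnchoredBracket A N)

theorem bracket_swap (x y : N) : B.bracket x y = -B.bracket y x := by
  have h := B.bracket_self (x + y)
  simp only [map_add, AddMonoidHom.add_apply, B.bracket_self, zero_add, add_zero] at h
  exact eq_neg_of_add_eq_zero_right h

/-- The formula for the differential. For `h_1, ..., h_{k+1}` it is
`∑_i (-1)^i {h_i, φ(.., ĥ_i, ..)} + ∑_{i<j} (-1)^{i+j-1} φ({h_i, h_j}, .., ĥ_i, .., ĥ_j, ..)`.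
Here the indices start at `0`, which gives the sign `(-1)^(i+1)` in the first sum; a pair of
positions `i < j'` is written as `i.castSucc`, `j.succ` with `i ≤ j`, which gives the sign
`(-1)^(i+j)` in the second one. In degree `k = 0` the second sum is empty. -/
def diffFun : ∀ {k : ℕ}, (N [⋀^Fin k]→ₗ[A] A) → (Fin (k + 1) → N) → A
  | 0, φ, h => ∑ i, (-1) ^ (i.val + 1) * B.anchor (h i) (φ (i.removeNth h))
  | k + 1, φ, h =>
      (∑ i, (-1) ^ (i.val + 1) * B.anchor (h i) (φ (i.removeNth h))) +
        ∑ i : Fin (k + 1), ∑ j ≥ i, (-1) ^ (i.val + j.val) *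
          φ (Fin.cons (B.bracket (h i.castSucc) (h j.succ))
            (j.removeNth (i.castSucc.removeNth h)))

/-- `φ` as a map that is alternating over `ℤ` only. -/
def intAlt {k : ℕ} (φ : N [⋀^Fin k]→ₗ[A] A) : N [⋀^Fin k]→ₗ[ℤ] A :=
  { φ.toMultilinearMap.restrictScalars ℤ with
    map_eq_zero_of_eq' := fun v _ _ h hij => φ.map_eq_zero_of_eq v h hij }

/-- `x ↦ (v ↦ {x, φ v})`, additive in every entry. -/
noncomputable def aux1 {k : ℕ} (φ : N [⋀^Fin k]→ₗ[A] A) : N →ₗ[ℤ] N [⋀^Fin k]→ₗ[ℤ] A :=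
  AddMonoidHom.toIntLinearMap
    { toFun := fun x => (B.anchor x).toIntLinearMap.compAlternatingMap (intAlt φ)
      map_zero' := by ext; simp
      map_add' := fun x y => by ext; simp }

/-- `(x, y) ↦ (v ↦ φ({x, y}, v))`, additive in every entry. -/
noncomputable def aux2 {k : ℕ} (φ : N [⋀^Fin (k + 1)]→ₗ[A] A) :
    N →ₗ[ℤ] N →ₗ[ℤ] N [⋀^Fin k]→ₗ[ℤ] A :=
  AddMonoidHom.toIntLinearMap
    { toFun := fun x => (intAlt φ).curryLeft ∘ₗ (B.bracket x).toIntLinearMap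
      map_zero' := by ext; simp
      map_add' := fun x y => by
        ext z v
        simp only [map_add, AddMonoidHom.coe_toIntLinearMap, LinearMap.comp_apply,
          AddMonoidHom.add_apply, LinearMap.add_apply] }

theorem two_mul_aux {k : ℕ} (φ : N [⋀^Fin (k + 1)]→ₗ[A] A) (h : Fin (k + 2) → N) :
    AlternatingMap.alternatizeUncurryFin
      (AlternatingMap.alternatizeUncurryFinLM ∘ₗ B.aux2 φ) h =
    2 * ∑ i : Fin (k + 1), ∑ j ≥ i, (-1) ^ (i.val + j.val) *
          φ (Fin.cons (B.bracket (h i.castSucc) (h j.succ))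
            (j.removeNth (i.castSucc.removeNth h))) := by
  rw [AlternatingMap.alternatizeUncurryFin_alternatizeUncurryFinLM_comp_apply, Finset.mul_sum]
  refine Finset.sum_congr rfl fun i _ => ?_
  rw [Finset.mul_sum]
  refine Finset.sum_congr rfl fun j _ => ?_
  have e : ∀ x y (v : Fin k → N), B.aux2 φ x y v = φ (Fin.cons (B.bracket x y) v) := fun _ _ _ => rfl
  have e2 : ∀ x (v : Fin k → N), φ (Fin.cons (-x) v) = -φ (Fin.cons x v) := fun x v => by
    have := φ.curryLeft.map_neg x
    exact congrArg (fun f => f v) this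
  rw [e, e, B.bracket_swap (h j.succ), e2]
  simp only [zsmul_eq_mul]
  push_cast
  ring

theorem exists_int_alternating (h2 : IsUnit (2 : A)) {k : ℕ} (φ : N [⋀^Fin k]→ₗ[A] A) :
    ∃ F : N [⋀^Fin (k + 1)]→ₗ[ℤ] A, ∀ h, F h = B.diffFun φ h := by
  obtain ⟨u, hu⟩ := h2
  have t1 : ∀ h : Fin (k + 1) → N, (-AlternatingMap.alternatizeUncurryFin (B.aux1 φ)) h =
      ∑ i, (-1) ^ (i.val + 1) * B.anchor (h i) (φ (i.removeNth h)) := by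
    intro h
    simp only [AlternatingMap.neg_apply, AlternatingMap.alternatizeUncurryFin_apply,
      ← Finset.sum_neg_distrib]
    refine Finset.sum_congr rfl fun i _ => ?_
    have e : B.aux1 φ (h i) (i.removeNth h) = B.anchor (h i) (φ (i.removeNth h)) := rfl
    rw [e, zsmul_eq_mul, pow_succ]
    push_cast
    ring
  cases k with
  | zero => exact ⟨_, t1⟩
  | succ k =>
    refine ⟨-AlternatingMap.alternatizeUncurryFin (B.aux1 φ) +
      (LinearMap.mulLeft ℤ (↑u⁻¹ : A)).compAlternatingMap
        (AlternatingMap.alternatizeUncurryFin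
      (AlternatingMap.alternatizeUncurryFinLM ∘ₗ B.aux2 φ)), fun h => ?_⟩
    rw [AlternatingMap.add_apply, t1, LinearMap.compAlternatingMap_apply, two_mul_aux,
      LinearMap.mulLeft_apply, ← mul_assoc, ← hu, Units.inv_mul, one_mul]
    rfl

theorem map_cons_smul {k : ℕ} (φ : N [⋀^Fin (k + 1)]→ₗ[A] A) (a : A) (x : N) (v : Fin k → N) :
    φ (Fin.cons (a • x) v) = a * φ (Fin.cons x v) :=
  congrArg (fun f => f v) (φ.curryLeft.map_smul a x)

theorem map_cons_add {k : ℕ} (φ : N [⋀^Fin (k + 1)]→ₗ[A] A) (x y : N) (v : Fin k → N) :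
    φ (Fin.cons (x + y) v) = φ (Fin.cons x v) + φ (Fin.cons y v) :=
  congrArg (fun f => f v) (φ.curryLeft.map_add x y)

theorem diffFun_cons_smul {k : ℕ} (φ : N [⋀^Fin k]→ₗ[A] A) (a : A) (x : N) (v : Fin k → N) :
    B.diffFun φ (Fin.cons (a • x) v) = a * B.diffFun φ (Fin.cons x v) := by
  have hr : ∀ {m : ℕ} (y : N) (w : Fin (m + 1) → N) (i : Fin (m + 1)),
      i.succ.removeNth (Fin.cons y w : Fin (m + 2) → N) = Fin.cons y (i.removeNth w) := by
    intro m y w i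
    ext l
    refine Fin.cases ?_ (fun l => ?_) l <;> simp [Fin.removeNth]
  cases k with
  | zero => simp [diffFun, B.anchor_smul]
  | succ k =>
    have key : ∀ y : N, B.diffFun φ (Fin.cons y v) =
        -(B.anchor y (φ v)) + ∑ i : Fin (k + 1), (-1) ^ (i.val) *
          (B.anchor (v i) (φ (Fin.cons y (i.removeNth v))) +
            φ (Fin.cons (B.bracket y (v i)) (i.removeNth v))) +
        ∑ i : Fin k, ∑ j : Fin (k + 1), if i.succ ≤ j then (-1) ^ (i.succ.val + j.val) *
          φ (Fin.cons (B.bracket (v i.castSucc) (v j))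
            (j.removeNth (Fin.cons y (i.castSucc.removeNth v) : Fin (k + 1) → N))) else 0 := by
      intro y
      have h1 : ∑ i : Fin (k + 2), (-1) ^ (i.val + 1) *
          B.anchor ((Fin.cons y v : Fin (k + 2) → N) i)
            (φ (i.removeNth (Fin.cons y v : Fin (k + 2) → N))) =
          -(B.anchor y (φ v)) + ∑ i : Fin (k + 1), (-1) ^ (i.val) *
            B.anchor (v i) (φ (Fin.cons y (i.removeNth v))) := by
        rw [Fin.sum_univ_succ]
        simp only [hr, Fin.cons_zero, Fin.cons_succ, Fin.removeNth_zero, Fin.tail_cons,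
          Fin.val_zero, Fin.val_succ, pow_succ]
        simp
      have h2 : ∑ i : Fin (k + 1), ∑ j ≥ i, (-1) ^ (i.val + j.val) *
          φ (Fin.cons (B.bracket ((Fin.cons y v : Fin (k + 2) → N) i.castSucc)
              ((Fin.cons y v : Fin (k + 2) → N) j.succ))
            (j.removeNth (i.castSucc.removeNth (Fin.cons y v : Fin (k + 2) → N)))) =
          ∑ i : Fin (k + 1), (-1) ^ (i.val) *
            φ (Fin.cons (B.bracket y (v i)) (i.removeNth v)) +
          ∑ i : Fin k, ∑ j : Fin (k + 1), if i.succ ≤ j then (-1) ^ (i.succ.val + j.val) *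
            φ (Fin.cons (B.bracket (v i.castSucc) (v j))
              (j.removeNth (Fin.cons y (i.castSucc.removeNth v) : Fin (k + 1) → N))) else 0 := by
        have hge : ∀ (i : Fin (k + 1)) (f : Fin (k + 1) → A),
            ∑ j ≥ i, f j = ∑ j, if i ≤ j then f j else 0 := by
          intro i f
          rw [← Finset.sum_filter]
          congr 1
          ext
          simp
        simp only [hge]
        rw [Fin.sum_univ_succ]
        congr 1
        · simp [Fin.removeNth_zero, Fin.tail_cons]
        · refine Finset.sum_congr rfl fun i _ => Finset.sum_congr rfl fun j _ => ?_
          have hc : i.succ.castSucc = i.castSucc.succ := rfl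
          simp only [hc, hr, Fin.cons_succ]
      simp only [mul_add, Finset.sum_add_distrib]
      rw [diffFun, h1, h2]
      ring
    have key2 : ∀ (i : Fin k) (j : Fin (k + 1)), i.succ ≤ j →
          φ (Fin.cons (B.bracket (v i.castSucc) (v j))
            (j.removeNth (Fin.cons (a • x) (i.castSucc.removeNth v) : Fin (k + 1) → N)))
          = a * φ (Fin.cons (B.bracket (v i.castSucc) (v j))
            (j.removeNth (Fin.cons x (i.castSucc.removeNth v) : Fin (k + 1) → N))) := by
      intro i j hij
      cases k with
      | zero => exact i.elim0
      | succ k =>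
        obtain ⟨j, rfl⟩ : ∃ j', j = Fin.succ j' :=
          Fin.exists_succ_eq.2 (fun h => by subst h; simp at hij) |>.imp fun _ h => h.symm
        rw [hr, hr]
        have hu : ∀ (b y : N) (w : Fin k → N),
            (Fin.cons b (Fin.cons y w : Fin (k + 1) → N) : Fin (k + 2) → N) =
              Function.update (Fin.cons b (Fin.cons 0 w : Fin (k + 1) → N)) 1 y := by
          intro b y w
          ext l
          refine Fin.cases ?_ (fun l => Fin.cases ?_ (fun l => ?_) l) l
          · rw [Function.update_of_ne (by simp)]; rfl
          · have h01 : Fin.succ (0 : Fin (k + 1)) = 1 := rfl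
            rw [h01, Function.update_self]
            rfl
          · rw [Function.update_of_ne (by
              rw [Ne, ← Fin.succ_zero_eq_one, Fin.succ_inj]; exact Fin.succ_ne_zero l)]
            rfl
        rw [hu, hu _ x, φ.map_update_smul, smul_eq_mul]
    rw [key, key, mul_add, mul_add, Finset.mul_sum]
    congr 1
    · have hb : ∀ y, B.bracket (a • x) y = a • B.bracket x y - B.anchor y a • x := by
        intro y
        rw [B.bracket_swap, B.bracket_smul, B.bracket_swap y x]
        simp only [smul_neg, neg_add, neg_neg, sub_eq_add_neg]
      have hn : ∀ (b c : N) (w : Fin k → N),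
          φ (Fin.cons (b - c) w) = φ (Fin.cons b w) - φ (Fin.cons c w) := fun b c w =>
        congrArg (fun f => f w) (φ.curryLeft.map_sub b c)
      congr 1
      · rw [B.anchor_smul]; ring
      · refine Finset.sum_congr rfl fun i _ => ?_
        rw [map_cons_smul, hb, hn, map_cons_smul, map_cons_smul, B.anchor_mul]
        ring
    · rw [Finset.mul_sum]
      refine Finset.sum_congr rfl fun i _ => ?_
      rw [Finset.mul_sum]
      refine Finset.sum_congr rfl fun j _ => ?_
      split_ifs with h
      · rw [key2 i j h]; ring
      · simp

/-- The differential on alternating forms, given by `diffFun`. -/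
noncomputable def diff (h2 : IsUnit (2 : A)) {k : ℕ} (φ : N [⋀^Fin k]→ₗ[A] A) :
    N [⋀^Fin (k + 1)]→ₗ[A] A where
  toFun := B.diffFun φ
  map_update_add' := by
    intro inst h i x y
    obtain ⟨F, hF⟩ := B.exists_int_alternating h2 φ
    rw [← hF, ← hF, ← hF]
    convert F.map_update_add h i x y
  map_update_smul' := by
    intro inst h i a x
    obtain ⟨F, hF⟩ := B.exists_int_alternating h2 φ
    have hins : ∀ y : N, B.diffFun φ (Function.update h i y) =
        (-1) ^ i.val • B.diffFun φ (Fin.cons y (i.removeNth h)) := by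
      intro y
      rw [← hF, ← hF, Subsingleton.elim inst (instDecidableEqFin _), ← Fin.insertNth_removeNth,
        AlternatingMap.map_insertNth]
      rfl
    show B.diffFun φ _ = a • B.diffFun φ _
    rw [hins, hins, diffFun_cons_smul, smul_eq_mul, mul_smul_comm]
  map_eq_zero_of_eq' := by
    intro h i j hij hne
    obtain ⟨F, hF⟩ := B.exists_int_alternating h2 φ
    show B.diffFun φ h = 0
    rw [← hF]
    exact F.map_eq_zero_of_eq h hij hne

end AnchoredBracket
end Algebroid

section Conormal

/-- A skew-symmetric biderivation of a commutative ring. -/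
structure SkewBiderivation (R : Type*) [CommRing R] where
  toFun : R →+ R →+ R
  self : ∀ f, toFun f f = 0
  mul_right : ∀ f g h, toFun f (g * h) = g * toFun f h + h * toFun f g

namespace SkewBiderivation

variable {R : Type*} [CommRing R] (β : SkewBiderivation R) {I : Ideal R}

theorem swap (f g : R) : β.toFun f g = -β.toFun g f := by
  have h := β.self (f + g)
  simp only [map_add, AddMonoidHom.add_apply, β.self, zero_add, add_zero] at h
  exact eq_neg_of_add_eq_zero_right h

theorem mul_left (f g h : R) : β.toFun (f * g) h = f * β.toFun g h + g * β.toFun f h := by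
  rw [β.swap, β.mul_right, β.swap h g, β.swap h f]; ring

theorem mem_sq (hI : ∀ f ∈ I, ∀ g ∈ I, β.toFun f g ∈ I)
    {f g : R} (hf : f ∈ I) (hg : g ∈ I ^ 2) : β.toFun f g ∈ I ^ 2 := by
  rw [pow_two] at hg ⊢
  refine Submodule.smul_induction_on hg (fun a ha b hb => ?_) (fun a b ha hb => ?_)
  · rw [smul_eq_mul, β.mul_right]
    exact add_mem (Ideal.mul_mem_mul ha (hI f hf b hb)) (Ideal.mul_mem_mul hb (hI f hf a ha))
  · rw [map_add]; exact add_mem ha hb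

theorem mem_of_sq {f : R} (g : R) (hf : f ∈ I ^ 2) : β.toFun f g ∈ I := by
  rw [pow_two] at hf
  refine Submodule.smul_induction_on hf (fun a ha b hb => ?_) (fun a b ha hb => ?_)
  · rw [smul_eq_mul, β.mul_left]
    exact add_mem (I.mul_mem_right _ ha) (I.mul_mem_right _ hb)
  · rw [map_add, AddMonoidHom.add_apply]; exact add_mem ha hb

variable (hI : ∀ f ∈ I, ∀ g ∈ I, β.toFun f g ∈ I)

/-- The operation `I / I² × R / I → R / I` induced by `β`, through representatives; see
`conormalAnchorFun_mk`. -/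
noncomputable def conormalAnchorFun (x : I.Cotangent) (a : R ⧸ I) : R ⧸ I :=
  Ideal.Quotient.mk I (β.toFun (Function.surjInv I.toCotangent_surjective x : I)
    (Function.surjInv Ideal.Quotient.mk_surjective a))

theorem conormalAnchorFun_mk (hI : ∀ f ∈ I, ∀ g ∈ I, β.toFun f g ∈ I) (g : I) (f : R) :
    β.conormalAnchorFun (I.toCotangent g) (Ideal.Quotient.mk I f) =
      Ideal.Quotient.mk I (β.toFun g f) := by
  have h1 := Function.surjInv_eq I.toCotangent_surjective (I.toCotangent g)
  have h2 := Function.surjInv_eq (Ideal.Quotient.mk_surjective (I := I)) (Ideal.Quotient.mk I f)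
  rw [Ideal.toCotangent_eq] at h1
  rw [Ideal.Quotient.eq] at h2
  unfold conormalAnchorFun
  set g' := Function.surjInv I.toCotangent_surjective (I.toCotangent g)
  set f' := Function.surjInv (Ideal.Quotient.mk_surjective (I := I)) (Ideal.Quotient.mk I f)
  rw [Ideal.Quotient.eq]
  have e : β.toFun (g' : R) f' - β.toFun (g : R) f =
      β.toFun (g' - g : R) f' + β.toFun g (f' - f) := by
    simp only [map_sub, AddMonoidHom.sub_apply]; ring
  rw [e]
  exact add_mem (β.mem_of_sq _ h1) (hI _ g.2 _ h2)

/-- The operation `I / I² × I / I² → I / I²` induced by `β`, through representatives; see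
`conormalBracketFun_mk`. -/
noncomputable def conormalBracketFun (x y : I.Cotangent) : I.Cotangent :=
  I.toCotangent ⟨β.toFun (Function.surjInv I.toCotangent_surjective x : I)
    (Function.surjInv I.toCotangent_surjective y : I), hI _ (Subtype.mem _) _ (Subtype.mem _)⟩

theorem conormalBracketFun_mk (g h : I) :
    β.conormalBracketFun hI (I.toCotangent g) (I.toCotangent h) =
      I.toCotangent ⟨β.toFun g h, hI _ g.2 _ h.2⟩ := by
  have h1 := Function.surjInv_eq I.toCotangent_surjective (I.toCotangent g)
  have h2 := Function.surjInv_eq I.toCotangent_surjective (I.toCotangent h)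
  rw [Ideal.toCotangent_eq] at h1 h2
  unfold conormalBracketFun
  set g' := Function.surjInv I.toCotangent_surjective (I.toCotangent g)
  set h' := Function.surjInv I.toCotangent_surjective (I.toCotangent h)
  rw [Ideal.toCotangent_eq]
  have e : β.toFun (g' : R) h' - β.toFun (g : R) h =
      -β.toFun h' (g' - g : R) + β.toFun g (h' - h : R) := by
    rw [← β.swap]
    simp only [map_sub, AddMonoidHom.sub_apply]; ring
  show β.toFun (g' : R) h' - β.toFun (g : R) h ∈ I ^ 2
  rw [e]
  exact add_mem (neg_mem (β.mem_sq hI h'.2 h1)) (β.mem_sq hI g.2 h2)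

theorem mk_smul_toCotangent (r : R) (g : I) :
    Ideal.Quotient.mk I r • I.toCotangent g = I.toCotangent (r • g) := rfl

theorem conormalBracketFun_self (x : I.Cotangent) : β.conormalBracketFun hI x x = 0 := by
  obtain ⟨g, rfl⟩ := I.toCotangent_surjective x
  rw [β.conormalBracketFun_mk hI, Ideal.toCotangent_eq_zero]
  show β.toFun g g ∈ I ^ 2
  rw [β.self]
  exact zero_mem _

theorem conormalBracketFun_smul (x : I.Cotangent) (a : R ⧸ I) (y : I.Cotangent) :
    β.conormalBracketFun hI x (a • y) =
      a • β.conormalBracketFun hI x y + β.conormalAnchorFun x a • y := by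
  obtain ⟨g, rfl⟩ := I.toCotangent_surjective x
  obtain ⟨h, rfl⟩ := I.toCotangent_surjective y
  obtain ⟨a, rfl⟩ := Ideal.Quotient.mk_surjective a
  rw [β.conormalAnchorFun_mk hI, mk_smul_toCotangent, β.conormalBracketFun_mk hI,
    β.conormalBracketFun_mk hI, mk_smul_toCotangent, mk_smul_toCotangent, ← map_add]
  congr 1
  ext
  show β.toFun g (a * h) = a * β.toFun g h + β.toFun g a * h
  rw [β.mul_right]
  ring

/-- The action of `I / I²` on `R / I` and the bracket on `I / I²` that `β` induces if
`β(I, I) ⊆ I`. -/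
noncomputable def conormalAlgebroid : AnchoredBracket (R ⧸ I) I.Cotangent where
  anchor := AddMonoidHom.mk'
    (fun x => AddMonoidHom.mk' (β.conormalAnchorFun x) fun a b => by
      obtain ⟨g, rfl⟩ := I.toCotangent_surjective x
      obtain ⟨a, rfl⟩ := Ideal.Quotient.mk_surjective a
      obtain ⟨b, rfl⟩ := Ideal.Quotient.mk_surjective b
      simp only [← map_add, β.conormalAnchorFun_mk hI])
    fun x y => by
      ext a
      obtain ⟨g, rfl⟩ := I.toCotangent_surjective x
      obtain ⟨h, rfl⟩ := I.toCotangent_surjective y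
      simp only [AddMonoidHom.mk'_apply, AddMonoidHom.add_apply]
      obtain ⟨a, rfl⟩ := Ideal.Quotient.mk_surjective a
      rw [← map_add, β.conormalAnchorFun_mk hI, β.conormalAnchorFun_mk hI,
        β.conormalAnchorFun_mk hI, ← map_add]
      simp
  anchor_smul r x a := by
    obtain ⟨g, rfl⟩ := I.toCotangent_surjective x
    obtain ⟨r, rfl⟩ := Ideal.Quotient.mk_surjective r
    obtain ⟨a, rfl⟩ := Ideal.Quotient.mk_surjective a
    simp only [AddMonoidHom.mk'_apply, mk_smul_toCotangent]
    rw [β.conormalAnchorFun_mk hI, β.conormalAnchorFun_mk hI, ← map_mul, Ideal.Quotient.eq]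
    simp only [Submodule.coe_smul, smul_eq_mul, β.mul_left, add_sub_cancel_left]
    exact I.mul_mem_right _ g.2
  anchor_mul x a b := by
    obtain ⟨g, rfl⟩ := I.toCotangent_surjective x
    obtain ⟨a, rfl⟩ := Ideal.Quotient.mk_surjective a
    obtain ⟨b, rfl⟩ := Ideal.Quotient.mk_surjective b
    simp only [AddMonoidHom.mk'_apply, ← map_mul, β.conormalAnchorFun_mk hI, β.mul_right,
      ← map_add]
  bracket := AddMonoidHom.mk'
    (fun x => AddMonoidHom.mk' (β.conormalBracketFun hI x) fun y z => by
      obtain ⟨g, rfl⟩ := I.toCotangent_surjective x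
      obtain ⟨h, rfl⟩ := I.toCotangent_surjective y
      obtain ⟨k, rfl⟩ := I.toCotangent_surjective z
      simp only [← map_add, β.conormalBracketFun_mk hI]
      congr 1; ext; simp)
    fun y z => by
      ext x
      obtain ⟨g, rfl⟩ := I.toCotangent_surjective x
      obtain ⟨h, rfl⟩ := I.toCotangent_surjective y
      obtain ⟨k, rfl⟩ := I.toCotangent_surjective z
      simp only [AddMonoidHom.mk'_apply, AddMonoidHom.add_apply, ← map_add,
        β.conormalBracketFun_mk hI]
      congr 1; ext; simp
  bracket_self := β.conormalBracketFun_self hI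
  bracket_smul := β.conormalBracketFun_smul hI

end SkewBiderivation
end Conormal

section Forms

open Filter
open scoped Topology Manifold ContDiff

variable {𝕜 : Type*} [NontriviallyNormedField 𝕜] [IsRCLikeNormedField 𝕜]
variable {E : Type*} [NormedAddCommGroup E] [NormedSpace 𝕜 E]

theorem altWedge_bound {k l : ℕ} (η : E [⋀^Fin k]→L[𝕜] 𝕜) (ζ : E [⋀^Fin l]→L[𝕜] 𝕜)
    (v : Fin (k + l) → E) :
    ‖altWedge η.toAlternatingMap ζ.toAlternatingMap v‖ ≤
      (Fintype.card (Equiv.Perm.ModSumCongr (Fin k) (Fin l)) * ‖η‖ * ‖ζ‖) * ∏ i, ‖v i‖ := by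
  have h1 : altWedge η.toAlternatingMap ζ.toAlternatingMap v =
      ∑ σ : Equiv.Perm.ModSumCongr (Fin k) (Fin l), LinearMap.mul' 𝕜 𝕜
        (AlternatingMap.domCoprod.summand η.toAlternatingMap ζ.toAlternatingMap σ
          (fun i => v (finSumFinEquiv i))) := by
    simp only [altWedge, AlternatingMap.domDomCongr_apply, LinearMap.compAlternatingMap_apply,
      AlternatingMap.domCoprod_apply, sum_apply, map_sum]
    rfl
  rw [h1, mul_assoc, mul_assoc, ← nsmul_eq_mul, ← Finset.card_univ]
  refine (norm_sum_le _ _).trans (Finset.sum_le_card_nsmul _ _ _ fun σ _ => ?_)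
  induction σ using Quotient.inductionOn' with | _ σ
  rw [AlternatingMap.domCoprod.summand_mk'']
  have h2 : ∏ i, ‖v i‖ = (∏ i, ‖v (finSumFinEquiv (σ (Sum.inl i)))‖) *
      ∏ i, ‖v (finSumFinEquiv (σ (Sum.inr i)))‖ := by
    rw [← Fintype.prod_sumElim (fun i => ‖v (finSumFinEquiv (σ (Sum.inl i)))‖)
      (fun i => ‖v (finSumFinEquiv (σ (Sum.inr i)))‖),
      ← Equiv.prod_comp (σ.trans finSumFinEquiv) (fun i => ‖v i‖)]
    refine Finset.prod_congr rfl fun i _ => ?_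
    cases i <;> rfl
  have h3 : ‖LinearMap.mul' 𝕜 𝕜 ((Equiv.Perm.sign σ •
      (MultilinearMap.domCoprod (η.toAlternatingMap : MultilinearMap 𝕜 (fun _ => E) 𝕜)
        (ζ.toAlternatingMap : MultilinearMap 𝕜 (fun _ => E) 𝕜)).domDomCongr σ)
        fun i => v (finSumFinEquiv i))‖ =
      ‖η fun i => v (finSumFinEquiv (σ (Sum.inl i)))‖ *
        ‖ζ fun i => v (finSumFinEquiv (σ (Sum.inr i)))‖ := by
    rcases Int.units_eq_one_or (Equiv.Perm.sign σ) with h | h <;> simp [h]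
  rw [h3, h2]
  calc _ ≤ (‖η‖ * ∏ i, ‖v (finSumFinEquiv (σ (Sum.inl i)))‖) *
        (‖ζ‖ * ∏ i, ‖v (finSumFinEquiv (σ (Sum.inr i)))‖) := by
        gcongr
        · exact η.le_opNorm _
        · exact ζ.le_opNorm _
    _ = _ := by ring

/-- The wedge product of continuous alternating forms. -/
noncomputable def wedge {k l : ℕ} (η : E [⋀^Fin k]→L[𝕜] 𝕜) (ζ : E [⋀^Fin l]→L[𝕜] 𝕜) :
    E [⋀^Fin (k + l)]→L[𝕜] 𝕜 :=
  (altWedge η.toAlternatingMap ζ.toAlternatingMap).mkContinuous _ (altWedge_bound η ζ)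

theorem altWedge_eq_sum {A N : Type*} [CommRing A] [AddCommGroup N] [Module A N]
    {k l : ℕ} (Φ : N [⋀^Fin k]→ₗ[A] A) (Ψ : N [⋀^Fin l]→ₗ[A] A) (v : Fin (k + l) → N) :
    altWedge Φ Ψ v = LinearMap.mul' A A (Φ.domCoprod Ψ (fun i => v (finSumFinEquiv i))) := rfl

theorem isBoundedBilinearMap_wedge (k l : ℕ) :
    IsBoundedBilinearMap 𝕜 (fun p : (E [⋀^Fin k]→L[𝕜] 𝕜) × (E [⋀^Fin l]→L[𝕜] 𝕜) =>
      wedge p.1 p.2) where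
  add_left η η' ζ := by
    ext v
    show altWedge (η.toAlternatingMap + η'.toAlternatingMap) _ v =
      altWedge _ _ v + altWedge _ _ v
    simp only [altWedge_eq_sum, ← map_add, ← AlternatingMap.domCoprod'_apply,
      TensorProduct.add_tmul]
    rfl
  smul_left c η ζ := by
    ext v
    show altWedge (c • η.toAlternatingMap) _ v = c • altWedge _ _ v
    simp only [altWedge_eq_sum, ← AlternatingMap.domCoprod'_apply,
      ← TensorProduct.smul_tmul', map_smul]
    exact map_smul (LinearMap.mul' 𝕜 𝕜) c _
  add_right η ζ ζ' := by
    ext v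
    show altWedge _ (ζ.toAlternatingMap + ζ'.toAlternatingMap) v =
      altWedge _ _ v + altWedge _ _ v
    simp only [altWedge_eq_sum, ← map_add, ← AlternatingMap.domCoprod'_apply,
      TensorProduct.tmul_add]
    rfl
  smul_right c η ζ := by
    ext v
    show altWedge _ (c • ζ.toAlternatingMap) v = c • altWedge _ _ v
    simp only [altWedge_eq_sum, ← AlternatingMap.domCoprod'_apply,
      TensorProduct.tmul_smul, map_smul]
    exact map_smul (LinearMap.mul' 𝕜 𝕜) c _
  bound := by
    refine ⟨Fintype.card (Equiv.Perm.ModSumCongr (Fin k) (Fin l)) + 1, by positivity,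
      fun η ζ => ?_⟩
    refine ContinuousAlternatingMap.opNorm_le_bound _ (by positivity) fun v => ?_
    refine (altWedge_bound η ζ v).trans ?_
    gcongr
    simp

theorem wedge_compContinuousLinearMap {k l : ℕ} (η : E [⋀^Fin k]→L[𝕜] 𝕜)
    (ζ : E [⋀^Fin l]→L[𝕜] 𝕜) (T : E →L[𝕜] E) :
    (wedge η ζ).compContinuousLinearMap T =
      wedge (η.compContinuousLinearMap T) (ζ.compContinuousLinearMap T) := by
  ext v
  show altWedge _ _ _ = altWedge _ _ _
  simp only [altWedge_eq_sum, AlternatingMap.domCoprod_apply, sum_apply]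
  congr 1
  refine Finset.sum_congr rfl fun σ _ => ?_
  induction σ using Quotient.inductionOn' with | _ σ
  rfl

variable {M : Type*} [TopologicalSpace M] [ChartedSpace E M] [IsManifold 𝓘(𝕜, E) ∞ M]

/-- A `k`-form on `M` is a function `M → E [⋀^Fin k]→L[𝕜] 𝕜`, its value at `x` being a form on the
tangent space at `x`, which Mathlib identifies with `E` through the preferred chart at `x`.
`formInChart p η` is the form on `E` that expresses `η` in the chart at `p`, i.e. the pullback of `η`
under the inverse of this chart. -/
noncomputable def formInChart {k : ℕ} (p : M) (η : M → E [⋀^Fin k]→L[𝕜] 𝕜) (y : E) :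
    E [⋀^Fin k]→L[𝕜] 𝕜 :=
  (η ((extChartAt 𝓘(𝕜, E) p).symm y)).compContinuousLinearMap
    (tangentCoordChange 𝓘(𝕜, E) p ((extChartAt 𝓘(𝕜, E) p).symm y)
      ((extChartAt 𝓘(𝕜, E) p).symm y))

/-- The exterior derivative of a form on a manifold, computed at `x` in the chart at `x`. -/
noncomputable def mextDeriv {k : ℕ} (η : M → E [⋀^Fin k]→L[𝕜] 𝕜) (x : M) :
    E [⋀^Fin (k + 1)]→L[𝕜] 𝕜 :=
  extDeriv (formInChart x η) (extChartAt 𝓘(𝕜, E) x x)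

/-- `η` is a smooth form on a neighbourhood of `p`. -/
def SmoothFormAt {k : ℕ} (η : M → E [⋀^Fin k]→L[𝕜] 𝕜) (p : M) : Prop :=
  ∀ᶠ q in 𝓝 p, ContDiffAt 𝕜 ∞ (formInChart q η) (extChartAt 𝓘(𝕜, E) q q)

theorem formInChart_congr {k : ℕ} {η η' : M → E [⋀^Fin k]→L[𝕜] 𝕜} {q x : M}
    (hx : x ∈ (extChartAt 𝓘(𝕜, E) q).source) (h : η =ᶠ[𝓝 x] η') :
    formInChart q η =ᶠ[𝓝 (extChartAt 𝓘(𝕜, E) q x)] formInChart q η' := by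
  have hc := continuousAt_extChartAt_symm' (I := 𝓘(𝕜, E)) hx
  unfold ContinuousAt at hc
  rw [(extChartAt 𝓘(𝕜, E) q).left_inv hx] at hc
  filter_upwards [hc.eventually h] with y hy
  simp only [formInChart, hy]

theorem formInChart_change {k : ℕ} (η : M → E [⋀^Fin k]→L[𝕜] 𝕜) {q x : M}
    (hx : x ∈ (extChartAt 𝓘(𝕜, E) q).source) :
    formInChart q η =ᶠ[𝓝 (extChartAt 𝓘(𝕜, E) q x)] fun y =>
      (formInChart x η ((extChartAt 𝓘(𝕜, E) x ∘ (extChartAt 𝓘(𝕜, E) q).symm) y)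
        ).compContinuousLinearMap
          (fderiv 𝕜 (extChartAt 𝓘(𝕜, E) x ∘ (extChartAt 𝓘(𝕜, E) q).symm) y) := by
  have hc := continuousAt_extChartAt_symm' (I := 𝓘(𝕜, E)) hx
  unfold ContinuousAt at hc
  rw [(extChartAt 𝓘(𝕜, E) q).left_inv hx] at hc
  filter_upwards [hc.eventually (extChartAt_source_mem_nhds (I := 𝓘(𝕜, E)) x),
    hc.eventually (extChartAt_source_mem_nhds' (I := 𝓘(𝕜, E)) hx),
    extChartAt_target_mem_nhds' (I := 𝓘(𝕜, E)) ((extChartAt 𝓘(𝕜, E) q).map_source hx)]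
    with y hy1 hy2 hy3
  ext v
  simp only [formInChart, Function.comp_apply, (extChartAt 𝓘(𝕜, E) x).left_inv hy1,
    ContinuousAlternatingMap.compContinuousLinearMap_apply]
  congr 1
  ext i
  simp only [Function.comp_apply]
  set z := (extChartAt 𝓘(𝕜, E) q).symm y with hz
  have e : fderiv 𝕜 (extChartAt 𝓘(𝕜, E) x ∘ (extChartAt 𝓘(𝕜, E) q).symm) y =
      tangentCoordChange 𝓘(𝕜, E) q x z := by
    rw [tangentCoordChange_def, hz, (extChartAt 𝓘(𝕜, E) q).right_inv hy3]
    simp [fderivWithin_univ]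
  rw [e, tangentCoordChange_comp]
  exact ⟨⟨hy2, hy1⟩, mem_extChartAt_source z⟩

theorem formInChart_mextDeriv {k : ℕ} {η : M → E [⋀^Fin k]→L[𝕜] 𝕜} {q x : M}
    (hx : x ∈ (extChartAt 𝓘(𝕜, E) q).source)
    (hη : ContDiffAt 𝕜 ∞ (formInChart x η) (extChartAt 𝓘(𝕜, E) x x)) :
    formInChart q (mextDeriv η) (extChartAt 𝓘(𝕜, E) q x) =
      extDeriv (formInChart q η) (extChartAt 𝓘(𝕜, E) q x) := by
  rw [(formInChart_change η hx).extDeriv_eq]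
  have hτ : ContDiffAt 𝕜 ∞ (extChartAt 𝓘(𝕜, E) x ∘ (extChartAt 𝓘(𝕜, E) q).symm)
      (extChartAt 𝓘(𝕜, E) q x) := by
    have := contDiffWithinAt_ext_coord_change (I := 𝓘(𝕜, E)) (n := ∞) x q
      (y := extChartAt 𝓘(𝕜, E) q x) (by
        rw [PartialEquiv.trans_source'', PartialEquiv.symm_symm, PartialEquiv.symm_target]
        exact Set.mem_image_of_mem _ ⟨hx, mem_extChartAt_source x⟩)
    simpa [contDiffWithinAt_univ] using this
  have hval : (extChartAt 𝓘(𝕜, E) x ∘ (extChartAt 𝓘(𝕜, E) q).symm) (extChartAt 𝓘(𝕜, E) q x) =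
      extChartAt 𝓘(𝕜, E) x x := by
    simp only [Function.comp_apply, (extChartAt 𝓘(𝕜, E) q).left_inv hx]
  rw [extDeriv_pullback (r := ∞) (by rw [hval]; exact hη.differentiableAt (by simp)) hτ
    (by simp only [minSmoothness_of_isRCLikeNormedField]; exact WithTop.coe_le_coe.2 le_top), hval]
  simp only [formInChart, (extChartAt 𝓘(𝕜, E) q).left_inv hx, tangentCoordChange_def]
  simp [fderivWithin_univ, mextDeriv]

theorem SmoothFormAt.mextDeriv {k : ℕ} {η : M → E [⋀^Fin k]→L[𝕜] 𝕜} {p : M}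
    (h : SmoothFormAt η p) : SmoothFormAt (mextDeriv η) p := by
  filter_upwards [h.eventually_nhds] with q hq
  have hs : ContDiffAt 𝕜 ∞ (extDeriv (formInChart q η)) (extChartAt 𝓘(𝕜, E) q q) := by
    unfold extDeriv
    have h1 := hq.self_of_nhds.fderiv_right (m := ∞) (by simp)
    exact (ContinuousAlternatingMap.alternatizeUncurryFinCLM 𝕜 E 𝕜).contDiff.contDiffAt.comp _ h1
  refine hs.congr_of_eventuallyEq ?_
  have hc := continuousAt_extChartAt_symm (I := 𝓘(𝕜, E)) q
  unfold ContinuousAt at hc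
  rw [extChartAt_to_inv] at hc
  filter_upwards [hc.eventually hq,
    hc.eventually (extChartAt_source_mem_nhds (I := 𝓘(𝕜, E)) q),
    extChartAt_target_mem_nhds (I := 𝓘(𝕜, E)) q] with y hy1 hy2 hy3
  have := formInChart_mextDeriv hy2 hy1
  rwa [(extChartAt 𝓘(𝕜, E) q).right_inv hy3] at this

end Forms

section Germs

open Filter
open scoped Topology Manifold ContDiff

variable {𝕜 : Type*} [NontriviallyNormedField 𝕜] [IsRCLikeNormedField 𝕜]
variable {E : Type*} [NormedAddCommGroup E] [NormedSpace 𝕜 E]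
variable {M : Type*} [TopologicalSpace M] [ChartedSpace E M] [IsManifold 𝓘(𝕜, E) ∞ M]

theorem formInChart_add {k : ℕ} (p : M) (η ζ : M → E [⋀^Fin k]→L[𝕜] 𝕜) :
    formInChart p (η + ζ) = formInChart p η + formInChart p ζ := rfl

theorem formInChart_smul {k : ℕ} (p : M) (f : M → 𝕜) (η : M → E [⋀^Fin k]→L[𝕜] 𝕜) :
    formInChart p (f • η) = (f ∘ (extChartAt 𝓘(𝕜, E) p).symm) • formInChart p η := rfl

theorem formInChart_wedge {k l : ℕ} (p : M) (η : M → E [⋀^Fin k]→L[𝕜] 𝕜)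
    (ζ : M → E [⋀^Fin l]→L[𝕜] 𝕜) :
    formInChart p (fun x => wedge (η x) (ζ x)) =
      fun y => wedge (formInChart p η y) (formInChart p ζ y) := by
  ext1 y
  exact wedge_compContinuousLinearMap _ _ _

variable (E) in
/-- `f` is smooth on a neighbourhood of `p`. -/
def SmoothFnAt (f : M → 𝕜) (p : M) : Prop :=
  ∀ᶠ q in 𝓝 p, ContMDiffAt 𝓘(𝕜, E) 𝓘(𝕜, 𝕜) ∞ f q

theorem contDiffAt_inChart {f : M → 𝕜} {q : M} (h : ContMDiffAt 𝓘(𝕜, E) 𝓘(𝕜, 𝕜) ∞ f q) :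
    ContDiffAt 𝕜 ∞ (f ∘ (extChartAt 𝓘(𝕜, E) q).symm) (extChartAt 𝓘(𝕜, E) q q) := by
  have := (contMDiffAt_iff.1 h).2
  rw [extChartAt_model_space_eq_id] at this
  simpa [contDiffWithinAt_univ, Function.comp_def] using this

variable (𝕜 E) in
/-- The germs at `p` of smooth functions (holomorphic functions if `𝕜` is `ℂ`). -/
def fnGermSubring (p : M) : Subring (Germ (𝓝 p) 𝕜) where
  carrier := {g | ∃ f : M → 𝕜, SmoothFnAt E f p ∧ (f : Germ (𝓝 p) 𝕜) = g}
  mul_mem' := by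
    rintro _ _ ⟨f, hf, rfl⟩ ⟨g, hg, rfl⟩
    exact ⟨f * g, by filter_upwards [hf, hg] with q h1 h2 using h1.mul h2, rfl⟩
  one_mem' := ⟨1, Eventually.of_forall fun _ => contMDiffAt_const, rfl⟩
  add_mem' := by
    rintro _ _ ⟨f, hf, rfl⟩ ⟨g, hg, rfl⟩
    exact ⟨f + g, by filter_upwards [hf, hg] with q h1 h2 using h1.add h2, rfl⟩
  zero_mem' := ⟨0, Eventually.of_forall fun _ => contMDiffAt_const, rfl⟩
  neg_mem' := by
    rintro _ ⟨f, hf, rfl⟩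
    exact ⟨-f, by filter_upwards [hf] with q h1 using h1.neg, rfl⟩

variable (𝕜 E) in
/-- The local ring `O_{M,p}` of germs at `p` of smooth functions. -/
def fnGerm (p : M) : Type _ := fnGermSubring 𝕜 E p

noncomputable instance (p : M) : CommRing (fnGerm 𝕜 E p) :=
  inferInstanceAs (CommRing (fnGermSubring 𝕜 E p))

/-- The germ at `p` of a function that is smooth near `p`. -/
def fnGerm.mk {p : M} (f : M → 𝕜) (hf : SmoothFnAt E f p) : fnGerm 𝕜 E p :=
  (⟨f, f, hf, rfl⟩ : fnGermSubring 𝕜 E p)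

theorem fnGerm.exists_rep {p : M} (a : fnGerm 𝕜 E p) :
    ∃ (f : M → 𝕜) (hf : SmoothFnAt E f p), a = fnGerm.mk f hf := by
  obtain ⟨_, f, hf, rfl⟩ := a
  exact ⟨f, hf, rfl⟩

variable (𝕜 E) in
/-- The germs at `p` of smooth `k`-forms. -/
def formGermSubgroup (k : ℕ) (p : M) : AddSubgroup (Germ (𝓝 p) (E [⋀^Fin k]→L[𝕜] 𝕜)) where
  carrier := {g | ∃ η : M → E [⋀^Fin k]→L[𝕜] 𝕜, SmoothFormAt η p ∧ (η : Germ (𝓝 p) _) = g}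
  add_mem' := by
    rintro _ _ ⟨f, hf, rfl⟩ ⟨g, hg, rfl⟩
    exact ⟨f + g, by filter_upwards [hf, hg] with q h1 h2 using h1.add h2, rfl⟩
  zero_mem' := ⟨0, Eventually.of_forall fun _ => contDiffAt_const (c := 0), rfl⟩
  neg_mem' := by
    rintro _ ⟨f, hf, rfl⟩
    exact ⟨-f, by filter_upwards [hf] with q h1 using h1.neg, rfl⟩

variable (𝕜 E) in
/-- The stalk at `p` of the sheaf of smooth `k`-forms on `M`. -/
def formGerm (k : ℕ) (p : M) : Type _ := formGermSubgroup 𝕜 E k p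

noncomputable instance (k : ℕ) (p : M) : AddCommGroup (formGerm 𝕜 E k p) :=
  inferInstanceAs (AddCommGroup (formGermSubgroup 𝕜 E k p))

/-- The germ at `p` of a form that is smooth near `p`. -/
def formGerm.mk {k : ℕ} {p : M} (η : M → E [⋀^Fin k]→L[𝕜] 𝕜) (hη : SmoothFormAt η p) :
    formGerm 𝕜 E k p := (⟨η, η, hη, rfl⟩ : formGermSubgroup 𝕜 E k p)

theorem formGerm.exists_rep {k : ℕ} {p : M} (a : formGerm 𝕜 E k p) :
    ∃ (η : M → E [⋀^Fin k]→L[𝕜] 𝕜) (hη : SmoothFormAt η p), a = formGerm.mk η hη := by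
  obtain ⟨_, η, hη, rfl⟩ := a
  exact ⟨η, hη, rfl⟩

theorem formGerm.mk_eq {k : ℕ} {p : M} {η ζ : M → E [⋀^Fin k]→L[𝕜] 𝕜} {hη : SmoothFormAt η p}
    {hζ : SmoothFormAt ζ p} (h : η =ᶠ[𝓝 p] ζ) : formGerm.mk η hη = formGerm.mk ζ hζ :=
  Subtype.ext (Germ.coe_eq.2 h)

/-- Germs of forms are multiplied pointwise by germs of functions. -/
noncomputable instance (k : ℕ) (p : M) : SMul (fnGerm 𝕜 E p) (formGerm 𝕜 E k p) where
  smul a b := (⟨Germ.map₂ (fun (c : 𝕜) (η : E [⋀^Fin k]→L[𝕜] 𝕜) => c • η) a.1 b.1, by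
    obtain ⟨_, f, hf, rfl⟩ := a
    obtain ⟨_, η, hη, rfl⟩ := b
    refine ⟨f • η, ?_, rfl⟩
    filter_upwards [hf, hη] with q h1 h2 using (contDiffAt_inChart h1).smul h2⟩ :
      formGermSubgroup 𝕜 E k p)

noncomputable instance (k : ℕ) (p : M) : Module (fnGerm 𝕜 E p) (formGerm 𝕜 E k p) where
  one_smul b := by
    obtain ⟨_, η, hη, rfl⟩ := b
    exact Subtype.ext (congrArg Germ.ofFun (funext fun x => one_smul 𝕜 (η x)))
  mul_smul a a' b := by
    obtain ⟨_, f, hf, rfl⟩ := a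
    obtain ⟨_, g, hg, rfl⟩ := a'
    obtain ⟨_, η, hη, rfl⟩ := b
    exact Subtype.ext (congrArg Germ.ofFun (funext fun x => mul_smul (f x) (g x) (η x)))
  smul_zero a := by
    obtain ⟨_, f, hf, rfl⟩ := a
    exact Subtype.ext (congrArg Germ.ofFun (funext fun x => smul_zero (f x)))
  smul_add a b b' := by
    obtain ⟨_, f, hf, rfl⟩ := a
    obtain ⟨_, η, hη, rfl⟩ := b
    obtain ⟨_, ζ, hζ, rfl⟩ := b'
    exact Subtype.ext (congrArg Germ.ofFun (funext fun x => smul_add (f x) (η x) (ζ x)))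
  add_smul a a' b := by
    obtain ⟨_, f, hf, rfl⟩ := a
    obtain ⟨_, g, hg, rfl⟩ := a'
    obtain ⟨_, η, hη, rfl⟩ := b
    exact Subtype.ext (congrArg Germ.ofFun (funext fun x => add_smul (f x) (g x) (η x)))
  zero_smul b := by
    obtain ⟨_, η, hη, rfl⟩ := b
    exact Subtype.ext (congrArg Germ.ofFun (funext fun x => zero_smul 𝕜 (η x)))

theorem mextDeriv_congr {k : ℕ} {p : M} {η η' : M → E [⋀^Fin k]→L[𝕜] 𝕜} (h : η =ᶠ[𝓝 p] η') :
    mextDeriv η =ᶠ[𝓝 p] mextDeriv η' := by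
  filter_upwards [h.eventuallyEq_nhds] with q hq
  exact (formInChart_congr (mem_extChartAt_source q) hq).extDeriv_eq

/-- The exterior derivative of a germ. -/
noncomputable def formGerm.d {k : ℕ} {p : M} (η : formGerm 𝕜 E k p) : formGerm 𝕜 E (k + 1) p :=
  (⟨Germ.map' mextDeriv (fun _ _ h => mextDeriv_congr h) η.1, by
    obtain ⟨_, η, hη, rfl⟩ := η
    exact ⟨mextDeriv η, hη.mextDeriv, rfl⟩⟩ : formGermSubgroup 𝕜 E (k + 1) p)

/-- The wedge product of germs. -/
noncomputable def formGerm.wedge {k l : ℕ} {p : M} (η : formGerm 𝕜 E k p)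
    (ζ : formGerm 𝕜 E l p) : formGerm 𝕜 E (k + l) p :=
  (⟨Germ.map₂ LagrangianDeRham.wedge η.1 ζ.1, by
    obtain ⟨_, η, hη, rfl⟩ := η
    obtain ⟨_, ζ, hζ, rfl⟩ := ζ
    refine ⟨fun x => LagrangianDeRham.wedge (η x) (ζ x), ?_, rfl⟩
    filter_upwards [hη, hζ] with q h1 h2
    rw [formInChart_wedge]
    exact (isBoundedBilinearMap_wedge k l).contDiff.contDiffAt.comp _ (h1.prodMk h2)⟩ :
      formGermSubgroup 𝕜 E (k + l) p)

/-- A germ of a function as a germ of a `0`-form. -/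
noncomputable def formGerm.ofFn {p : M} (f : fnGerm 𝕜 E p) : formGerm 𝕜 E 0 p :=
  (⟨Germ.map (ContinuousAlternatingMap.constOfIsEmpty 𝕜 E (Fin 0)) f.1, by
    obtain ⟨_, f, hf, rfl⟩ := f
    refine ⟨fun x => ContinuousAlternatingMap.constOfIsEmpty 𝕜 E (Fin 0) (f x), ?_, rfl⟩
    filter_upwards [hf] with q h1
    exact (ContinuousAlternatingMap.constOfIsEmptyLIE 𝕜 E 𝕜 (Fin 0)).contDiff.contDiffAt.comp _
      (contDiffAt_inChart h1)⟩ : formGermSubgroup 𝕜 E 0 p)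


/-- The differential of a function, at `x`. -/
noncomputable def fnDeriv (E : Type*) [NormedAddCommGroup E] [NormedSpace 𝕜 E]
    {M : Type*} [TopologicalSpace M] [ChartedSpace E M] (f : M → 𝕜) (x : M) : E →L[𝕜] 𝕜 :=
  mvfderiv 𝓘(𝕜, E) f x

/-- The map `v ↦ i_v Ω` for a `2`-form `Ω` on `E`. -/
noncomputable def flat (Ω : E [⋀^Fin 2]→L[𝕜] 𝕜) : E →L[𝕜] E →L[𝕜] 𝕜 :=
  (ContinuousAlternatingMap.ofSubsingletonLIE (𝕜 := 𝕜) (E := E) (F := 𝕜)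
    (0 : Fin 1)).symm.toContinuousLinearEquiv.toContinuousLinearMap ∘L Ω.curryLeft

theorem flat_apply (Ω : E [⋀^Fin 2]→L[𝕜] 𝕜) (v w : E) : flat Ω v w = Ω ![v, w] := by
  show Ω (Matrix.vecCons v _) = _
  congr 1
  ext i
  fin_cases i <;> rfl

theorem contDiff_flat : ContDiff 𝕜 ∞ (flat : (E [⋀^Fin 2]→L[𝕜] 𝕜) → E →L[𝕜] E →L[𝕜] 𝕜) := by
  have h : IsBoundedLinearMap 𝕜 (flat : (E [⋀^Fin 2]→L[𝕜] 𝕜) → E →L[𝕜] E →L[𝕜] 𝕜) :=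
    { map_add := fun a b => by ext v w; simp [flat_apply]
      map_smul := fun c a => by ext v w; simp [flat_apply]
      bound := ⟨1, one_pos, fun Ω => by
        rw [one_mul]
        refine ContinuousLinearMap.opNorm_le_bound₂ _ (norm_nonneg _) fun v w => ?_
        rw [flat_apply]
        have := Ω.le_opNorm ![v, w]
        simpa [Fin.prod_univ_two, mul_assoc] using this⟩ }
  exact h.contDiff

theorem flat_isInvertible [FiniteDimensional 𝕜 E] {Ω : E [⋀^Fin 2]→L[𝕜] 𝕜}
    (h : ∀ v, (∀ w, Ω ![v, w] = 0) → v = 0) : (flat Ω).IsInvertible := by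
  have : CompleteSpace 𝕜 := by
    let _ := IsRCLikeNormedField.rclike 𝕜
    infer_instance
  have hinj : Function.Injective (flat Ω).toLinearMap := by
    rw [← LinearMap.ker_eq_bot, LinearMap.ker_eq_bot']
    intro v hv
    refine h v fun w => ?_
    rw [← flat_apply]
    exact congrArg (fun L : E →L[𝕜] 𝕜 => L w) hv
  have hr : Module.finrank 𝕜 E = Module.finrank 𝕜 (E →L[𝕜] 𝕜) := by
    rw [← (LinearMap.toContinuousLinearMap (𝕜 := 𝕜) (E := E) (F' := 𝕜)).finrank_eq]
    exact (Subspace.dual_finrank_eq (K := 𝕜) (V := E)).symm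
  refine ⟨(LinearEquiv.ofInjectiveOfFinrankEq (flat Ω).toLinearMap hinj hr
    ).toContinuousLinearEquiv, ?_⟩
  ext v w
  rfl

/-- The hamiltonian vector field `H_f`, given by `i_{H_f} Ω = df`. -/
noncomputable def hamiltonian (Ω : M → E [⋀^Fin 2]→L[𝕜] 𝕜) (f : M → 𝕜) (x : M) : E :=
  (flat (Ω x)).inverse (fnDeriv E f x)

/-- The Poisson bracket `{f, g} = H_f(g)`. -/
noncomputable def poissonFn (Ω : M → E [⋀^Fin 2]→L[𝕜] 𝕜) (f g : M → 𝕜) (x : M) : 𝕜 :=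
  fnDeriv E g x (hamiltonian Ω f x)

theorem fnDeriv_eq {f : M → 𝕜} {x : M} (hf : ContMDiffAt 𝓘(𝕜, E) 𝓘(𝕜, 𝕜) ∞ f x) :
    fnDeriv E f x = fderiv 𝕜 (f ∘ (extChartAt 𝓘(𝕜, E) x).symm) (extChartAt 𝓘(𝕜, E) x x) := by
  have hd := hf.mdifferentiableAt (by simp)
  ext v
  simp only [fnDeriv, mvfderiv, mfderiv, hd]
  simp [writtenInExtChartAt, Function.comp_def]
  rfl

theorem fderiv_inChart {f : M → 𝕜} {q x : M} (hx : x ∈ (extChartAt 𝓘(𝕜, E) q).source)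
    (hf : ContMDiffAt 𝓘(𝕜, E) 𝓘(𝕜, 𝕜) ∞ f x) :
    fderiv 𝕜 (f ∘ (extChartAt 𝓘(𝕜, E) q).symm) (extChartAt 𝓘(𝕜, E) q x) =
      fnDeriv E f x ∘L tangentCoordChange 𝓘(𝕜, E) q x x := by
  rw [fnDeriv_eq hf]
  have hτ := hasFDerivWithinAt_tangentCoordChange (I := 𝓘(𝕜, E)) (x := q) (y := x) (z := x)
    ⟨hx, mem_extChartAt_source x⟩
  simp only [modelWithCornersSelf_coe, Set.range_id, hasFDerivWithinAt_univ] at hτ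
  have hval : (extChartAt 𝓘(𝕜, E) x ∘ (extChartAt 𝓘(𝕜, E) q).symm) (extChartAt 𝓘(𝕜, E) q x) =
      extChartAt 𝓘(𝕜, E) x x := by
    simp only [Function.comp_apply, (extChartAt 𝓘(𝕜, E) q).left_inv hx]
  have h1 := ((contDiffAt_inChart hf).differentiableAt (by simp)).hasFDerivAt
  rw [← hval] at h1
  have h2 := h1.comp _ hτ
  rw [← hval]
  refine (h2.congr_of_eventuallyEq ?_).fderiv
  have hc := continuousAt_extChartAt_symm' (I := 𝓘(𝕜, E)) hx
  unfold ContinuousAt at hc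
  rw [(extChartAt 𝓘(𝕜, E) q).left_inv hx] at hc
  filter_upwards [hc.eventually (extChartAt_source_mem_nhds (I := 𝓘(𝕜, E)) x)] with y hy
  simp only [Function.comp_apply, (extChartAt 𝓘(𝕜, E) x).left_inv hy]

variable (𝕜 E M) in
/-- A symplectic form: a smooth, closed, non-degenerate `2`-form. -/
structure SymplecticForm where
  toFun : M → E [⋀^Fin 2]→L[𝕜] 𝕜
  smooth : ∀ p, SmoothFormAt toFun p
  closed : ∀ p, mextDeriv toFun p = 0
  nondegenerate : ∀ p v, (∀ w, toFun p ![v, w] = 0) → v = 0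

theorem poissonFn_inChart [FiniteDimensional 𝕜 E] (Ω : SymplecticForm 𝕜 E M) {f g : M → 𝕜}
    {q x : M} (hx : x ∈ (extChartAt 𝓘(𝕜, E) q).source)
    (hf : ContMDiffAt 𝓘(𝕜, E) 𝓘(𝕜, 𝕜) ∞ f x) (hg : ContMDiffAt 𝓘(𝕜, E) 𝓘(𝕜, 𝕜) ∞ g x) :
    (flat (formInChart q Ω.toFun (extChartAt 𝓘(𝕜, E) q x))).IsInvertible ∧
    poissonFn Ω.toFun f g x =
      fderiv 𝕜 (g ∘ (extChartAt 𝓘(𝕜, E) q).symm) (extChartAt 𝓘(𝕜, E) q x)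
        ((flat (formInChart q Ω.toFun (extChartAt 𝓘(𝕜, E) q x))).inverse
          (fderiv 𝕜 (f ∘ (extChartAt 𝓘(𝕜, E) q).symm) (extChartAt 𝓘(𝕜, E) q x))) := by
  rw [fderiv_inChart hx hf, fderiv_inChart hx hg]
  simp only [formInChart, (extChartAt 𝓘(𝕜, E) q).left_inv hx]
  set T := tangentCoordChange 𝓘(𝕜, E) q x x with hT
  set S := tangentCoordChange 𝓘(𝕜, E) x q x with hS
  have hTS : ∀ v, T (S v) = v := fun v => by
    rw [hT, hS, tangentCoordChange_comp ⟨⟨mem_extChartAt_source x, hx⟩, mem_extChartAt_source x⟩,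
      tangentCoordChange_self (mem_extChartAt_source x)]
  have hST : ∀ v, S (T v) = v := fun v => by
    rw [hT, hS, tangentCoordChange_comp ⟨⟨hx, mem_extChartAt_source x⟩, hx⟩,
      tangentCoordChange_self hx]
  have hfl : ∀ v w, flat ((Ω.toFun x).compContinuousLinearMap T) v w =
      flat (Ω.toFun x) (T v) (T w) := by
    intro v w
    rw [flat_apply, flat_apply, ContinuousAlternatingMap.compContinuousLinearMap_apply]
    congr 1
    ext i
    fin_cases i <;> rfl
  have hinv := flat_isInvertible (Ω.nondegenerate x)
  have hinv' : (flat ((Ω.toFun x).compContinuousLinearMap T)).IsInvertible := by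
    refine flat_isInvertible fun v hv => ?_
    have : T v = 0 := by
      refine Ω.nondegenerate x _ fun w => ?_
      have h := hv (S w)
      rw [← flat_apply, hfl, hTS, flat_apply] at h
      exact h
    rw [← hST v, this, map_zero]
  refine ⟨hinv', ?_⟩
  have key : (flat ((Ω.toFun x).compContinuousLinearMap T)).inverse (fnDeriv E f x ∘L T) =
      S (hamiltonian Ω.toFun f x) := by
    have h1 : fnDeriv E f x ∘L T = flat ((Ω.toFun x).compContinuousLinearMap T)
        (S (hamiltonian Ω.toFun f x)) := by
      ext w
      rw [hfl, hTS, hamiltonian, hinv.self_apply_inverse]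
      rfl
    rw [h1, hinv'.inverse_apply_self]
  rw [key, ContinuousLinearMap.comp_apply, hTS, poissonFn]

theorem SmoothFnAt.poissonFn [FiniteDimensional 𝕜 E] (Ω : SymplecticForm 𝕜 E M) {f g : M → 𝕜}
    {p : M} (hf : SmoothFnAt E f p) (hg : SmoothFnAt E g p) :
    SmoothFnAt E (poissonFn Ω.toFun f g) p := by
  have : CompleteSpace 𝕜 := by
    let _ := IsRCLikeNormedField.rclike 𝕜
    infer_instance
  have : CompleteSpace E := FiniteDimensional.complete 𝕜 E
  filter_upwards [hf.eventually_nhds, hg.eventually_nhds, (Ω.smooth p)] with q hfq hgq hΩ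
  rw [contMDiffAt_iff_source]
  have hc := continuousAt_extChartAt_symm (I := 𝓘(𝕜, E)) q
  unfold ContinuousAt at hc
  rw [extChartAt_to_inv] at hc
  have hF := (contDiffAt_inChart hfq.self_of_nhds).fderiv_right (m := ∞) (by simp)
  have hG := (contDiffAt_inChart hgq.self_of_nhds).fderiv_right (m := ∞) (by simp)
  have hinv := (poissonFn_inChart Ω (mem_extChartAt_source q) hfq.self_of_nhds
    hgq.self_of_nhds).1
  have hW := (hinv.contDiffAt_map_inverse (n := ∞)).comp (extChartAt 𝓘(𝕜, E) q q)
    (contDiff_flat.contDiffAt.comp (extChartAt 𝓘(𝕜, E) q q) hΩ)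
  have hall := hG.clm_apply (hW.clm_apply hF)
  simp only [modelWithCornersSelf_coe, Set.range_id, contMDiffWithinAt_univ,
    contMDiffAt_iff_contDiffAt]
  refine hall.congr_of_eventuallyEq ?_
  filter_upwards [hc.eventually hfq, hc.eventually hgq,
    hc.eventually (extChartAt_source_mem_nhds (I := 𝓘(𝕜, E)) q),
    extChartAt_target_mem_nhds (I := 𝓘(𝕜, E)) q] with y hy1 hy1' hy2 hy3
  have := (poissonFn_inChart Ω hy2 hy1 hy1').2
  rw [(extChartAt 𝓘(𝕜, E) q).right_inv hy3] at this
  exact this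

end Germs

section Poisson

open Filter
open scoped Topology Manifold ContDiff

variable {𝕜 : Type*} [NontriviallyNormedField 𝕜] [IsRCLikeNormedField 𝕜]
variable {E : Type*} [NormedAddCommGroup E] [NormedSpace 𝕜 E] [FiniteDimensional 𝕜 E]
variable {M : Type*} [TopologicalSpace M] [ChartedSpace E M] [IsManifold 𝓘(𝕜, E) ∞ M]

theorem fnDeriv_congr {f g : M → 𝕜} {p : M} (h : f =ᶠ[𝓝 p] g) :
    ∀ᶠ q in 𝓝 p, fnDeriv E f q = fnDeriv E g q := by
  filter_upwards [h.eventuallyEq_nhds] with q hq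
  simp only [fnDeriv, mvfderiv]
  ext v
  have := hq.mfderiv_eq (I := 𝓘(𝕜, E)) (I' := 𝓘(𝕜, 𝕜))
  exact congrArg (fun L : E →L[𝕜] 𝕜 => L v) this

/-- The Poisson bracket of two germs. -/
noncomputable def poissonGerm (Ω : SymplecticForm 𝕜 E M) {p : M} (f g : fnGerm 𝕜 E p) :
    fnGerm 𝕜 E p :=
  (⟨Quotient.map₂ (poissonFn Ω.toFun) (fun f f' hf g g' hg => by
      filter_upwards [fnDeriv_congr (E := E) hf, fnDeriv_congr (E := E) hg] with q h1 h2
      simp only [poissonFn, hamiltonian, h1, h2]) f.1 g.1, by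
    obtain ⟨_, f, hf, rfl⟩ := f
    obtain ⟨_, g, hg, rfl⟩ := g
    exact ⟨poissonFn Ω.toFun f g, hf.poissonFn Ω hg, rfl⟩⟩ : fnGermSubring 𝕜 E p)

theorem poissonGerm_mk (Ω : SymplecticForm 𝕜 E M) {p : M} {f g : M → 𝕜}
    (hf : SmoothFnAt E f p) (hg : SmoothFnAt E g p) :
    poissonGerm Ω (fnGerm.mk f hf) (fnGerm.mk g hg) =
      fnGerm.mk (poissonFn Ω.toFun f g) (hf.poissonFn Ω hg) := rfl

theorem fnGerm.mk_eq {p : M} {f g : M → 𝕜} {hf : SmoothFnAt E f p} {hg : SmoothFnAt E g p}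
    (h : f =ᶠ[𝓝 p] g) : fnGerm.mk f hf = fnGerm.mk g hg :=
  Subtype.ext (Germ.coe_eq.2 h)

theorem SmoothFnAt.add {p : M} {f g : M → 𝕜} (hf : SmoothFnAt E f p) (hg : SmoothFnAt E g p) :
    SmoothFnAt E (f + g) p := by filter_upwards [hf, hg] with q h1 h2 using h1.add h2

theorem SmoothFnAt.mul {p : M} {f g : M → 𝕜} (hf : SmoothFnAt E f p) (hg : SmoothFnAt E g p) :
    SmoothFnAt E (f * g) p := by filter_upwards [hf, hg] with q h1 h2 using h1.mul h2

theorem fnDeriv_add {f g : M → 𝕜} {q : M} (hf : ContMDiffAt 𝓘(𝕜, E) 𝓘(𝕜, 𝕜) ∞ f q)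
    (hg : ContMDiffAt 𝓘(𝕜, E) 𝓘(𝕜, 𝕜) ∞ g q) :
    fnDeriv E (f + g) q = fnDeriv E f q + fnDeriv E g q :=
  mvfderiv_add (hf.mdifferentiableAt (by simp)) (hg.mdifferentiableAt (by simp))

theorem fnDeriv_mul {f g : M → 𝕜} {q : M} (hf : ContMDiffAt 𝓘(𝕜, E) 𝓘(𝕜, 𝕜) ∞ f q)
    (hg : ContMDiffAt 𝓘(𝕜, E) 𝓘(𝕜, 𝕜) ∞ g q) :
    fnDeriv E (f * g) q = f q • fnDeriv E g q + g q • fnDeriv E f q :=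
  mvfderiv_mul (hf.mdifferentiableAt (by simp)) (hg.mdifferentiableAt (by simp))

/-- The Poisson bracket on the ring of germs at `p`, a skew-symmetric biderivation. -/
noncomputable def poisson (Ω : SymplecticForm 𝕜 E M) (p : M) :
    SkewBiderivation (fnGerm 𝕜 E p) where
  toFun := AddMonoidHom.mk'
    (fun f => AddMonoidHom.mk' (poissonGerm Ω f) fun g h => by
      obtain ⟨f, hf, rfl⟩ := fnGerm.exists_rep f
      obtain ⟨g, hg, rfl⟩ := fnGerm.exists_rep g
      obtain ⟨h, hh, rfl⟩ := fnGerm.exists_rep h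
      refine fnGerm.mk_eq (hf := hf.poissonFn Ω (hg.add hh))
        (hg := (hf.poissonFn Ω hg).add (hf.poissonFn Ω hh)) ?_
      filter_upwards [hg, hh] with q h1 h2
      simp [poissonFn, fnDeriv_add h1 h2])
    fun f g => by
      ext1 h
      obtain ⟨f, hf, rfl⟩ := fnGerm.exists_rep f
      obtain ⟨g, hg, rfl⟩ := fnGerm.exists_rep g
      obtain ⟨h, hh, rfl⟩ := fnGerm.exists_rep h
      refine fnGerm.mk_eq (hf := (hf.add hg).poissonFn Ω hh)
        (hg := (hf.poissonFn Ω hh).add (hg.poissonFn Ω hh)) ?_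
      filter_upwards [hf, hg] with q h1 h2
      simp [poissonFn, hamiltonian, fnDeriv_add h1 h2]
  self f := by
    obtain ⟨f, hf, rfl⟩ := fnGerm.exists_rep f
    refine fnGerm.mk_eq (hf := hf.poissonFn Ω hf)
      (hg := Eventually.of_forall fun _ => contMDiffAt_const (c := 0)) ?_
    refine Eventually.of_forall fun q => ?_
    have h1 : fnDeriv E f q = flat (Ω.toFun q) (hamiltonian Ω.toFun f q) :=
      ((flat_isInvertible (Ω.nondegenerate q)).self_apply_inverse _).symm
    show fnDeriv E f q (hamiltonian Ω.toFun f q) = 0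
    rw [h1, flat_apply]
    exact (Ω.toFun q).map_eq_zero_of_eq _ (i := 0) (j := 1) rfl (by simp)
  mul_right f g h := by
    obtain ⟨f, hf, rfl⟩ := fnGerm.exists_rep f
    obtain ⟨g, hg, rfl⟩ := fnGerm.exists_rep g
    obtain ⟨h, hh, rfl⟩ := fnGerm.exists_rep h
    refine fnGerm.mk_eq (hf := hf.poissonFn Ω (hg.mul hh))
      (hg := (hg.mul (hf.poissonFn Ω hh)).add (hh.mul (hf.poissonFn Ω hg))) ?_
    filter_upwards [hg, hh] with q h1 h2
    simp [poissonFn, fnDeriv_mul h1 h2]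

end Poisson

section Sheaves

open Filter TopologicalSpace
open scoped Topology Manifold ContDiff

variable {𝕜 : Type*} [NontriviallyNormedField 𝕜] [IsRCLikeNormedField 𝕜]
variable {E : Type*} [NormedAddCommGroup E] [NormedSpace 𝕜 E]
variable {M : Type*} [TopologicalSpace M] [ChartedSpace E M] [IsManifold 𝓘(𝕜, E) ∞ M]

theorem isUnit_two_fnGerm (p : M) : IsUnit (2 : fnGerm 𝕜 E p) := by
  have h2 : (2 : 𝕜) ≠ 0 := by
    let _ := IsRCLikeNormedField.rclike 𝕜
    exact two_ne_zero
  have hs : ∀ c : 𝕜, SmoothFnAt E (fun _ : M => c) p := fun c =>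
    Eventually.of_forall fun _ => contMDiffAt_const
  have e : (2 : fnGerm 𝕜 E p) = fnGerm.mk (fun _ => 2) (hs 2) := by
    apply Subtype.ext
    rfl
  refine IsUnit.of_mul_eq_one (fnGerm.mk (fun _ => 2⁻¹) (hs _)) ?_
  rw [e]
  apply Subtype.ext
  refine Germ.coe_eq.2 (Eventually.of_forall fun q => ?_)
  exact mul_inv_cancel₀ h2

theorem mextDeriv_sub {k : ℕ} {η ζ : M → E [⋀^Fin k]→L[𝕜] 𝕜} {q : M}
    (h1 : ContDiffAt 𝕜 ∞ (formInChart q η) (extChartAt 𝓘(𝕜, E) q q))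
    (h2 : ContDiffAt 𝕜 ∞ (formInChart q ζ) (extChartAt 𝓘(𝕜, E) q q)) :
    mextDeriv (η - ζ) q = mextDeriv η q - mextDeriv ζ q := by
  have e : formInChart q (η - ζ) = formInChart q η - formInChart q ζ := rfl
  simp only [mextDeriv, e, extDeriv]
  rw [fderiv_sub (h1.differentiableAt (by simp)) (h2.differentiableAt (by simp))]
  exact map_sub (ContinuousAlternatingMap.alternatizeUncurryFinCLM 𝕜 E 𝕜) _ _

theorem formGerm.d_sub {k : ℕ} {p : M} (η ζ : formGerm 𝕜 E k p) : formGerm.d (η - ζ) = formGerm.d η - formGerm.d ζ := by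
  obtain ⟨_, η, hη, rfl⟩ := η
  obtain ⟨_, ζ, hζ, rfl⟩ := ζ
  apply Subtype.ext
  refine Germ.coe_eq.2 ?_
  filter_upwards [hη, hζ] with q h1 h2 using mextDeriv_sub h1 h2

theorem formGerm.sub_wedge {k l : ℕ} {p : M} (η η' : formGerm 𝕜 E k p) (ζ : formGerm 𝕜 E l p) :
    formGerm.wedge (η - η') ζ = formGerm.wedge η ζ - formGerm.wedge η' ζ := by
  obtain ⟨_, η, hη, rfl⟩ := η
  obtain ⟨_, η', hη', rfl⟩ := η'
  obtain ⟨_, ζ, hζ, rfl⟩ := ζ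
  apply Subtype.ext
  refine Germ.coe_eq.2 (Eventually.of_forall fun q => ?_)
  exact (isBoundedBilinearMap_wedge k l).map_sub_left

theorem formGerm.wedge_sub {k l : ℕ} {p : M} (η : formGerm 𝕜 E k p) (ζ ζ' : formGerm 𝕜 E l p) :
    formGerm.wedge η (ζ - ζ') = formGerm.wedge η ζ - formGerm.wedge η ζ' := by
  obtain ⟨_, η, hη, rfl⟩ := η
  obtain ⟨_, ζ, hζ, rfl⟩ := ζ
  obtain ⟨_, ζ', hζ', rfl⟩ := ζ'
  apply Subtype.ext
  refine Germ.coe_eq.2 (Eventually.of_forall fun q => ?_)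
  exact (isBoundedBilinearMap_wedge k l).map_sub_right

/-- The differential graded ideal generated by an ideal `I` of functions, in the algebra of germs of
forms. By the Leibniz rule its part of degree `k` is `I Ω^k + dI ∧ Ω^{k-1}`. -/
inductive DeRhamIdealMem {p : M} (I : Ideal (fnGerm 𝕜 E p)) : ∀ k, formGerm 𝕜 E k p → Prop
  | ofFn (f) : f ∈ I → DeRhamIdealMem I 0 (formGerm.ofFn f)
  | zero (k) : DeRhamIdealMem I k 0
  | add {k} (η ζ) : DeRhamIdealMem I k η → DeRhamIdealMem I k ζ → DeRhamIdealMem I k (η + ζ)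
  | smul {k} (f : fnGerm 𝕜 E p) (η) : DeRhamIdealMem I k η → DeRhamIdealMem I k (f • η)
  | wedge_left {k l} (η : formGerm 𝕜 E k p) (ζ : formGerm 𝕜 E l p) :
      DeRhamIdealMem I k η → DeRhamIdealMem I (k + l) (formGerm.wedge η ζ)
  | wedge_right {k l} (η : formGerm 𝕜 E k p) (ζ : formGerm 𝕜 E l p) :
      DeRhamIdealMem I l ζ → DeRhamIdealMem I (k + l) (formGerm.wedge η ζ)
  | d {k} (η : formGerm 𝕜 E k p) : DeRhamIdealMem I k η → DeRhamIdealMem I (k + 1) (formGerm.d η)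

/-- The part of degree `k` of the differential graded ideal generated by `I`. -/
def deRhamIdeal {p : M} (I : Ideal (fnGerm 𝕜 E p)) (k : ℕ) :
    Submodule (fnGerm 𝕜 E p) (formGerm 𝕜 E k p) where
  carrier := {η | DeRhamIdealMem I k η}
  add_mem' := DeRhamIdealMem.add _ _
  zero_mem' := DeRhamIdealMem.zero k
  smul_mem' := DeRhamIdealMem.smul

variable (𝕜 E M) in
/-- A sheaf of ideals of the sheaf of smooth functions on `M`, given by its stalks. A family of
ideals of the stalks comes from an ideal sheaf if and only if a function whose germ at `p` is in the
ideal at `p` has its germ at `q` in the ideal at `q`, for all `q` near `p`. -/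
structure IdealSheaf where
  stalk : ∀ p : M, Ideal (fnGerm 𝕜 E p)
  isOpen : ∀ (p : M) (f : M → 𝕜) (hf : SmoothFnAt E f p), fnGerm.mk f hf ∈ stalk p →
    ∀ᶠ q in 𝓝 p, ∃ hq : SmoothFnAt E f q, fnGerm.mk f hq ∈ stalk q

namespace IdealSheaf

variable (I : IdealSheaf 𝕜 E M)

/-- `{I, I} ⊆ I`. -/
def IsInvolutive [FiniteDimensional 𝕜 E] (Ω : SymplecticForm 𝕜 E M) : Prop :=
  ∀ p, ∀ f ∈ I.stalk p, ∀ g ∈ I.stalk p, (poisson Ω p).toFun f g ∈ I.stalk p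

/-- The stalk of `O_L = O_M / I`. -/
abbrev OStalk (p : M) : Type _ := fnGerm 𝕜 E p ⧸ I.stalk p

/-- The class of a germ of a function in `O_L`. -/
noncomputable abbrev OStalk.mk {p : M} (f : fnGerm 𝕜 E p) : I.OStalk p := Ideal.Quotient.mk (I.stalk p) f

/-- The stalk of `Ω^k_L = Ω^k_M / (I Ω^k_M + dI ∧ Ω^{k-1}_M)`. -/
abbrev OmegaStalk (k : ℕ) (p : M) : Type _ := formGerm 𝕜 E k p ⧸ deRhamIdeal (I.stalk p) k

/-- The class of a germ of a form in `Ω^k_L`. -/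
noncomputable abbrev OmegaStalk.mk {k : ℕ} {p : M} (η : formGerm 𝕜 E k p) : I.OmegaStalk k p :=
  Submodule.Quotient.mk η

/-- The exterior derivative on `Ω_L`. -/
noncomputable def OmegaStalk.d {k : ℕ} {p : M} : I.OmegaStalk k p → I.OmegaStalk (k + 1) p :=
  Quotient.map' formGerm.d fun η ζ h => by
    rw [Submodule.quotientRel_def] at h ⊢
    rw [← formGerm.d_sub]
    exact DeRhamIdealMem.d _ h

/-- The wedge product on `Ω_L`. -/
noncomputable def OmegaStalk.wedge {k l : ℕ} {p : M} :
    I.OmegaStalk k p → I.OmegaStalk l p → I.OmegaStalk (k + l) p :=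
  Quotient.map₂ formGerm.wedge fun η η' h ζ ζ' h' => by
    have h1 := (Submodule.quotientRel_def _).1 h
    have h2 := (Submodule.quotientRel_def _).1 h'
    refine (Submodule.quotientRel_def _).2 ?_
    have e : formGerm.wedge η ζ - formGerm.wedge η' ζ' =
        formGerm.wedge (η - η') ζ + formGerm.wedge η' (ζ - ζ') := by
      rw [formGerm.sub_wedge, formGerm.wedge_sub]; abel
    rw [e]
    exact add_mem (DeRhamIdealMem.wedge_left _ _ h1) (DeRhamIdealMem.wedge_right _ _ h2)

/-- The stalk of the conormal sheaf `I / I²`. -/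
abbrev ConormalStalk (p : M) : Type _ := (I.stalk p).Cotangent

/-- The alternating `k`-forms on the stalk of the conormal sheaf with values in the stalk of
`O_L`. A section of `C^k_L = Hom(⋀^k (I / I²), O_L)` is a family of such forms; see `cSections`. -/
abbrev CStalk (k : ℕ) (p : M) : Type _ := I.ConormalStalk p [⋀^Fin k]→ₗ[I.OStalk p] I.OStalk p

variable {I} in
/-- The differential `δ` of `C_L`. -/
noncomputable def CStalk.delta [FiniteDimensional 𝕜 E] {Ω : SymplecticForm 𝕜 E M}
    (hI : I.IsInvolutive Ω) {k : ℕ} {p : M} (φ : I.CStalk k p) : I.CStalk (k + 1) p :=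
  ((poisson Ω p).conormalAlgebroid (hI p)).diff
    ((map_ofNat (Ideal.Quotient.mk (I.stalk p)) 2) ▸
      (isUnit_two_fnGerm (𝕜 := 𝕜) (E := E) p).map (Ideal.Quotient.mk (I.stalk p))) φ

/-- The sections of `O_L` over `U`: the families of elements of the stalks that are induced,
locally, by smooth functions. -/
def oSections (U : Opens M) : Set (∀ q : U, I.OStalk q.1) :=
  {s | ∀ p : U, ∃ f : M → 𝕜, ∀ᶠ q : U in 𝓝 p,
    ∃ hf : SmoothFnAt E f q.1, s q = OStalk.mk I (fnGerm.mk f hf)}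

/-- The sections of `Ω^k_L` over `U`: the families of elements of the stalks that are induced,
locally, by smooth forms. -/
def omegaSections (U : Opens M) (k : ℕ) : Set (∀ q : U, I.OmegaStalk k q.1) :=
  {s | ∀ p : U, ∃ η : M → E [⋀^Fin k]→L[𝕜] 𝕜, ∀ᶠ q : U in 𝓝 p,
    ∃ hη : SmoothFormAt η q.1, s q = OmegaStalk.mk I (formGerm.mk η hη)}

/-- The sections of `C^k_L = Hom(⋀^k (I / I²), O_L)` over `U`. A morphism of sheaves over `U` is a
family of maps of the stalks that sends sections to sections; as sections of `I / I²` come locally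
from sections of `I`, it is enough to test this on sections `h_1, ..., h_k` of `I` over open subsets
`V` of `U`. -/
def cSections (U : Opens M) (k : ℕ) : Set (∀ q : U, I.CStalk k q.1) :=
  {φ | ∀ (V : Opens M) (hV : V ≤ U) (h : Fin k → M → 𝕜)
    (hs : ∀ i (q : V), SmoothFnAt E (h i) q.1)
    (hm : ∀ i (q : V), fnGerm.mk (h i) (hs i q) ∈ I.stalk q.1),
    (fun q : V => φ ⟨q.1, hV q.2⟩ fun i => (I.stalk q.1).toCotangent ⟨_, hm i q⟩) ∈
      I.oSections V}

/-- `p` is a point of `L` at which `L` is smooth of dimension `d`: near `p` the ideal sheaf is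
generated by functions, `finrank 𝕜 E - d` in number, whose differentials at `p` are linearly
independent. The condition `I.stalk p ≠ ⊤` says that `p` is in `L`. -/
def IsSmoothPoint (p : M) (d : ℕ) : Prop :=
  I.stalk p ≠ ⊤ ∧ ∃ c : ℕ, c + d = Module.finrank 𝕜 E ∧ ∃ f : Fin c → M → 𝕜,
    LinearIndependent 𝕜 (fun i => fnDeriv E (f i) p) ∧
    ∀ᶠ q in 𝓝 p, ∃ hf : ∀ i, SmoothFnAt E (f i) q,
      I.stalk q = Ideal.span (Set.range fun i => fnGerm.mk (f i) (hf i))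

end IdealSheaf

/-- A morphism of sheaves of differential graded algebras from `(Ω_L, d, ∧)` to `(C_L, δ, ∧)`, linear
over `O_L`, given by the maps on stalks. It is the identity of `O_L` in degree `0`, where both
algebras are equal to `O_L`; in particular it preserves the unit. -/
structure DGAMorphism [FiniteDimensional 𝕜 E] {Ω : SymplecticForm 𝕜 E M}
    (I : IdealSheaf 𝕜 E M) (hI : I.IsInvolutive Ω) where
  toFun : ∀ (k : ℕ) (p : M), I.OmegaStalk k p →ₗ[fnGerm 𝕜 E p] I.CStalk k p
  map_sections : ∀ (U : Opens M) (k : ℕ), ∀ s ∈ I.omegaSections U k,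
    (fun q : U => toFun k q.1 (s q)) ∈ I.cSections U k
  map_fn : ∀ (p : M) (f : fnGerm 𝕜 E p),
    toFun 0 p (IdealSheaf.OmegaStalk.mk I (formGerm.ofFn f)) =
      AlternatingMap.constOfIsEmpty _ _ _ (IdealSheaf.OStalk.mk I f)
  map_wedge : ∀ (k l : ℕ) (p : M) (x : I.OmegaStalk k p) (y : I.OmegaStalk l p),
    toFun (k + l) p (IdealSheaf.OmegaStalk.wedge I x y) = altWedge (toFun k p x) (toFun l p y)
  map_d : ∀ (k : ℕ) (p : M) (x : I.OmegaStalk k p),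
    toFun (k + 1) p (IdealSheaf.OmegaStalk.d I x) = IdealSheaf.CStalk.delta hI (toFun k p x)

/-- `J` is an isomorphism at `p`: on a neighbourhood of `p` it is an isomorphism of sheaves in every
degree, both on all stalks and on the sections over all open subsets. -/
def DGAMorphism.IsIsoAt [FiniteDimensional 𝕜 E] {Ω : SymplecticForm 𝕜 E M}
    {I : IdealSheaf 𝕜 E M} {hI : I.IsInvolutive Ω} (J : DGAMorphism I hI) (p : M) : Prop :=
  ∃ V : Opens M, p ∈ V ∧ ∀ k : ℕ, (∀ q ∈ V, Function.Bijective (J.toFun k q)) ∧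
    ∀ W ≤ V, Set.BijOn (fun (s : ∀ q : W, I.OmegaStalk k q.1) (q : W) => J.toFun k q.1 (s q))
      (I.omegaSections W k) (I.cSections W k)

end Sheaves

end LagrangianDeRham

set_option linter.unusedSectionVars false

/-! For a k-form η put J(η)(g_1, ..., g_k) = (-1)^k η(H_{g_1}, ..., H_{g_k}) mod I; the sign makes
J(df)(g) = -{g, f} = {f, g}. Since H_{ab} = a H_b + b H_a, the function η(H_{g_1}, ..., H_{g_k})
(`eval`) is a derivation in each g_i. For g_i in I it is therefore multilinear modulo I and sends I²
to I, so it descends to the conormal module (`conormalForm`). Products are respected pointwise.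
Differentials are respected by Cartan's formula for dη on vector fields together with [H_f, H_g] =
H_{{f, g}}, and this is where dω = 0 enters (`lieBracket_hamiltonian`, `eval_d_succ`). The same
formulas and involutivity show that the differential graded ideal generated by I goes to zero
(`eval_mem_of_deRhamIdealMem`).

At a smooth point p let f_1, ..., f_c generate I. The brackets {f_i, f_j} lie in I and vanish at p,
so the independent vectors H_{f_i}(p) span an isotropic subspace. Functions y_j with {f_i, y_j}(p) =
δ_ij make the matrix of brackets of (f, y) at p invertible. Hence 2c ≤ 2n, whereas the bound on the
dimension of L gives c ≥ n. So c = n, and the hamiltonian fields of u = (f, y) form a frame near p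
(`IdealSheaf.IsSmoothPoint.exists_frame`). In the dual coframe e, the half belonging to the y_j lies
in the differential graded ideal (`exists_coframe`).

The rest is induction on the degree by means of ∑_a (ι_{H_{u_a}} η) ∧ e_a = N η with a nonzero
integer N (`sum_wedge_contraction`). If η takes values in I on tuples from I, so do its contractions
with the H_{f_i}, which are then in the ideal by induction; the other summands contain a factor e_a
from the ideal. This is injectivity (`deRhamIdealMem_of_eval_mem`). Conversely, a form on the
conormal module is rebuilt by wedging lifts of its contractions with the f_i with the e_i
(`conormalForm_surjective`). Bijectivity passes from stalks to sections because forms are compared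
on finitely many tuples of generators and membership in I persists at nearby points
(`deRhamToConormal_bijOn`). -/

namespace LagrangianDeRham

/-! ### Vector fields in charts and Cartan's formula -/

section VectorFields

open Filter VectorField
open scoped Topology Manifold ContDiff

variable {𝕜 : Type*} [NontriviallyNormedField 𝕜] [IsRCLikeNormedField 𝕜]
variable {E : Type*} [NormedAddCommGroup E] [NormedSpace 𝕜 E]
variable {M : Type*} [TopologicalSpace M] [ChartedSpace E M] [IsManifold 𝓘(𝕜, E) ∞ M]

variable (𝕜) in
/-- A vector field on `M`, expressed in the chart at `q`. -/
noncomputable def vecInChart (q : M) (X : M → E) (y : E) : E :=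
  tangentCoordChange 𝓘(𝕜, E) ((extChartAt 𝓘(𝕜, E) q).symm y) q
    ((extChartAt 𝓘(𝕜, E) q).symm y) (X ((extChartAt 𝓘(𝕜, E) q).symm y))

variable (𝕜) in
/-- `X` is a smooth vector field on a neighbourhood of `p`. -/
def SmoothVecAt (X : M → E) (p : M) : Prop :=
  ∀ᶠ q in 𝓝 p, ContDiffAt 𝕜 ∞ (vecInChart 𝕜 q X) (extChartAt 𝓘(𝕜, E) q q)

theorem vecInChart_self (q : M) (X : M → E) :
    vecInChart 𝕜 q X (extChartAt 𝓘(𝕜, E) q q) = X q := by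
  rw [vecInChart, extChartAt_to_inv, tangentCoordChange_self (mem_extChartAt_source q)]

theorem tangentCoordChange_vecInChart {q : M} (X : M → E) {y : E}
    (hy : y ∈ (extChartAt 𝓘(𝕜, E) q).target) :
    tangentCoordChange 𝓘(𝕜, E) q ((extChartAt 𝓘(𝕜, E) q).symm y)
      ((extChartAt 𝓘(𝕜, E) q).symm y) (vecInChart 𝕜 q X y) =
        X ((extChartAt 𝓘(𝕜, E) q).symm y) := by
  have h := (extChartAt 𝓘(𝕜, E) q).map_target hy
  rw [vecInChart, tangentCoordChange_comp
    ⟨⟨mem_extChartAt_source _, h⟩, mem_extChartAt_source _⟩,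
    tangentCoordChange_self (mem_extChartAt_source _)]

/-- Forms are pulled back by a coordinate change and vectors are moved by its inverse, so the
pairing is unchanged. This reduces identities on M to identities on E. -/
theorem formInChart_vecInChart {k : ℕ} {q : M} (η : M → E [⋀^Fin k]→L[𝕜] 𝕜)
    (X : Fin k → M → E) {y : E} (hy : y ∈ (extChartAt 𝓘(𝕜, E) q).target) :
    formInChart q η y (fun i => vecInChart 𝕜 q (X i) y) =
      η ((extChartAt 𝓘(𝕜, E) q).symm y) fun i => X i ((extChartAt 𝓘(𝕜, E) q).symm y) := by
  rw [formInChart, ContinuousAlternatingMap.compContinuousLinearMap_apply]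
  congr 1
  ext i
  exact tangentCoordChange_vecInChart (X i) hy

/-- Induction on the degree: inserting the first vector field gives a smooth form of lower degree,
because currying is linear and continuous. -/
theorem contDiffAt_alternating_apply {F : Type*} [NormedAddCommGroup F] [NormedSpace 𝕜 F]
    {k : ℕ} {η : F → E [⋀^Fin k]→L[𝕜] 𝕜} {V : Fin k → F → E}
    {y : F} (hη : ContDiffAt 𝕜 ∞ η y) (hV : ∀ i, ContDiffAt 𝕜 ∞ (V i) y) :
    ContDiffAt 𝕜 ∞ (fun z => η z fun i => V i z) y := by
  induction k with
  | zero =>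
    have h : (fun z => η z fun i => V i z) =
        fun z => (ContinuousAlternatingMap.constOfIsEmptyLIE 𝕜 E 𝕜 (Fin 0)).symm (η z) := by
      ext z
      rw [Subsingleton.elim (fun i => V i z) 0]
      rfl
    rw [h]
    exact (ContinuousAlternatingMap.constOfIsEmptyLIE 𝕜 E 𝕜 (Fin 0)).symm.contDiff.contDiffAt.comp
      _ hη
  | succ k ih =>
    have h : (fun z => η z fun i => V i z) =
        fun z => (η z).curryLeft (V 0 z) fun i => V i.succ z := by
      ext z
      rw [ContinuousAlternatingMap.curryLeft_apply_apply]
      congr 1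
      ext i
      refine Fin.cases ?_ (fun i => ?_) i <;> rfl
    rw [h]
    refine ih (η := fun z => (η z).curryLeft (V 0 z)) (V := fun i => V i.succ) ?_ fun i => hV _
    exact ((ContinuousAlternatingMap.curryLeftLI (𝕜 := 𝕜) (E := E) (F := 𝕜)
      (n := k)).contDiff.contDiffAt.comp _ hη).clm_apply (hV 0)

theorem SmoothFormAt.apply {k : ℕ} {p : M} {η : M → E [⋀^Fin k]→L[𝕜] 𝕜} {X : Fin k → M → E}
    (hη : SmoothFormAt η p) (hX : ∀ i, SmoothVecAt 𝕜 (X i) p) :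
    SmoothFnAt E (fun x => η x fun i => X i x) p := by
  filter_upwards [hη, eventually_all.2 hX] with q h1 h2
  rw [contMDiffAt_iff_source]
  simp only [modelWithCornersSelf_coe, Set.range_id, contMDiffWithinAt_univ,
    contMDiffAt_iff_contDiffAt]
  refine (contDiffAt_alternating_apply h1 h2).congr_of_eventuallyEq ?_
  filter_upwards [extChartAt_target_mem_nhds (I := 𝓘(𝕜, E)) q] with y hy
  exact (formInChart_vecInChart η X hy).symm

theorem SmoothFormAt.curryLeft {k : ℕ} {p : M} {η : M → E [⋀^Fin (k + 1)]→L[𝕜] 𝕜} {X : M → E}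
    (hη : SmoothFormAt η p) (hX : SmoothVecAt 𝕜 X p) :
    SmoothFormAt (fun x => (η x).curryLeft (X x)) p := by
  filter_upwards [hη, hX] with q h1 h2
  have h3 := ((ContinuousAlternatingMap.curryLeftLI (𝕜 := 𝕜) (E := E) (F := 𝕜)
      (n := k)).contDiff.contDiffAt.comp _ h1).clm_apply h2
  refine h3.congr_of_eventuallyEq ?_
  filter_upwards [extChartAt_target_mem_nhds (I := 𝓘(𝕜, E)) q] with y hy
  ext v
  simp only [formInChart, ContinuousAlternatingMap.compContinuousLinearMap_apply,
    ContinuousAlternatingMap.curryLeft_apply_apply, Function.comp_apply]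
  show _ = ContinuousAlternatingMap.compContinuousLinearMap _ _ _
  rw [ContinuousAlternatingMap.compContinuousLinearMap_apply]
  congr 1
  ext i
  refine Fin.cases ?_ (fun i => rfl) i
  exact (tangentCoordChange_vecInChart X hy).symm

/-- Cartan's formula for a 2-form with its sums written out, so that the closedness of ω can be
exploited term by term. -/
theorem extDeriv_apply_three {w : E → E [⋀^Fin 2]→L[𝕜] 𝕜} {X Y Z : E → E} {x : E}
    (hw : DifferentiableAt 𝕜 w x) (hX : DifferentiableAt 𝕜 X x) (hY : DifferentiableAt 𝕜 Y x)
    (hZ : DifferentiableAt 𝕜 Z x) :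
    extDeriv w x ![X x, Y x, Z x] =
      fderiv 𝕜 (fun y => w y ![Y y, Z y]) x (X x) - fderiv 𝕜 (fun y => w y ![X y, Z y]) x (Y x) +
      fderiv 𝕜 (fun y => w y ![X y, Y y]) x (Z x) - w x ![lieBracket 𝕜 X Y x, Z x] +
      w x ![lieBracket 𝕜 X Z x, Y x] - w x ![lieBracket 𝕜 Y Z x, X x] := by
  have h := extDeriv_apply_vectorField (V := ![X, Y, Z]) hw
    (by intro i; fin_cases i <;> assumption)
  have e : (fun i => (![X, Y, Z] : Fin 3 → E → E) i x) = ![X x, Y x, Z x] := by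
    ext i; fin_cases i <;> rfl
  have r0 : ∀ y, Fin.removeNth (0 : Fin 3) (fun i => (![X, Y, Z] : Fin 3 → E → E) i y) =
      ![Y y, Z y] := by intro y; ext i; fin_cases i <;> rfl
  have r1 : ∀ y, Fin.removeNth (1 : Fin 3) (fun i => (![X, Y, Z] : Fin 3 → E → E) i y) =
      ![X y, Z y] := by intro y; ext i; fin_cases i <;> rfl
  have r2 : ∀ y, Fin.removeNth (2 : Fin 3) (fun i => (![X, Y, Z] : Fin 3 → E → E) i y) =
      ![X y, Y y] := by intro y; ext i; fin_cases i <;> rfl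
  have s1 := Fin.sum_univ_three (fun i : Fin 3 => (-1) ^ i.val • fderiv 𝕜 (fun y =>
    w y (i.removeNth fun i => (![X, Y, Z] : Fin 3 → E → E) i y)) x
      ((![X, Y, Z] : Fin 3 → E → E) i x))
  have hge : ∀ (i : Fin 2) (s : Fin 2 → 𝕜),
      ∑ j ≥ i, s j = ∑ j, if i ≤ j then s j else 0 := by
    intro i s
    rw [← Finset.sum_filter]
    congr 1
    ext
    simp
  have s2 := Fin.sum_univ_two (fun i : Fin 2 => ∑ j ≥ i, (-1) ^ (i + j : ℕ) •
    w x (Matrix.vecCons (lieBracket 𝕜 ((![X, Y, Z] : Fin 3 → E → E) i.castSucc)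
      ((![X, Y, Z] : Fin 3 → E → E) j.succ) x)
        (j.removeNth <| i.castSucc.removeNth ((![X, Y, Z] : Fin 3 → E → E) · x))))
  have s3 := s2.trans (congrArg₂ (· + ·) ((hge _ _).trans (Fin.sum_univ_two _))
    ((hge _ _).trans (Fin.sum_univ_two _)))
  have t0 : (0 : Fin 2).removeNth (![Y x, Z x] : Fin 2 → E) = ![Z x] := by
    ext i; fin_cases i; rfl
  have t1 : (1 : Fin 2).removeNth (![Y x, Z x] : Fin 2 → E) = ![Y x] := by
    ext i; fin_cases i; rfl
  have t2 : (1 : Fin 2).removeNth (![X x, Z x] : Fin 2 → E) = ![X x] := by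
    ext i; fin_cases i; rfl
  refine (congrArg _ e).symm.trans (h.trans ((congrArg₂ (· - ·) s1 s3).trans ?_))
  have c0 : (0 : Fin 2).castSucc = 0 := rfl
  have c1 : (1 : Fin 2).castSucc = 1 := rfl
  have c2 : (0 : Fin 2).succ = 1 := rfl
  have c3 : (1 : Fin 2).succ = 2 := rfl
  simp only [r0, r1, r2, c0, c1, c2, c3, t0, t1, t2]
  simp
  ring

/-! ### Hamiltonian vector fields and their Lie brackets -/

variable [FiniteDimensional 𝕜 E]

theorem flat_hamiltonian (Ω : SymplecticForm 𝕜 E M) (f : M → 𝕜) (x : M) :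
    flat (Ω.toFun x) (hamiltonian Ω.toFun f x) = fnDeriv E f x :=
  (flat_isInvertible (Ω.nondegenerate x)).self_apply_inverse _

theorem flat_formInChart (η : M → E [⋀^Fin 2]→L[𝕜] 𝕜) {q x : M}
    (hx : x ∈ (extChartAt 𝓘(𝕜, E) q).source) (v w : E) :
    flat (formInChart q η (extChartAt 𝓘(𝕜, E) q x)) v w =
      flat (η x) (tangentCoordChange 𝓘(𝕜, E) q x x v) (tangentCoordChange 𝓘(𝕜, E) q x x w) := by
  simp only [formInChart, (extChartAt 𝓘(𝕜, E) q).left_inv hx]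
  rw [flat_apply, flat_apply, ContinuousAlternatingMap.compContinuousLinearMap_apply]
  congr 1
  ext i
  fin_cases i <;> rfl

/-- The equation i_{H_f} ω = df is invariant under coordinate changes, so it holds in the chart at q
at every point of its domain where f is smooth, not only at q. -/
theorem flat_vecInChart_hamiltonian (Ω : SymplecticForm 𝕜 E M) {f : M → 𝕜} {q x : M}
    (hx : x ∈ (extChartAt 𝓘(𝕜, E) q).source)
    (hf : ContMDiffAt 𝓘(𝕜, E) 𝓘(𝕜, 𝕜) ∞ f x) :
    flat (formInChart q Ω.toFun (extChartAt 𝓘(𝕜, E) q x))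
        (vecInChart 𝕜 q (hamiltonian Ω.toFun f) (extChartAt 𝓘(𝕜, E) q x)) =
      fderiv 𝕜 (f ∘ (extChartAt 𝓘(𝕜, E) q).symm) (extChartAt 𝓘(𝕜, E) q x) := by
  rw [fderiv_inChart hx hf]
  ext w
  have h := tangentCoordChange_vecInChart (𝕜 := 𝕜) (hamiltonian Ω.toFun f)
    ((extChartAt 𝓘(𝕜, E) q).map_source hx)
  rw [(extChartAt 𝓘(𝕜, E) q).left_inv hx] at h
  rw [flat_formInChart _ hx, h, flat_hamiltonian]
  rfl

theorem eventually_inChart {P : M → Prop} {q : M} (h : ∀ᶠ x in 𝓝 q, P x) :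
    ∀ᶠ y in 𝓝 (extChartAt 𝓘(𝕜, E) q q), ∃ x ∈ (extChartAt 𝓘(𝕜, E) q).source,
      P x ∧ extChartAt 𝓘(𝕜, E) q x = y ∧ (extChartAt 𝓘(𝕜, E) q).symm y = x := by
  have hc := continuousAt_extChartAt_symm (I := 𝓘(𝕜, E)) q
  unfold ContinuousAt at hc
  rw [extChartAt_to_inv] at hc
  filter_upwards [hc.eventually h, extChartAt_target_mem_nhds (I := 𝓘(𝕜, E)) q] with y h1 h2
  exact ⟨_, (extChartAt 𝓘(𝕜, E) q).map_target h2, h1, (extChartAt 𝓘(𝕜, E) q).right_inv h2, rfl⟩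

/-- In the chart, H_f is the inverse of v ↦ i_v ω applied to df, and inversion is smooth at
invertible operators. -/
theorem SmoothFnAt.hamiltonian (Ω : SymplecticForm 𝕜 E M) {f : M → 𝕜} {p : M}
    (hf : SmoothFnAt E f p) : SmoothVecAt 𝕜 (hamiltonian Ω.toFun f) p := by
  have : CompleteSpace 𝕜 := by
    let _ := IsRCLikeNormedField.rclike 𝕜
    infer_instance
  have : CompleteSpace E := FiniteDimensional.complete 𝕜 E
  filter_upwards [hf.eventually_nhds, Ω.smooth p] with q hfq hΩ
  have hF := (contDiffAt_inChart hfq.self_of_nhds).fderiv_right (m := ∞) (by simp)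
  have hinv := (poissonFn_inChart Ω (mem_extChartAt_source q) hfq.self_of_nhds
    hfq.self_of_nhds).1
  have hW := (hinv.contDiffAt_map_inverse (n := ∞)).comp (extChartAt 𝓘(𝕜, E) q q)
    (contDiff_flat.contDiffAt.comp (extChartAt 𝓘(𝕜, E) q q) hΩ)
  refine (hW.clm_apply hF).congr_of_eventuallyEq ?_
  filter_upwards [eventually_inChart (𝕜 := 𝕜) (E := E) hfq] with y ⟨x, hx, hfx, hxy, _⟩
  subst hxy
  rw [← flat_vecInChart_hamiltonian Ω hx hfx]
  exact ((poissonFn_inChart Ω hx hfx hfx).1.inverse_apply_self _).symm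

/-- Let V, W express H_f, H_g in the chart and let v be a constant field. Expand 0 = dω(V, W, v):
the second derivatives V(v f), W(v g) and their analogues are removed by expanding df([W, v]) and
dg([V, v]), and what remains is ω([V, W], v) = v({f, g}). -/
theorem lieBracket_hamiltonian (Ω : SymplecticForm 𝕜 E M) {f g : M → 𝕜} {x : M}
    (hf : SmoothFnAt E f x) (hg : SmoothFnAt E g x) :
    lieBracket 𝕜 (vecInChart 𝕜 x (hamiltonian Ω.toFun f)) (vecInChart 𝕜 x (hamiltonian Ω.toFun g))
      (extChartAt 𝓘(𝕜, E) x x) = hamiltonian Ω.toFun (poissonFn Ω.toFun f g) x := by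
  set φ := extChartAt 𝓘(𝕜, E) x with hφ
  set w := formInChart x Ω.toFun with hw
  set V := vecInChart 𝕜 x (hamiltonian Ω.toFun f) with hVdef
  set W := vecInChart 𝕜 x (hamiltonian Ω.toFun g) with hWdef
  have hV : DifferentiableAt 𝕜 V (φ x) :=
    (hf.hamiltonian Ω).self_of_nhds.differentiableAt (by simp)
  have hW : DifferentiableAt 𝕜 W (φ x) :=
    (hg.hamiltonian Ω).self_of_nhds.differentiableAt (by simp)
  have hwd : DifferentiableAt 𝕜 w (φ x) := (Ω.smooth x).self_of_nhds.differentiableAt (by simp)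
  have hF : ContDiffAt 𝕜 ∞ (f ∘ φ.symm) (φ x) := contDiffAt_inChart hf.self_of_nhds
  have hG : ContDiffAt 𝕜 ∞ (g ∘ φ.symm) (φ x) := contDiffAt_inChart hg.self_of_nhds
  have ef : ∀ᶠ y in 𝓝 (φ x), ∀ v, w y ![V y, v] = fderiv 𝕜 (f ∘ φ.symm) y v := by
    filter_upwards [eventually_inChart (𝕜 := 𝕜) (E := E) hf] with y ⟨z, hz, hfz, hzy, _⟩ v
    subst hzy
    rw [← flat_apply, hw, hVdef, flat_vecInChart_hamiltonian Ω hz hfz]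
  have eg : ∀ᶠ y in 𝓝 (φ x), ∀ v, w y ![W y, v] = fderiv 𝕜 (g ∘ φ.symm) y v := by
    filter_upwards [eventually_inChart (𝕜 := 𝕜) (E := E) hg] with y ⟨z, hz, hgz, hzy, _⟩ v
    subst hzy
    rw [← flat_apply, hw, hWdef, flat_vecInChart_hamiltonian Ω hz hgz]
  have swap : ∀ y a b, w y ![a, b] = - w y ![b, a] := by
    intro y a b
    have h := (w y).toAlternatingMap.map_swap ![b, a] (i := 0) (j := 1) (by simp)
    have e : ![b, a] ∘ Equiv.swap (0 : Fin 2) 1 = ![a, b] := by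
      ext i; fin_cases i <;> simp
    rw [e] at h
    exact h
  have ep : poissonFn Ω.toFun f g ∘ φ.symm =ᶠ[𝓝 (φ x)]
      fun y => fderiv 𝕜 (g ∘ φ.symm) y (V y) := by
    filter_upwards [eventually_inChart (𝕜 := 𝕜) (E := E) hf,
      eventually_inChart (𝕜 := 𝕜) (E := E) hg] with y ⟨z, hz, hfz, hzy, hyz⟩ ⟨z', _, hgz, _, hyz'⟩
    have : z = z' := hyz.symm.trans hyz'
    subst this
    rw [Function.comp_apply, hyz, (poissonFn_inChart Ω hz hfz hgz).2,
      ← flat_vecInChart_hamiltonian Ω hz hfz,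
      (poissonFn_inChart Ω hz hfz hgz).1.inverse_apply_self, hzy]
  have hclosed : extDeriv w (φ x) = 0 := Ω.closed x
  have hsm : minSmoothness 𝕜 2 ≤ (∞ : WithTop ℕ∞) := by
    simp only [minSmoothness_of_isRCLikeNormedField]; exact WithTop.coe_le_coe.2 le_top
  have key : flat (w (φ x)) (lieBracket 𝕜 V W (φ x)) =
      fderiv 𝕜 (poissonFn Ω.toFun f g ∘ φ.symm) (φ x) := by
    ext v
    -- The third field may be taken constant, since a covector is determined by its values on
    -- constant vectors.
    have hc := extDeriv_apply_three hwd hV hW (differentiableAt_const (c := v))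
    have d1 : fderiv 𝕜 (fun y => w y ![W y, v]) (φ x) =
        fderiv 𝕜 (fun y => fderiv 𝕜 (g ∘ φ.symm) y v) (φ x) :=
      Filter.EventuallyEq.fderiv_eq (eg.mono fun y hy => hy v)
    have d2 : fderiv 𝕜 (fun y => w y ![V y, v]) (φ x) =
        fderiv 𝕜 (fun y => fderiv 𝕜 (f ∘ φ.symm) y v) (φ x) :=
      Filter.EventuallyEq.fderiv_eq (ef.mono fun y hy => hy v)
    have d3 : fderiv 𝕜 (fun y => w y ![V y, W y]) (φ x) =
        fderiv 𝕜 (fun y => fderiv 𝕜 (f ∘ φ.symm) y (W y)) (φ x) :=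
      Filter.EventuallyEq.fderiv_eq (ef.mono fun y hy => hy (W y))
    -- ω(V, W) is both df(W) and -dg(V). The first expression cancels a term of `b2`, the second one
    -- matches {f, g}.
    have d4 : fderiv 𝕜 (fun y => w y ![V y, W y]) (φ x) =
        - fderiv 𝕜 (fun y => fderiv 𝕜 (g ∘ φ.symm) y (V y)) (φ x) := by
      rw [← fderiv_fun_neg]
      refine Filter.EventuallyEq.fderiv_eq (eg.mono fun y hy => ?_)
      show w y ![V y, W y] = _
      rw [swap, hy]
    have b1 := fderiv_apply_lieBracket hG hsm (differentiableAt_const (c := v)) hV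
    have b2 := fderiv_apply_lieBracket hF hsm (differentiableAt_const (c := v)) hW
    rw [swap _ _ (W (φ x)), swap _ _ (V (φ x)), eg.self_of_nhds, ef.self_of_nhds, d1, d2, d4,
      hclosed, b1, b2, ← d3, d4] at hc
    rw [flat_apply, ep.fderiv_eq]
    replace hc : (0 : 𝕜) = _ := hc
    simp only [_root_.neg_apply] at hc
    linear_combination hc
  rw [hamiltonian, fnDeriv_eq (hf.poissonFn Ω hg).self_of_nhds, ← key]
  have hself : w (φ x) = Ω.toFun x := by
    rw [hw, hφ]
    ext v
    have := formInChart_vecInChart (q := x) Ω.toFun (fun i _ => v i)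
      (mem_extChartAt_target (I := 𝓘(𝕜, E)) x)
    rw [extChartAt_to_inv] at this
    rw [← this]
    congr 1
    ext i
    exact (vecInChart_self x fun _ => v i).symm
  rw [hself]
  exact ((flat_isInvertible (Ω.nondegenerate x)).inverse_apply_self _).symm

/-- Differentiation along H_g is {g, -}; this turns the first sum of Cartan's formula into Poisson
brackets. -/
theorem fderiv_formInChart_apply (Ω : SymplecticForm 𝕜 E M) {k : ℕ}
    {η : M → E [⋀^Fin k]→L[𝕜] 𝕜} {x : M} (hη : SmoothFormAt η x) {h : Fin k → M → 𝕜}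
    (hh : ∀ i, SmoothFnAt E (h i) x) (g : M → 𝕜) :
    fderiv 𝕜 (fun y => formInChart x η y fun i => vecInChart 𝕜 x (hamiltonian Ω.toFun (h i)) y)
        (extChartAt 𝓘(𝕜, E) x x)
        (vecInChart 𝕜 x (hamiltonian Ω.toFun g) (extChartAt 𝓘(𝕜, E) x x)) =
      poissonFn Ω.toFun g (fun z => η z fun i => hamiltonian Ω.toFun (h i) z) x := by
  rw [poissonFn, fnDeriv_eq (hη.apply fun i => (hh i).hamiltonian Ω).self_of_nhds,
    vecInChart_self]
  congr 1
  refine Filter.EventuallyEq.fderiv_eq ?_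
  filter_upwards [extChartAt_target_mem_nhds (I := 𝓘(𝕜, E)) x] with y hy
  exact formInChart_vecInChart η _ hy

theorem mextDeriv_apply_hamiltonian_zero (Ω : SymplecticForm 𝕜 E M)
    {η : M → E [⋀^Fin 0]→L[𝕜] 𝕜} {x : M} (hη : SmoothFormAt η x) {h : Fin 1 → M → 𝕜}
    (hh : ∀ i, SmoothFnAt E (h i) x) :
    mextDeriv η x (fun i => hamiltonian Ω.toFun (h i) x) =
      ∑ i : Fin 1, (-1) ^ i.val * poissonFn Ω.toFun (h i)
        (fun z => η z fun j => hamiltonian Ω.toFun (i.removeNth h j) z) x := by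
  -- A single vector field produces no bracket term, and pairwise commutation is vacuous.
  have h1 := extDeriv_apply_vectorField_of_pairwise_commute
    (V := fun i => vecInChart 𝕜 x (hamiltonian Ω.toFun (h i)))
    (hη.self_of_nhds.differentiableAt (by simp))
    (fun i => ((hh i).hamiltonian Ω).self_of_nhds.differentiableAt (by simp))
    (fun i j hij => absurd (Subsingleton.elim (α := Fin 1) i j) hij)
  simp only [vecInChart_self] at h1
  refine h1.trans (Finset.sum_congr rfl fun i _ => ?_)
  rw [zsmul_eq_mul, Int.cast_pow, Int.cast_neg, Int.cast_one,
    ← fderiv_formInChart_apply Ω hη (h := i.removeNth h) (fun j => hh _), vecInChart_self]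
  rfl

/-- Cartan's formula in the chart at x, where `lieBracket_hamiltonian` replaces each Lie bracket by
the field of a Poisson bracket. Only functions and their brackets remain, so the identity can be
read on germs. -/
theorem mextDeriv_apply_hamiltonian_succ (Ω : SymplecticForm 𝕜 E M) {k : ℕ}
    {η : M → E [⋀^Fin (k + 1)]→L[𝕜] 𝕜} {x : M} (hη : SmoothFormAt η x) {h : Fin (k + 2) → M → 𝕜}
    (hh : ∀ i, SmoothFnAt E (h i) x) :
    mextDeriv η x (fun i => hamiltonian Ω.toFun (h i) x) =
      (∑ i, (-1) ^ i.val * poissonFn Ω.toFun (h i)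
        (fun z => η z fun j => hamiltonian Ω.toFun (i.removeNth h j) z) x) -
      ∑ i : Fin (k + 1), ∑ j ≥ i, (-1) ^ (i.val + j.val) *
        η x fun l => hamiltonian Ω.toFun ((Fin.cons (poissonFn Ω.toFun (h i.castSucc) (h j.succ))
          (j.removeNth (i.castSucc.removeNth h)) : Fin (k + 1) → M → 𝕜) l) x := by
  have h1 := extDeriv_apply_vectorField
    (V := fun i => vecInChart 𝕜 x (hamiltonian Ω.toFun (h i)))
    (hη.self_of_nhds.differentiableAt (by simp))
    (fun i => ((hh i).hamiltonian Ω).self_of_nhds.differentiableAt (by simp))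
  simp only [vecInChart_self] at h1
  refine h1.trans (congrArg₂ (· - ·) (Finset.sum_congr rfl fun i _ => ?_)
    (Finset.sum_congr rfl fun i _ => Finset.sum_congr rfl fun j _ => ?_))
  · rw [zsmul_eq_mul, Int.cast_pow, Int.cast_neg, Int.cast_one,
      ← fderiv_formInChart_apply Ω hη (h := i.removeNth h) (fun j => hh _), vecInChart_self]
    rfl
  · rw [zsmul_eq_mul, Int.cast_pow, Int.cast_neg, Int.cast_one,
      lieBracket_hamiltonian Ω (hh _) (hh _)]
    congr 1
    have h2 := formInChart_vecInChart (𝕜 := 𝕜) (q := x) η (fun l => hamiltonian Ω.toFun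
      ((Fin.cons (poissonFn Ω.toFun (h i.castSucc) (h j.succ))
          (j.removeNth (i.castSucc.removeNth h)) : Fin (k + 1) → M → 𝕜) l))
      (mem_extChartAt_target (I := 𝓘(𝕜, E)) x)
    rw [extChartAt_to_inv] at h2
    rw [← h2]
    simp only [vecInChart_self]
    congr 1
    ext l
    refine Fin.cases ?_ (fun l => ?_) l <;> rfl

end VectorFields
end LagrangianDeRham

/-! ### The shuffle expansion of the wedge product -/

namespace LagrangianDeRham

/-- With one representative `σ.out` fixed per shuffle, wedge products of forms on M, of germs and of
forms on the conormal module expand over the same index set and can be compared term by term. -/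
theorem altWedge_apply {A N : Type*} [CommRing A] [AddCommGroup N] [Module A N]
    {k l : ℕ} (Φ : N [⋀^Fin k]→ₗ[A] A) (Ψ : N [⋀^Fin l]→ₗ[A] A) (v : Fin (k + l) → N) :
    altWedge Φ Ψ v = ∑ σ : Equiv.Perm.ModSumCongr (Fin k) (Fin l),
      ((Equiv.Perm.sign σ.out : ℤ) : A) * (Φ (fun i => v (finSumFinEquiv (σ.out (Sum.inl i)))) *
        Ψ fun i => v (finSumFinEquiv (σ.out (Sum.inr i)))) := by
  rw [altWedge_eq_sum, AlternatingMap.domCoprod_apply, sum_apply, map_sum]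
  refine Finset.sum_congr rfl fun σ _ => ?_
  have h : σ = Quotient.mk'' σ.out := (Quotient.out_eq' σ).symm
  conv_lhs => rw [h, AlternatingMap.domCoprod.summand_mk'']
  rcases Int.units_eq_one_or (Equiv.Perm.sign σ.out) with h | h <;> simp [h]

/-! ### Germs and their representatives -/

section Evaluation

open Filter
open scoped Topology Manifold ContDiff

variable {𝕜 : Type*} [NontriviallyNormedField 𝕜] [IsRCLikeNormedField 𝕜]
variable {E : Type*} [NormedAddCommGroup E] [NormedSpace 𝕜 E]
variable {M : Type*} [TopologicalSpace M] [ChartedSpace E M] [IsManifold 𝓘(𝕜, E) ∞ M]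
variable {p : M}

/-- The inclusion of the germs of smooth functions into the ring of all germs. -/
def fnGerm.toGerm : fnGerm 𝕜 E p →+* Germ (𝓝 p) 𝕜 := (fnGermSubring 𝕜 E p).subtype

/-- The germ `a` is represented by the function `f`. -/
def fnGerm.IsRep (a : fnGerm 𝕜 E p) (f : M → 𝕜) : Prop := a.toGerm = (f : Germ (𝓝 p) 𝕜)

/-- The germ `a` is represented by the form `η`. -/
def formGerm.IsRep {k : ℕ} (a : formGerm 𝕜 E k p) (η : M → E [⋀^Fin k]→L[𝕜] 𝕜) : Prop :=
  a.1 = (η : Germ (𝓝 p) (E [⋀^Fin k]→L[𝕜] 𝕜))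

namespace fnGerm

theorem isRep_mk (f : M → 𝕜) (hf : SmoothFnAt E f p) : (mk f hf).IsRep f := rfl

theorem exists_isRep (a : fnGerm 𝕜 E p) : ∃ f, a.IsRep f := by
  obtain ⟨f, hf, rfl⟩ := a.exists_rep
  exact ⟨f, rfl⟩

variable {a b : fnGerm 𝕜 E p} {f g : M → 𝕜}

theorem IsRep.smooth (h : a.IsRep f) : SmoothFnAt E f p := by
  obtain ⟨f', hf', rfl⟩ := a.exists_rep
  have h : f' =ᶠ[𝓝 p] f := Germ.coe_eq.1 h
  filter_upwards [hf', h.eventuallyEq_nhds] with q h1 h2 using h1.congr_of_eventuallyEq h2.symm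

theorem IsRep.eq_mk (h : a.IsRep f) : a = mk f h.smooth := Subtype.ext h

theorem IsRep.ext (ha : a.IsRep f) (hb : b.IsRep g) (h : f =ᶠ[𝓝 p] g) : a = b :=
  Subtype.ext (ha.trans ((Germ.coe_eq.2 h).trans hb.symm))

theorem IsRep.eventuallyEq (ha : a.IsRep f) (hb : a.IsRep g) : f =ᶠ[𝓝 p] g :=
  Germ.coe_eq.1 (ha.symm.trans hb)

theorem IsRep.add (ha : a.IsRep f) (hb : b.IsRep g) : (a + b).IsRep (fun x => f x + g x) := by
  rw [IsRep, map_add, ha, hb]; rfl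

theorem IsRep.sub (ha : a.IsRep f) (hb : b.IsRep g) : (a - b).IsRep (fun x => f x - g x) := by
  rw [IsRep, map_sub, ha, hb]; rfl

theorem IsRep.mul (ha : a.IsRep f) (hb : b.IsRep g) : (a * b).IsRep (fun x => f x * g x) := by
  rw [IsRep, map_mul, ha, hb]; rfl

theorem isRep_intCast (n : ℤ) : (n : fnGerm 𝕜 E p).IsRep (fun _ => (n : 𝕜)) := by
  rw [IsRep, map_intCast]; rfl

theorem isRep_neg_one_pow (n : ℕ) : ((-1) ^ n : fnGerm 𝕜 E p).IsRep (fun _ => (-1) ^ n) := by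
  rw [IsRep, map_pow, map_neg, map_one]; rfl

theorem isRep_one : (1 : fnGerm 𝕜 E p).IsRep (fun _ => 1) := rfl

theorem isRep_zero : (0 : fnGerm 𝕜 E p).IsRep (fun _ => 0) := rfl

theorem isRep_sum {ι : Type*} (s : Finset ι) {a : ι → fnGerm 𝕜 E p} {f : ι → M → 𝕜}
    (h : ∀ i ∈ s, (a i).IsRep (f i)) : (∑ i ∈ s, a i).IsRep (fun x => ∑ i ∈ s, f i x) := by
  have e : (fun x => ∑ i ∈ s, f i x) = ∑ i ∈ s, f i := by ext x; simp
  rw [IsRep, map_sum, Finset.sum_congr rfl h, e]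
  exact (map_sum (Germ.coeRingHom (R := 𝕜) (𝓝 p)) f s).symm

theorem IsRep.poisson [FiniteDimensional 𝕜 E] (Ω : SymplecticForm 𝕜 E M) (ha : a.IsRep f)
    (hb : b.IsRep g) : ((poisson Ω p).toFun a b).IsRep (poissonFn Ω.toFun f g) := by
  rw [ha.eq_mk, hb.eq_mk]
  rfl

theorem IsRep.det {ι : Type*} [Fintype ι] [DecidableEq ι] {P : Matrix ι ι (fnGerm 𝕜 E p)}
    {F : ι → ι → M → 𝕜} (h : ∀ i j, (P i j).IsRep (F i j)) :
    P.det.IsRep (fun x => (Matrix.of fun i j => F i j x).det) := by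
  rw [IsRep, RingHom.map_det]
  have e : (toGerm : fnGerm 𝕜 E p →+* _).mapMatrix P =
      (Germ.coeRingHom (R := 𝕜) (𝓝 p)).mapMatrix (Matrix.of F) := by
    ext i j
    exact h i j
  rw [e, ← RingHom.map_det]
  show ((Matrix.of F).det : Germ (𝓝 p) 𝕜) = _
  congr 1
  ext x
  have := RingHom.map_det (Pi.evalRingHom (fun _ : M => 𝕜) x) (Matrix.of F)
  exact this

/-- The value at `p` of a germ at `p`. -/
noncomputable def value : fnGerm 𝕜 E p →+* 𝕜 := Germ.valueRingHom.comp toGerm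

theorem IsRep.value (h : a.IsRep f) : a.value = f p := by
  show Germ.value a.toGerm = f p
  rw [h]; rfl

/-- By continuity the function has no zero near p, and there its reciprocal is smooth. Hence the
stalk is a local ring whose maximal ideal consists of the germs that vanish at p. -/
theorem isUnit_of_value_ne_zero (h : a.value ≠ 0) : IsUnit a := by
  obtain ⟨f, hf⟩ := a.exists_isRep
  rw [hf.value] at h
  have hc : ContinuousAt f p := hf.smooth.self_of_nhds.continuousAt
  have hne : ∀ᶠ q in 𝓝 p, f q ≠ 0 := hc.eventually_ne h
  have hinv : SmoothFnAt E (fun x => (f x)⁻¹) p := by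
    filter_upwards [hf.smooth, hne] with q h1 h2
    have := (contDiffAt_inv 𝕜 (n := ∞) h2).contMDiffAt.comp q h1
    exact this
  refine IsUnit.of_mul_eq_one (mk _ hinv) ?_
  refine (hf.mul (isRep_mk _ hinv)).ext isRep_one ?_
  filter_upwards [hne] with q hq
  simp [hq]

theorem value_eq_zero_of_mem {I : Ideal (fnGerm 𝕜 E p)} (hI : I ≠ ⊤) (ha : a ∈ I) :
    a.value = 0 := by
  by_contra h
  exact hI (I.eq_top_of_isUnit_mem ha (isUnit_of_value_ne_zero h))

theorem isUnit_natCast {n : ℕ} (hn : n ≠ 0) : IsUnit (n : fnGerm 𝕜 E p) := by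
  refine isUnit_of_value_ne_zero ?_
  let _ := IsRCLikeNormedField.rclike 𝕜
  rw [map_natCast]
  exact_mod_cast hn

end fnGerm

namespace formGerm

variable {k : ℕ}

theorem isRep_mk (η : M → E [⋀^Fin k]→L[𝕜] 𝕜) (hη : SmoothFormAt η p) : (mk η hη).IsRep η := rfl

theorem exists_isRep (a : formGerm 𝕜 E k p) : ∃ η, a.IsRep η := by
  obtain ⟨f, hf, rfl⟩ := a.exists_rep
  exact ⟨f, rfl⟩

variable {a b : formGerm 𝕜 E k p} {η ζ : M → E [⋀^Fin k]→L[𝕜] 𝕜}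

theorem IsRep.smooth (h : a.IsRep η) : SmoothFormAt η p := by
  obtain ⟨η', hη', rfl⟩ := a.exists_rep
  have h : η' =ᶠ[𝓝 p] η := Germ.coe_eq.1 h
  filter_upwards [hη', h.eventuallyEq_nhds] with q h1 h2
  exact h1.congr_of_eventuallyEq (formInChart_congr (mem_extChartAt_source q) h2.symm)

theorem IsRep.eq_mk (h : a.IsRep η) : a = mk η h.smooth := Subtype.ext h

theorem IsRep.ext (ha : a.IsRep η) (hb : b.IsRep ζ) (h : η =ᶠ[𝓝 p] ζ) : a = b :=
  Subtype.ext (ha.trans ((Germ.coe_eq.2 h).trans hb.symm))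

theorem IsRep.add (ha : a.IsRep η) (hb : b.IsRep ζ) : (a + b).IsRep (fun x => η x + ζ x) := by
  rw [ha.eq_mk, hb.eq_mk]; rfl

theorem IsRep.smul {c : fnGerm 𝕜 E p} {f : M → 𝕜} (hc : c.IsRep f) (ha : a.IsRep η) :
    (c • a).IsRep (fun x => f x • η x) := by
  rw [ha.eq_mk, hc.eq_mk]; rfl

theorem IsRep.wedge {l : ℕ} {b : formGerm 𝕜 E l p} {ζ : M → E [⋀^Fin l]→L[𝕜] 𝕜}
    (ha : a.IsRep η) (hb : b.IsRep ζ) :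
    (wedge a b).IsRep (fun x => LagrangianDeRham.wedge (η x) (ζ x)) := by
  rw [ha.eq_mk, hb.eq_mk]; rfl

theorem IsRep.d (ha : a.IsRep η) : a.d.IsRep (mextDeriv η) := by
  rw [ha.eq_mk]; rfl

theorem _root_.LagrangianDeRham.fnGerm.IsRep.ofFn {c : fnGerm 𝕜 E p} {f : M → 𝕜}
    (hc : c.IsRep f) :
    (ofFn c).IsRep (fun x => ContinuousAlternatingMap.constOfIsEmpty 𝕜 E (Fin 0) (f x)) := by
  rw [hc.eq_mk]; rfl

theorem exists_eq_ofFn (a : formGerm 𝕜 E 0 p) : ∃ f, a = ofFn f := by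
  obtain ⟨η, hη⟩ := a.exists_isRep
  have hs : SmoothFnAt E (fun x => η x 0) p := by
    have := hη.smooth.apply (X := fun _ _ => (0 : E)) (fun i => i.elim0)
    filter_upwards [this] with q hq
    refine hq.congr_of_eventuallyEq (Eventually.of_forall fun x => ?_)
    congr 1
  refine ⟨fnGerm.mk _ hs, hη.ext (fnGerm.isRep_mk _ hs).ofFn (Eventually.of_forall fun x => ?_)⟩
  ext v
  rw [Subsingleton.elim v 0]
  rfl

end formGerm

/-! ### Evaluation of forms on hamiltonian vector fields -/

variable [FiniteDimensional 𝕜 E] (Ω : SymplecticForm 𝕜 E M)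

theorem hamiltonian_congr {f g : M → 𝕜} (h : f =ᶠ[𝓝 p] g) :
    ∀ᶠ q in 𝓝 p, hamiltonian Ω.toFun f q = hamiltonian Ω.toFun g q := by
  filter_upwards [fnDeriv_congr (E := E) h] with q hq
  rw [hamiltonian, hq, hamiltonian]

/-- H_g near p depends only on the germ of g. Quantifying over all representatives lets every
identity for `eval` be checked pointwise on representatives of one's choice. -/
theorem exists_eval {k : ℕ} (η : formGerm 𝕜 E k p) (g : Fin k → fnGerm 𝕜 E p) :
    ∃ a : fnGerm 𝕜 E p, ∀ (ζ : M → E [⋀^Fin k]→L[𝕜] 𝕜) (G : Fin k → M → 𝕜), η.IsRep ζ →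
      (∀ i, (g i).IsRep (G i)) →
      a.IsRep fun x => ζ x fun i => hamiltonian Ω.toFun (G i) x := by
  obtain ⟨ζ₀, hζ₀⟩ := η.exists_isRep
  choose G₀ hG₀ using fun i => (g i).exists_isRep
  refine ⟨fnGerm.mk _ (hζ₀.smooth.apply fun i => (hG₀ i).smooth.hamiltonian Ω),
    fun ζ G hζ hG => Germ.coe_eq.2 ?_⟩
  have h1 : ζ₀ =ᶠ[𝓝 p] ζ := Germ.coe_eq.1 (hζ₀.symm.trans hζ)
  filter_upwards [h1, eventually_all.2 fun i =>
    hamiltonian_congr Ω ((hG₀ i).eventuallyEq (hG i))] with q h1 h2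
  simp only [h1, h2]

/-- The germ of the function `η(H_{g_1}, ..., H_{g_k})`. -/
noncomputable def eval {k : ℕ} (η : formGerm 𝕜 E k p) (g : Fin k → fnGerm 𝕜 E p) :
    fnGerm 𝕜 E p := (exists_eval Ω η g).choose

variable {Ω}

theorem formGerm.IsRep.eval {k : ℕ} {η : formGerm 𝕜 E k p} {g : Fin k → fnGerm 𝕜 E p}
    {ζ : M → E [⋀^Fin k]→L[𝕜] 𝕜} {G : Fin k → M → 𝕜} (hη : η.IsRep ζ)
    (hg : ∀ i, (g i).IsRep (G i)) :
    (eval Ω η g).IsRep fun x => ζ x fun i => hamiltonian Ω.toFun (G i) x :=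
  (exists_eval Ω η g).choose_spec ζ G hη hg

theorem eval_add {k : ℕ} (η ζ : formGerm 𝕜 E k p) (g : Fin k → fnGerm 𝕜 E p) :
    eval Ω (η + ζ) g = eval Ω η g + eval Ω ζ g := by
  obtain ⟨η', hη⟩ := η.exists_isRep
  obtain ⟨ζ', hζ⟩ := ζ.exists_isRep
  choose G hG using fun i => (g i).exists_isRep
  exact ((hη.add hζ).eval hG).ext ((hη.eval hG).add (hζ.eval hG))
    (Eventually.of_forall fun x => rfl)

theorem eval_smul {k : ℕ} (c : fnGerm 𝕜 E p) (η : formGerm 𝕜 E k p) (g : Fin k → fnGerm 𝕜 E p) :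
    eval Ω (c • η) g = c * eval Ω η g := by
  obtain ⟨η', hη⟩ := η.exists_isRep
  obtain ⟨c', hc⟩ := c.exists_isRep
  choose G hG using fun i => (g i).exists_isRep
  exact ((formGerm.IsRep.smul hc hη).eval hG).ext (hc.mul (hη.eval hG))
    (Eventually.of_forall fun x => rfl)

theorem eval_zero {k : ℕ} (g : Fin k → fnGerm 𝕜 E p) :
    eval Ω (0 : formGerm 𝕜 E k p) g = 0 := by
  have := eval_smul (Ω := Ω) 0 (0 : formGerm 𝕜 E k p) g
  rwa [zero_smul, zero_mul] at this

theorem eval_sum {k : ℕ} {ι : Type*} (s : Finset ι) (η : ι → formGerm 𝕜 E k p)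
    (g : Fin k → fnGerm 𝕜 E p) : eval Ω (∑ i ∈ s, η i) g = ∑ i ∈ s, eval Ω (η i) g :=
  map_sum (AddMonoidHom.mk' (fun η : formGerm 𝕜 E k p => eval Ω η g) fun _ _ => eval_add _ _ _) η s

theorem eval_ofFn (f : fnGerm 𝕜 E p) (g : Fin 0 → fnGerm 𝕜 E p) :
    eval Ω (formGerm.ofFn f) g = f := by
  obtain ⟨f', hf⟩ := f.exists_isRep
  choose G hG using fun i => (g i).exists_isRep
  exact (hf.ofFn.eval hG).ext hf (Eventually.of_forall fun x => rfl)

theorem eval_wedge {k l : ℕ} (η : formGerm 𝕜 E k p) (ζ : formGerm 𝕜 E l p)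
    (g : Fin (k + l) → fnGerm 𝕜 E p) :
    eval Ω (formGerm.wedge η ζ) g = ∑ σ : Equiv.Perm.ModSumCongr (Fin k) (Fin l),
      ((Equiv.Perm.sign σ.out : ℤ) : fnGerm 𝕜 E p) *
        (eval Ω η (fun i => g (finSumFinEquiv (σ.out (Sum.inl i)))) *
          eval Ω ζ fun i => g (finSumFinEquiv (σ.out (Sum.inr i)))) := by
  obtain ⟨η', hη⟩ := η.exists_isRep
  obtain ⟨ζ', hζ⟩ := ζ.exists_isRep
  choose G hG using fun i => (g i).exists_isRep
  refine ((hη.wedge hζ).eval hG).ext (fnGerm.isRep_sum _ fun σ _ =>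
    (fnGerm.isRep_intCast _).mul ((hη.eval fun i => hG _).mul (hζ.eval fun i => hG _)))
    (Eventually.of_forall fun x => ?_)
  exact altWedge_apply _ _ _

theorem isRep_removeNth {k : ℕ} {g : Fin (k + 1) → fnGerm 𝕜 E p} {G : Fin (k + 1) → M → 𝕜}
    (hG : ∀ i, (g i).IsRep (G i)) (i : Fin (k + 1)) (j : Fin k) :
    (i.removeNth g j).IsRep (i.removeNth G j) := hG _

theorem isRep_cons {k : ℕ} {a : fnGerm 𝕜 E p} {f : M → 𝕜} {g : Fin k → fnGerm 𝕜 E p}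
    {G : Fin k → M → 𝕜} (ha : a.IsRep f) (hG : ∀ i, (g i).IsRep (G i)) (i : Fin (k + 1)) :
    ((Fin.cons a g : Fin (k + 1) → fnGerm 𝕜 E p) i).IsRep
      ((Fin.cons f G : Fin (k + 1) → M → 𝕜) i) := by
  refine Fin.cases ?_ (fun i => ?_) i
  · exact ha
  · exact hG i

theorem isRep_update {k : ℕ} {a : fnGerm 𝕜 E p} {f : M → 𝕜} {g : Fin k → fnGerm 𝕜 E p}
    {G : Fin k → M → 𝕜} (ha : a.IsRep f) (hG : ∀ i, (g i).IsRep (G i)) (i j : Fin k) :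
    (Function.update g i a j).IsRep (Function.update G i f j) := by
  by_cases h : j = i
  · subst h; simpa using ha
  · simpa [h] using hG j

theorem eval_d_zero (η : formGerm 𝕜 E 0 p) (g : Fin 1 → fnGerm 𝕜 E p) :
    eval Ω η.d g = ∑ i : Fin 1, (-1) ^ i.val *
      (poisson Ω p).toFun (g i) (eval Ω η (i.removeNth g)) := by
  obtain ⟨η', hη⟩ := η.exists_isRep
  choose G hG using fun i => (g i).exists_isRep
  refine (hη.d.eval hG).ext (fnGerm.isRep_sum _ fun i _ => (fnGerm.isRep_neg_one_pow _).mul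
    ((hG i).poisson Ω (hη.eval (isRep_removeNth hG i)))) ?_
  have h1 : ∀ᶠ x in 𝓝 p, ∀ i, SmoothFnAt E (G i) x :=
    eventually_all.2 fun i => (hG i).smooth.eventually_nhds
  filter_upwards [hη.smooth.eventually_nhds, h1] with x h1 h2
  exact mextDeriv_apply_hamiltonian_zero Ω h1 h2

/-- The representatives are smooth at every point near p, so the pointwise Cartan formula holds on a
neighbourhood and is an identity of germs. -/
theorem eval_d_succ {k : ℕ} (η : formGerm 𝕜 E (k + 1) p) (g : Fin (k + 2) → fnGerm 𝕜 E p) :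
    eval Ω η.d g = (∑ i, (-1) ^ i.val *
      (poisson Ω p).toFun (g i) (eval Ω η (i.removeNth g))) -
      ∑ i : Fin (k + 1), ∑ j ≥ i, (-1) ^ (i.val + j.val) *
        eval Ω η (Fin.cons ((poisson Ω p).toFun (g i.castSucc) (g j.succ))
          (j.removeNth (i.castSucc.removeNth g))) := by
  obtain ⟨η', hη⟩ := η.exists_isRep
  choose G hG using fun i => (g i).exists_isRep
  refine (hη.d.eval hG).ext (fnGerm.IsRep.sub (fnGerm.isRep_sum _ fun i _ =>
    (fnGerm.isRep_neg_one_pow _).mul ((hG i).poisson Ω (hη.eval (isRep_removeNth hG i))))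
    (fnGerm.isRep_sum _ fun i _ => fnGerm.isRep_sum _ fun j _ => (fnGerm.isRep_neg_one_pow _).mul
      (hη.eval (isRep_cons ((hG _).poisson Ω (hG _))
        (isRep_removeNth (isRep_removeNth hG _) _))))) ?_
  have h1 : ∀ᶠ x in 𝓝 p, ∀ i, SmoothFnAt E (G i) x :=
    eventually_all.2 fun i => (hG i).smooth.eventually_nhds
  filter_upwards [hη.smooth.eventually_nhds, h1] with x h1 h2
  exact mextDeriv_apply_hamiltonian_succ Ω h1 h2

theorem eval_d_ofFn (f : fnGerm 𝕜 E p) (g : Fin 1 → fnGerm 𝕜 E p) :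
    eval Ω (formGerm.ofFn f).d g = (poisson Ω p).toFun (g 0) f := by
  rw [eval_d_zero]
  simp [eval_ofFn]

theorem hamiltonian_add {f g : M → 𝕜} {q : M} (hf : ContMDiffAt 𝓘(𝕜, E) 𝓘(𝕜, 𝕜) ∞ f q)
    (hg : ContMDiffAt 𝓘(𝕜, E) 𝓘(𝕜, 𝕜) ∞ g q) :
    hamiltonian Ω.toFun (f + g) q = hamiltonian Ω.toFun f q + hamiltonian Ω.toFun g q := by
  rw [hamiltonian, fnDeriv_add hf hg, map_add]; rfl

theorem hamiltonian_mul {f g : M → 𝕜} {q : M} (hf : ContMDiffAt 𝓘(𝕜, E) 𝓘(𝕜, 𝕜) ∞ f q)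
    (hg : ContMDiffAt 𝓘(𝕜, E) 𝓘(𝕜, 𝕜) ∞ g q) :
    hamiltonian Ω.toFun (f * g) q =
      f q • hamiltonian Ω.toFun g q + g q • hamiltonian Ω.toFun f q := by
  rw [hamiltonian, fnDeriv_mul hf hg, map_add, map_smul, map_smul]; rfl

theorem hamiltonian_update {k : ℕ} (G : Fin k → M → 𝕜) (i : Fin k) (f : M → 𝕜) (x : M) :
    (fun j => hamiltonian Ω.toFun (Function.update G i f j) x) =
      Function.update (fun j => hamiltonian Ω.toFun (G j) x) i (hamiltonian Ω.toFun f x) := by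
  ext j
  exact Function.apply_update (fun _ f => hamiltonian Ω.toFun f x) G i f j

theorem eval_update_add {k : ℕ} (η : formGerm 𝕜 E k p) (g : Fin k → fnGerm 𝕜 E p) (i : Fin k)
    (a b : fnGerm 𝕜 E p) : eval Ω η (Function.update g i (a + b)) =
      eval Ω η (Function.update g i a) + eval Ω η (Function.update g i b) := by
  obtain ⟨η', hη⟩ := η.exists_isRep
  obtain ⟨a', ha⟩ := a.exists_isRep
  obtain ⟨b', hb⟩ := b.exists_isRep
  choose G hG using fun i => (g i).exists_isRep
  refine (hη.eval (isRep_update (ha.add hb) hG i)).ext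
    ((hη.eval (isRep_update ha hG i)).add (hη.eval (isRep_update hb hG i))) ?_
  filter_upwards [ha.smooth, hb.smooth] with x h1 h2
  have e : hamiltonian Ω.toFun (fun x => a' x + b' x) x = _ := hamiltonian_add (Ω := Ω) h1 h2
  rw [hamiltonian_update, hamiltonian_update, hamiltonian_update, e]
  exact (η' x).map_update_add _ i _ _

/-- H_{ab} = a H_b + b H_a, so evaluation is a derivation in each function rather than linear. The
descent to I / I² rests on this rule. -/
theorem eval_update_mul {k : ℕ} (η : formGerm 𝕜 E k p) (g : Fin k → fnGerm 𝕜 E p) (i : Fin k)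
    (a b : fnGerm 𝕜 E p) : eval Ω η (Function.update g i (a * b)) =
      a * eval Ω η (Function.update g i b) + b * eval Ω η (Function.update g i a) := by
  obtain ⟨η', hη⟩ := η.exists_isRep
  obtain ⟨a', ha⟩ := a.exists_isRep
  obtain ⟨b', hb⟩ := b.exists_isRep
  choose G hG using fun i => (g i).exists_isRep
  refine (hη.eval (isRep_update (ha.mul hb) hG i)).ext
    ((ha.mul (hη.eval (isRep_update hb hG i))).add (hb.mul (hη.eval (isRep_update ha hG i)))) ?_
  filter_upwards [ha.smooth, hb.smooth] with x h1 h2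
  have e : hamiltonian Ω.toFun (fun x => a' x * b' x) x = _ := hamiltonian_mul (Ω := Ω) h1 h2
  rw [hamiltonian_update, hamiltonian_update, hamiltonian_update, e,
    (η' x).map_update_add, (η' x).map_update_smul, (η' x).map_update_smul]
  rfl

theorem eval_eq_zero_of_eq {k : ℕ} (η : formGerm 𝕜 E k p) (g : Fin k → fnGerm 𝕜 E p)
    {i j : Fin k} (h : g i = g j) (hij : i ≠ j) : eval Ω η g = 0 := by
  obtain ⟨η', hη⟩ := η.exists_isRep
  choose G hG using fun i => (g i).exists_isRep
  refine (hη.eval hG).ext fnGerm.isRep_zero ?_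
  have hij' : G i =ᶠ[𝓝 p] G j := (hG i).eventuallyEq (h ▸ hG j)
  filter_upwards [hamiltonian_congr Ω hij'] with x hx
  exact (η' x).map_eq_zero_of_eq _ hx hij

/-- Germs of forms can be contracted with the hamiltonian vector field of `a`. -/
theorem exists_contraction {k : ℕ} (η : formGerm 𝕜 E (k + 1) p) (a : fnGerm 𝕜 E p) :
    ∃ ζ : formGerm 𝕜 E k p, ∀ g, eval Ω ζ g = eval Ω η (Fin.cons a g) := by
  obtain ⟨η', hη⟩ := η.exists_isRep
  obtain ⟨a', ha⟩ := a.exists_isRep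
  refine ⟨formGerm.mk _ (hη.smooth.curryLeft (ha.smooth.hamiltonian Ω)), fun g => ?_⟩
  choose G hG using fun i => (g i).exists_isRep
  refine ((formGerm.isRep_mk _ _).eval hG).ext (hη.eval (isRep_cons ha hG))
    (Eventually.of_forall fun x => ?_)
  simp only [ContinuousAlternatingMap.curryLeft_apply_apply]
  congr 1
  ext i
  refine Fin.cases ?_ (fun i => ?_) i <;> rfl

/-- Pairing a relation ∑ c_a H_{u_a} = 0 with du_b shows that c is annihilated by the matrix of
Poisson brackets. -/
theorem linearIndependent_hamiltonian {ι : Type*} [Fintype ι] [DecidableEq ι] {U : ι → M → 𝕜}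
    {x : M} (h : (Matrix.of fun a b => poissonFn Ω.toFun (U a) (U b) x).det ≠ 0) :
    LinearIndependent 𝕜 fun a => hamiltonian Ω.toFun (U a) x := by
  rw [Fintype.linearIndependent_iff]
  intro c hc
  have h1 : Matrix.vecMul c (Matrix.of fun a b => poissonFn Ω.toFun (U a) (U b) x) = 0 := by
    ext b
    have := congrArg (fnDeriv E (U b) x) hc
    simp only [map_sum, map_smul, map_zero] at this
    exact this
  have h2 := Matrix.eq_zero_of_vecMul_eq_zero h h1
  exact fun i => congrFun h2 i

/-- A germ of a form is determined by its values on a frame of hamiltonian vector fields. -/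
theorem eval_injective {ι : Type*} [Fintype ι] [DecidableEq ι]
    (hι : Fintype.card ι = Module.finrank 𝕜 E) {u : ι → fnGerm 𝕜 E p}
    (hu : IsUnit (Matrix.of fun a b => (poisson Ω p).toFun (u a) (u b)).det) {k : ℕ}
    {η ζ : formGerm 𝕜 E k p}
    (h : ∀ a : Fin k → ι, eval Ω η (fun i => u (a i)) = eval Ω ζ (fun i => u (a i))) : η = ζ := by
  obtain ⟨η', hη⟩ := η.exists_isRep
  obtain ⟨ζ', hζ⟩ := ζ.exists_isRep
  choose U hU using fun i => (u i).exists_isRep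
  refine hη.ext hζ ?_
  obtain ⟨v, hv⟩ := hu.exists_right_inv
  obtain ⟨v', hv'⟩ := v.exists_isRep
  have hdet := fnGerm.IsRep.det (P := Matrix.of fun a b => (poisson Ω p).toFun (u a) (u b))
    fun a b => (hU a).poisson Ω (hU b)
  -- The determinant times its inverse is the germ of 1, so the determinant is nonzero near p and
  -- the hamiltonian fields form a basis of each nearby tangent space.
  have h1 := (hdet.mul hv').eventuallyEq
    (hv ▸ fnGerm.isRep_one)
  have h2 : ∀ᶠ x in 𝓝 p, ∀ a : Fin k → ι, (η' x fun i => hamiltonian Ω.toFun (U (a i)) x) =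
      ζ' x fun i => hamiltonian Ω.toFun (U (a i)) x :=
    eventually_all.2 fun a => (hη.eval fun i => hU (a i)).eventuallyEq
      (h a ▸ hζ.eval fun i => hU (a i))
  filter_upwards [h1, h2] with x h1 h2
  have hli := linearIndependent_hamiltonian (Ω := Ω) (U := U) (x := x)
    (left_ne_zero_of_mul_eq_one h1)
  let b := basisOfLinearIndependentOfCardEqFinrank' _ hli hι
  apply ContinuousAlternatingMap.toAlternatingMap_injective
  refine b.ext_alternating fun a _ => ?_
  have := h2 a
  simpa [b] using this

end Evaluation
end LagrangianDeRham

namespace LagrangianDeRham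

/-! ### Descent of alternating forms from I to I / I² -/

section Descent

variable {R : Type*} [CommRing R] {I : Ideal R} {k : ℕ}

/-- The entries of g are replaced by those of g' one at a time; each replacement changes an entry by
an element of I². -/
theorem alternating_congr_cotangent (F : I [⋀^Fin k]→ₗ[R] (R ⧸ I))
    (hF : ∀ (g : Fin k → I) (i : Fin k) (x : I), I.toCotangent x = 0 →
      F (Function.update g i x) = 0)
    {g g' : Fin k → I} (h : ∀ i, I.toCotangent (g i) = I.toCotangent (g' i)) : F g = F g' := by
  have key : ∀ s : Finset (Fin k), F (s.piecewise g' g) = F g := by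
    intro s
    induction s using Finset.induction_on with
    | empty => simp
    | insert i s his ih =>
      have h1 : g' i = g i + (g' i - g i) := by abel
      have h2 : Function.update (s.piecewise g' g) i (g i) = s.piecewise g' g := by
        conv_lhs => rw [← Finset.piecewise_eq_of_notMem s g' g his]
        exact Function.update_eq_self i _
      rw [Finset.piecewise_insert, h1, F.map_update_add, hF _ i (g' i - g i) (by
        rw [map_sub, h i, sub_self]), add_zero, h2, ih]
  have := key Finset.univ
  rw [Finset.piecewise_univ] at this
  exact this.symm

/-- The form on `I / I²` induced by an alternating form on `I` that vanishes on `I²`. -/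
noncomputable def cotangentForm (F : I [⋀^Fin k]→ₗ[R] (R ⧸ I))
    (hF : ∀ (g : Fin k → I) (i : Fin k) (x : I), I.toCotangent x = 0 →
      F (Function.update g i x) = 0) : I.Cotangent [⋀^Fin k]→ₗ[R ⧸ I] (R ⧸ I) :=
  have hmk : ∀ g : Fin k → I, F (fun i => Function.surjInv I.toCotangent_surjective
      (I.toCotangent (g i))) = F g := fun g =>
    alternating_congr_cotangent F hF fun i => Function.surjInv_eq I.toCotangent_surjective _
  have hup : ∀ (g : Fin k → I) (i : Fin k) (x : I),
      Function.update (fun j => I.toCotangent (g j)) i (I.toCotangent x) =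
        fun j => I.toCotangent (Function.update g i x j) := fun g i x => by
    ext j
    exact (Function.apply_update (fun _ y => I.toCotangent y) g i x j).symm
  { toFun := fun v => F fun i => Function.surjInv I.toCotangent_surjective (v i)
    map_update_add' := by
      intro inst v i x y
      rw [Subsingleton.elim inst (instDecidableEqFin _)]
      choose g hg using fun i => I.toCotangent_surjective (v i)
      obtain rfl : (fun i => I.toCotangent (g i)) = v := funext hg
      obtain ⟨x, rfl⟩ := I.toCotangent_surjective x
      obtain ⟨y, rfl⟩ := I.toCotangent_surjective y
      simp only [← map_add, hup, hmk, F.map_update_add]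
    map_update_smul' := by
      intro inst v i c x
      rw [Subsingleton.elim inst (instDecidableEqFin _)]
      choose g hg using fun i => I.toCotangent_surjective (v i)
      obtain rfl : (fun i => I.toCotangent (g i)) = v := funext hg
      obtain ⟨x, rfl⟩ := I.toCotangent_surjective x
      obtain ⟨c, rfl⟩ := Ideal.Quotient.mk_surjective c
      simp only [SkewBiderivation.mk_smul_toCotangent, hup, hmk, F.map_update_smul]
      rfl
    map_eq_zero_of_eq' := fun v i j h hij =>
      F.map_eq_zero_of_eq _ (congrArg (Function.surjInv I.toCotangent_surjective) h) hij }

theorem cotangentForm_mk (F : I [⋀^Fin k]→ₗ[R] (R ⧸ I))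
    (hF : ∀ (g : Fin k → I) (i : Fin k) (x : I), I.toCotangent x = 0 →
      F (Function.update g i x) = 0) (g : Fin k → I) :
    cotangentForm F hF (fun i => I.toCotangent (g i)) = F g :=
  alternating_congr_cotangent F hF fun _ => Function.surjInv_eq I.toCotangent_surjective _

theorem cotangentForm_ext {F G : I.Cotangent [⋀^Fin k]→ₗ[R ⧸ I] (R ⧸ I)}
    (h : ∀ g : Fin k → I, F (fun i => I.toCotangent (g i)) = G (fun i => I.toCotangent (g i))) :
    F = G := by
  ext v
  choose g hg using fun i => I.toCotangent_surjective (v i)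
  obtain rfl : (fun i => I.toCotangent (g i)) = v := funext hg
  exact h g

end Descent

/-! ### The morphism J -/

section Morphism

open Filter TopologicalSpace
open scoped Topology Manifold ContDiff

variable {𝕜 : Type*} [NontriviallyNormedField 𝕜] [IsRCLikeNormedField 𝕜]
variable {E : Type*} [NormedAddCommGroup E] [NormedSpace 𝕜 E] [FiniteDimensional 𝕜 E]
variable {M : Type*} [TopologicalSpace M] [ChartedSpace E M] [IsManifold 𝓘(𝕜, E) ∞ M]
variable {p : M} (Ω : SymplecticForm 𝕜 E M)

theorem coe_update {R : Type*} [CommRing R] {I : Ideal R} {k : ℕ} (g : Fin k → I) (i : Fin k)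
    (x : I) : (fun j => (Function.update g i x j : R)) =
      Function.update (fun j => (g j : R)) i (x : R) := by
  ext j
  exact Function.apply_update (fun _ (y : I) => (y : R)) g i x j

/-- The form `(g_1, ..., g_k) ↦ (-1)^k η(H_{g_1}, ..., H_{g_k})` on an ideal of functions. -/
noncomputable def idealForm (I : Ideal (fnGerm 𝕜 E p)) {k : ℕ} (η : formGerm 𝕜 E k p) :
    I [⋀^Fin k]→ₗ[fnGerm 𝕜 E p] (fnGerm 𝕜 E p ⧸ I) where
  toFun g := Ideal.Quotient.mk I ((-1) ^ k * eval Ω η fun i => g i)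
  map_update_add' := by
    intro inst g i x y
    rw [Subsingleton.elim inst (instDecidableEqFin _), ← map_add, coe_update, coe_update,
      coe_update, Submodule.coe_add, eval_update_add, mul_add]
  map_update_smul' := by
    intro inst g i c x
    rw [Subsingleton.elim inst (instDecidableEqFin _), coe_update, coe_update, Submodule.coe_smul,
      smul_eq_mul, eval_update_mul, ← Ideal.Quotient.mk_eq_mk, ← Ideal.Quotient.mk_eq_mk,
      ← Submodule.Quotient.mk_smul, Ideal.Quotient.mk_eq_mk, Ideal.Quotient.mk_eq_mk,
      Ideal.Quotient.eq, smul_eq_mul]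
    -- The Leibniz rule leaves, besides the linear term, x times the evaluation at c; it vanishes
    -- modulo I because x is in I.
    have e : ∀ s c a x b : fnGerm 𝕜 E p, s * (c * a + x * b) - c * (s * a) = x * (s * b) :=
      fun s c a x b => by ring
    rw [e]
    exact I.mul_mem_right _ x.2
  map_eq_zero_of_eq' := fun g i j h hij => by
    rw [eval_eq_zero_of_eq η _ (congrArg Subtype.val h) hij, mul_zero, map_zero]

theorem idealForm_apply (I : Ideal (fnGerm 𝕜 E p)) {k : ℕ} (η : formGerm 𝕜 E k p)
    (g : Fin k → I) :
    idealForm Ω I η g = Ideal.Quotient.mk I ((-1) ^ k * eval Ω η fun i => g i) := rfl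

variable {Ω} in
theorem eval_update_mem_of_sq {I : Ideal (fnGerm 𝕜 E p)} {k : ℕ} (η : formGerm 𝕜 E k p)
    (g : Fin k → fnGerm 𝕜 E p) (i : Fin k) {x : fnGerm 𝕜 E p} (hx : x ∈ I ^ 2) :
    eval Ω η (Function.update g i x) ∈ I := by
  rw [pow_two] at hx
  refine Submodule.smul_induction_on hx (fun a ha b hb => ?_) (fun a b ha hb => ?_)
  · rw [smul_eq_mul, eval_update_mul]
    exact add_mem (I.mul_mem_right _ ha) (I.mul_mem_right _ hb)
  · rw [eval_update_add]; exact add_mem ha hb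

theorem idealForm_update_eq_zero (I : Ideal (fnGerm 𝕜 E p)) {k : ℕ} (η : formGerm 𝕜 E k p)
    (g : Fin k → I) (i : Fin k) (x : I) (hx : I.toCotangent x = 0) :
    idealForm Ω I η (Function.update g i x) = 0 := by
  rw [idealForm_apply, coe_update, Ideal.Quotient.eq_zero_iff_mem]
  exact I.mul_mem_left _ (eval_update_mem_of_sq η _ i ((I.toCotangent_eq_zero x).1 hx))

/-- The map `η ↦ ((g_1, ..., g_k) ↦ (-1)^k η(H_{g_1}, ..., H_{g_k}))`, on germs. -/
noncomputable def conormalForm (I : Ideal (fnGerm 𝕜 E p)) (k : ℕ) :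
    formGerm 𝕜 E k p →ₗ[fnGerm 𝕜 E p]
      I.Cotangent [⋀^Fin k]→ₗ[fnGerm 𝕜 E p ⧸ I] (fnGerm 𝕜 E p ⧸ I) where
  toFun η := cotangentForm (idealForm Ω I η) (idealForm_update_eq_zero Ω I η)
  map_add' η ζ := by
    refine cotangentForm_ext fun g => ?_
    rw [AlternatingMap.add_apply]
    simp only [cotangentForm_mk, idealForm_apply, eval_add, mul_add, map_add]
  map_smul' c η := by
    refine cotangentForm_ext fun g => ?_
    rw [AlternatingMap.smul_apply]
    simp only [cotangentForm_mk, idealForm_apply, eval_smul, mul_left_comm _ c]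
    rfl

theorem conormalForm_mk (I : Ideal (fnGerm 𝕜 E p)) {k : ℕ} (η : formGerm 𝕜 E k p)
    (g : Fin k → I) : conormalForm Ω I k η (fun i => I.toCotangent (g i)) =
      Ideal.Quotient.mk I ((-1) ^ k * eval Ω η fun i => g i) :=
  cotangentForm_mk _ (idealForm_update_eq_zero Ω I η) g

variable {Ω}

/-- Induction over the generation of the ideal. Involutivity is needed only for d: in Cartan's
formula {g_i, -} maps I to itself, and the new entries {g_i, g_j} are again in I. -/
theorem eval_mem_of_deRhamIdealMem {I : Ideal (fnGerm 𝕜 E p)}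
    (hI : ∀ f ∈ I, ∀ g ∈ I, (poisson Ω p).toFun f g ∈ I) {k : ℕ} {η : formGerm 𝕜 E k p}
    (h : DeRhamIdealMem I k η) : ∀ g : Fin k → fnGerm 𝕜 E p, (∀ i, g i ∈ I) → eval Ω η g ∈ I := by
  induction h with
  | ofFn f hf => intro g _; rwa [eval_ofFn]
  | zero k => intro g _; rw [eval_zero]; exact zero_mem _
  | add η ζ _ _ h1 h2 => intro g hg; rw [eval_add]; exact add_mem (h1 g hg) (h2 g hg)
  | smul f η _ h1 => intro g hg; rw [eval_smul]; exact I.mul_mem_left _ (h1 g hg)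
  | wedge_left η ζ _ h1 =>
    intro g hg
    rw [eval_wedge]
    exact sum_mem fun σ _ => I.mul_mem_left _ (I.mul_mem_right _ (h1 _ fun i => hg _))
  | wedge_right η ζ _ h1 =>
    intro g hg
    rw [eval_wedge]
    exact sum_mem fun σ _ => I.mul_mem_left _ (I.mul_mem_left _ (h1 _ fun i => hg _))
  | @d k η _ h1 =>
    intro g hg
    cases k with
    | zero =>
      rw [eval_d_zero]
      exact sum_mem fun i _ => I.mul_mem_left _ (hI _ (hg _) _ (h1 _ fun j => hg _))
    | succ k =>
      rw [eval_d_succ]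
      refine sub_mem (sum_mem fun i _ => I.mul_mem_left _ (hI _ (hg _) _ (h1 _ fun j => hg _)))
        (sum_mem fun i _ => sum_mem fun j _ => I.mul_mem_left _ (h1 _ fun l => ?_))
      refine Fin.cases ?_ (fun l => ?_) l
      · exact hI _ (hg _) _ (hg _)
      · exact hg _

theorem deRhamIdeal_le_ker {I : Ideal (fnGerm 𝕜 E p)}
    (hI : ∀ f ∈ I, ∀ g ∈ I, (poisson Ω p).toFun f g ∈ I) (k : ℕ) :
    deRhamIdeal I k ≤ LinearMap.ker (conormalForm Ω I k) := by
  intro η hη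
  rw [LinearMap.mem_ker]
  refine cotangentForm_ext fun g => ?_
  rw [conormalForm_mk]
  exact Ideal.Quotient.eq_zero_iff_mem.2
    (I.mul_mem_left _ (eval_mem_of_deRhamIdealMem hI hη _ fun i => (g i).2))

theorem conormalForm_wedge (I : Ideal (fnGerm 𝕜 E p)) {k l : ℕ} (η : formGerm 𝕜 E k p)
    (ζ : formGerm 𝕜 E l p) : conormalForm Ω I (k + l) (formGerm.wedge η ζ) =
      altWedge (conormalForm Ω I k η) (conormalForm Ω I l ζ) := by
  refine cotangentForm_ext fun g => ?_
  rw [conormalForm_mk, altWedge_apply, eval_wedge, Finset.mul_sum, map_sum]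
  refine Finset.sum_congr rfl fun σ _ => ?_
  have h1 := conormalForm_mk Ω I η fun i => g (finSumFinEquiv (σ.out (Sum.inl i)))
  have h2 := conormalForm_mk Ω I ζ fun i => g (finSumFinEquiv (σ.out (Sum.inr i)))
  rw [h1, h2, ← map_mul, ← map_intCast (Ideal.Quotient.mk I), ← map_mul]
  congr 1
  ring

/-- Both sums in δ have the opposite sign to those in Cartan's formula. The factor (-1)^k built into
`conormalForm` accounts for this, since it changes sign when the degree grows by one. -/
theorem conormalForm_d {I : Ideal (fnGerm 𝕜 E p)}
    (hI : ∀ f ∈ I, ∀ g ∈ I, (poisson Ω p).toFun f g ∈ I) {k : ℕ} (η : formGerm 𝕜 E k p)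
    (g : Fin (k + 1) → I) :
    conormalForm Ω I (k + 1) η.d (fun i => I.toCotangent (g i)) =
      ((poisson Ω p).conormalAlgebroid hI).diffFun (conormalForm Ω I k η)
        (fun i => I.toCotangent (g i)) := by
  have hA : ∀ (x : I) (a : fnGerm 𝕜 E p),
      ((poisson Ω p).conormalAlgebroid hI).anchor (I.toCotangent x) (Ideal.Quotient.mk I a) =
        Ideal.Quotient.mk I ((poisson Ω p).toFun x a) := (poisson Ω p).conormalAnchorFun_mk hI
  have hB : ∀ x y : I, ((poisson Ω p).conormalAlgebroid hI).bracket (I.toCotangent x)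
      (I.toCotangent y) = I.toCotangent ⟨(poisson Ω p).toFun x y, hI _ x.2 _ y.2⟩ :=
    (poisson Ω p).conormalBracketFun_mk hI
  have hP : ∀ (x : I) (n : ℕ) (a : fnGerm 𝕜 E p), (poisson Ω p).toFun x ((-1) ^ n * a) =
      (-1) ^ n * (poisson Ω p).toFun x a := by
    intro x n a
    rcases neg_one_pow_eq_or (fnGerm 𝕜 E p) n with h | h <;> simp [h]
  have hsum : ∀ i : Fin (k + 1), (-1) ^ (i.val + 1) *
      ((poisson Ω p).conormalAlgebroid hI).anchor (I.toCotangent (g i))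
        (conormalForm Ω I k η (i.removeNth fun j => I.toCotangent (g j))) =
      Ideal.Quotient.mk I ((-1) ^ (k + 1) * ((-1) ^ i.val * (poisson Ω p).toFun (g i)
        (eval Ω η (i.removeNth fun j => (g j : fnGerm 𝕜 E p))))) := by
    intro i
    have h1 := conormalForm_mk Ω I η (i.removeNth g)
    have h2 : (i.removeNth fun j => I.toCotangent (g j)) =
      fun j => I.toCotangent (i.removeNth g j) := rfl
    rw [h2, h1, hA, hP]
    simp only [map_mul, map_pow, map_neg, map_one]
    have h3 : (fun j => (i.removeNth g j : fnGerm 𝕜 E p)) =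
      i.removeNth fun j => (g j : fnGerm 𝕜 E p) := rfl
    rw [h3]
    ring
  rw [conormalForm_mk]
  cases k with
  | zero =>
    rw [AnchoredBracket.diffFun, eval_d_zero, Finset.mul_sum, map_sum]
    exact Finset.sum_congr rfl fun i _ => (hsum i).symm
  | succ k =>
    rw [AnchoredBracket.diffFun, eval_d_succ, mul_sub, Finset.mul_sum, Finset.mul_sum,
      sub_eq_add_neg, ← Finset.sum_neg_distrib, map_add, map_sum, map_sum]
    refine congrArg₂ (· + ·) (Finset.sum_congr rfl fun i _ => (hsum i).symm)
      (Finset.sum_congr rfl fun i _ => ?_)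
    rw [Finset.mul_sum, ← Finset.sum_neg_distrib, map_sum]
    refine Finset.sum_congr rfl fun j _ => ?_
    have h1 := conormalForm_mk Ω I η (Fin.cons
      ⟨(poisson Ω p).toFun (g i.castSucc) (g j.succ), hI _ (g _).2 _ (g _).2⟩
      (j.removeNth (i.castSucc.removeNth g)) : Fin (k + 1) → I)
    have h2 : (fun l => I.toCotangent ((Fin.cons
        ⟨(poisson Ω p).toFun (g i.castSucc) (g j.succ), hI _ (g _).2 _ (g _).2⟩
        (j.removeNth (i.castSucc.removeNth g)) : Fin (k + 1) → I) l)) =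
      Fin.cons (((poisson Ω p).conormalAlgebroid hI).bracket (I.toCotangent (g i.castSucc))
        (I.toCotangent (g j.succ)))
        (j.removeNth (i.castSucc.removeNth fun l => I.toCotangent (g l))) := by
      rw [hB]
      ext l
      refine Fin.cases ?_ (fun l => ?_) l <;> rfl
    have h3 : (fun l => ((Fin.cons
        ⟨(poisson Ω p).toFun (g i.castSucc) (g j.succ), hI _ (g _).2 _ (g _).2⟩
        (j.removeNth (i.castSucc.removeNth g)) : Fin (k + 1) → I) l : fnGerm 𝕜 E p)) =
      Fin.cons ((poisson Ω p).toFun (g i.castSucc) (g j.succ))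
        (j.removeNth (i.castSucc.removeNth fun l => (g l : fnGerm 𝕜 E p))) := by
      ext l
      refine Fin.cases ?_ (fun l => ?_) l <;> rfl
    rw [h2, h3] at h1
    rw [h1]
    simp only [map_mul, map_pow, map_neg, map_one]
    ring

/-- The morphism from the de Rham algebra of `L` to the algebra of forms on the conormal sheaf. -/
noncomputable def deRhamToConormal (I : IdealSheaf 𝕜 E M) (hI : I.IsInvolutive Ω) :
    DGAMorphism I hI where
  toFun k p := (deRhamIdeal (I.stalk p) k).liftQ (conormalForm Ω (I.stalk p) k)
    (deRhamIdeal_le_ker (hI p) k)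
  map_sections U k s hs := by
    intro V hV h hsm hm p
    obtain ⟨η, hη⟩ := hs ⟨p.1, hV p.2⟩
    have hc : Tendsto (fun q : V => (⟨q.1, hV q.2⟩ : U)) (𝓝 p) (𝓝 ⟨p.1, hV p.2⟩) :=
      (continuous_inclusion hV).tendsto p
    -- One form η induces s at all points near p, so this one function induces the values of J(s)
    -- there.
    refine ⟨fun x => (-1) ^ k * η x fun i => hamiltonian Ω.toFun (h i) x, ?_⟩
    filter_upwards [hc.eventually hη] with q ⟨hq, hsq⟩
    have hrep := (fnGerm.isRep_neg_one_pow (𝕜 := 𝕜) (E := E) (p := q.1) k).mul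
      ((formGerm.isRep_mk η hq).eval (Ω := Ω) fun i => fnGerm.isRep_mk (h i) (hsm i q))
    refine ⟨hrep.smooth, ?_⟩
    rw [← hrep.eq_mk]
    simp only [hsq]
    exact conormalForm_mk Ω (I.stalk q.1) _ fun i => ⟨_, hm i q⟩
  map_fn p f := by
    refine cotangentForm_ext fun g => ?_
    refine (conormalForm_mk Ω (I.stalk p) _ g).trans ?_
    rw [eval_ofFn, pow_zero, one_mul]
    rfl
  map_wedge k l p x y := by
    obtain ⟨η, rfl⟩ := Submodule.Quotient.mk_surjective _ x
    obtain ⟨ζ, rfl⟩ := Submodule.Quotient.mk_surjective _ y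
    exact conormalForm_wedge (I.stalk p) η ζ
  map_d k p x := by
    obtain ⟨η, rfl⟩ := Submodule.Quotient.mk_surjective _ x
    refine cotangentForm_ext fun g => ?_
    exact conormalForm_d (hI p) η g

theorem deRhamToConormal_mk (I : IdealSheaf 𝕜 E M) (hI : I.IsInvolutive Ω) {k : ℕ} {p : M}
    (η : formGerm 𝕜 E k p) : (deRhamToConormal I hI).toFun k p (IdealSheaf.OmegaStalk.mk I η) =
      conormalForm Ω (I.stalk p) k η := rfl

theorem deRhamToConormal_d_ofFn (I : IdealSheaf 𝕜 E M) (hI : I.IsInvolutive Ω) (p : M)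
    (f : fnGerm 𝕜 E p) (g : I.stalk p) :
    (deRhamToConormal I hI).toFun 1 p (IdealSheaf.OmegaStalk.mk I (formGerm.ofFn f).d)
        (fun _ => (I.stalk p).toCotangent g) =
      IdealSheaf.OStalk.mk I ((poisson Ω p).toFun f g) := by
  rw [deRhamToConormal_mk]
  refine (conormalForm_mk Ω (I.stalk p) _ fun _ => g).trans ?_
  rw [eval_d_ofFn, pow_one, neg_one_mul, ← SkewBiderivation.swap]

end Morphism
end LagrangianDeRham

namespace LagrangianDeRham

/-! ### Sums over shuffles -/

section Shuffles

/-- The bijection `Fin (k + 1) ≃ Fin k ⊕ Fin 1` that sends `0` to the element of `Fin 1`. -/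
def finSuccEquivSum (k : ℕ) : Fin (k + 1) ≃ Fin k ⊕ Fin 1 where
  toFun := Fin.cases (Sum.inr 0) Sum.inl
  invFun := Sum.elim Fin.succ fun _ => 0
  left_inv i := by refine Fin.cases ?_ (fun i => ?_) i <;> rfl
  right_inv i := by
    rcases i with i | i
    · rfl
    · rw [Subsingleton.elim i 0]; rfl

/-- The factor in the formula `∑_a (ι_{e_a} φ) ∧ e^a = c φ` for forms `φ` of degree `k + 1`. -/
noncomputable def shuffleFactor (k : ℕ) : ℤ :=
  Fintype.card (Equiv.Perm.ModSumCongr (Fin k) (Fin 1)) *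
    (Equiv.Perm.sign ((finSuccEquivSum k).trans finSumFinEquiv) : ℤ)

theorem shuffleFactor_ne_zero (k : ℕ) : shuffleFactor k ≠ 0 :=
  mul_ne_zero (Nat.cast_ne_zero.2 (Fintype.card_ne_zero)) (Units.ne_zero _)

/-- Moving the last slot to the front and undoing σ permutes the arguments with sign equal to sign σ
times a constant. So sign σ cancels and every shuffle contributes the same amount. -/
theorem sum_shuffle_cons {X A : Type*} [CommRing A] {k : ℕ} (F : (Fin (k + 1) → X) → A)
    (hF : ∀ (v : Fin (k + 1) → X) (π : Equiv.Perm (Fin (k + 1))),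
      F (v ∘ π) = ((Equiv.Perm.sign π : ℤ) : A) * F v) (v : Fin (k + 1) → X) :
    ∑ σ : Equiv.Perm.ModSumCongr (Fin k) (Fin 1), ((Equiv.Perm.sign σ.out : ℤ) : A) *
      F (Fin.cons (v (finSumFinEquiv (σ.out (Sum.inr 0))))
        fun i => v (finSumFinEquiv (σ.out (Sum.inl i)))) = (shuffleFactor k : A) * F v := by
  have h : ∀ σ : Equiv.Perm (Fin k ⊕ Fin 1), ((Equiv.Perm.sign σ : ℤ) : A) *
      F (Fin.cons (v (finSumFinEquiv (σ (Sum.inr 0))))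
        fun i => v (finSumFinEquiv (σ (Sum.inl i)))) =
      ((Equiv.Perm.sign ((finSuccEquivSum k).trans finSumFinEquiv) : ℤ) : A) * F v := by
    intro σ
    have h1 : (Fin.cons (v (finSumFinEquiv (σ (Sum.inr 0))))
        fun i => v (finSumFinEquiv (σ (Sum.inl i))) : Fin (k + 1) → X) =
        v ∘ (((finSumFinEquiv.symm.trans σ).trans finSumFinEquiv : Equiv.Perm (Fin (k + 1))) *
          ((finSuccEquivSum k).trans finSumFinEquiv : Equiv.Perm (Fin (k + 1))) :
            Equiv.Perm (Fin (k + 1))) := by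
      ext i
      refine Fin.cases ?_ (fun i => ?_) i
      · simp [finSuccEquivSum]
      · simp [finSuccEquivSum]
    rw [h1, hF, Equiv.Perm.sign_mul, Equiv.Perm.sign_symm_trans_trans, Units.val_mul,
      Int.cast_mul, ← mul_assoc, ← mul_assoc]
    rcases Int.units_eq_one_or (Equiv.Perm.sign σ) with h | h <;> simp [h]
  rw [Finset.sum_congr rfl fun σ _ => h σ.out, Finset.sum_const, Finset.card_univ, nsmul_eq_mul,
    shuffleFactor]
  push_cast
  ring

/-- Reordering the arguments by σ costs sign σ, which cancels. The number of shuffles is left as a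
cardinality because only its being nonzero matters. -/
theorem altWedge_constOfIsEmpty {A N : Type*} [CommRing A] [AddCommGroup N] [Module A N] {k : ℕ}
    (Φ : N [⋀^Fin k]→ₗ[A] A) (c : A) (v : Fin k → N) :
    altWedge Φ (AlternatingMap.constOfIsEmpty A N (Fin 0) c) v =
      Fintype.card (Equiv.Perm.ModSumCongr (Fin k) (Fin 0)) * (c * Φ v) := by
  have h : ∀ σ : Equiv.Perm (Fin k ⊕ Fin 0), ((Equiv.Perm.sign σ : ℤ) : A) *
      (Φ (fun i => v (finSumFinEquiv (σ (Sum.inl i)))) * c) = c * Φ v := by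
    intro σ
    have h1 : (fun i => v (finSumFinEquiv (σ (Sum.inl i)))) =
        v ∘ ((finSumFinEquiv.symm.trans σ).trans finSumFinEquiv : Equiv.Perm (Fin (k + 0))) := by
      ext i
      have : finSumFinEquiv.symm (Fin.castAdd 0 i) = Sum.inl i :=
        finSumFinEquiv_symm_apply_castAdd i
      have h2 : (finSumFinEquiv.symm : Fin (k + 0) ≃ _) i = Sum.inl i := this
      simp only [Function.comp_apply, Equiv.trans_apply, h2]
    rw [h1]
    have h2 := Φ.map_perm v
      ((finSumFinEquiv.symm.trans σ).trans finSumFinEquiv : Equiv.Perm (Fin (k + 0)))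
    refine (congrArg (fun t => _ * (t * c)) h2).trans ?_
    have h3 := Equiv.Perm.sign_symm_trans_trans σ (finSumFinEquiv : _ ≃ Fin (k + 0))
    refine (congrArg (fun s : ℤˣ => ((Equiv.Perm.sign σ : ℤ) : A) * ((s • Φ v) * c)) h3).trans ?_
    rcases Int.units_eq_one_or (Equiv.Perm.sign σ) with h | h <;> simp [h, mul_comm]
  rw [altWedge_apply]
  refine (Finset.sum_congr rfl fun σ _ => h σ.out).trans ?_
  rw [Finset.sum_const, Finset.card_univ, nsmul_eq_mul]

theorem alternating_sum_apply {A N ι : Type*} [CommRing A] [AddCommGroup N] [Module A N]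
    (s : Finset ι) {k : ℕ} (φ : ι → N [⋀^Fin k]→ₗ[A] A) (v : Fin k → N) :
    (∑ i ∈ s, φ i) v = ∑ i ∈ s, φ i v :=
  map_sum (AddMonoidHom.mk' (fun φ : N [⋀^Fin k]→ₗ[A] A => φ v) fun _ _ => rfl) φ s

/-- Induction on the degree, expanding the first argument in the generators; they need not be
independent. -/
theorem alternating_ext_of_span {A N ι : Type*} [CommRing A] [AddCommGroup N] [Module A N]
    [Fintype ι] {e : ι → N} (he : ∀ x, ∃ r : ι → A, x = ∑ i, r i • e i) {k : ℕ}
    {φ ψ : N [⋀^Fin k]→ₗ[A] A} (h : ∀ a : Fin k → ι, φ (fun i => e (a i)) = ψ fun i => e (a i)) :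
    φ = ψ := by
  induction k with
  | zero =>
    ext v
    rw [Subsingleton.elim v fun i => e (Fin.elim0 i)]
    exact h fun i => i.elim0
  | succ k ih =>
    have h1 : ∀ i, φ.curryLeft (e i) = ψ.curryLeft (e i) := by
      intro i
      refine ih fun a => ?_
      have e1 : (Matrix.vecCons (e i) fun j => e (a j)) =
          fun j => e ((Fin.cons i a : Fin (k + 1) → ι) j) := by
        ext j
        refine Fin.cases ?_ (fun j => ?_) j <;> rfl
      rw [AlternatingMap.curryLeft_apply_apply, AlternatingMap.curryLeft_apply_apply, e1]
      exact h _
    ext v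
    obtain ⟨r, hr⟩ := he (v 0)
    have h2 : φ.curryLeft (v 0) = ψ.curryLeft (v 0) := by
      rw [hr]
      simp only [map_sum, map_smul, h1]
    have h3 := congrArg (fun f => f (Fin.tail v)) h2
    simp only [AlternatingMap.curryLeft_apply_apply] at h3
    have e1 : Matrix.vecCons (v 0) (Fin.tail v) = v := Fin.cons_self_tail v
    rwa [e1] at h3

end Shuffles

/-! ### Bijectivity on stalks in the presence of a frame -/

section Isomorphism

open Filter TopologicalSpace
open scoped Topology Manifold ContDiff

variable {𝕜 : Type*} [NontriviallyNormedField 𝕜] [IsRCLikeNormedField 𝕜]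
variable {E : Type*} [NormedAddCommGroup E] [NormedSpace 𝕜 E] [FiniteDimensional 𝕜 E]
variable {M : Type*} [TopologicalSpace M] [ChartedSpace E M] [IsManifold 𝓘(𝕜, E) ∞ M]
variable {p : M} {Ω : SymplecticForm 𝕜 E M}

theorem isUnit_shuffleFactor (k : ℕ) : IsUnit (shuffleFactor k : fnGerm 𝕜 E p) := by
  refine fnGerm.isUnit_of_value_ne_zero ?_
  let _ := IsRCLikeNormedField.rclike 𝕜
  rw [map_intCast]
  exact_mod_cast shuffleFactor_ne_zero k

/-- Evaluation is not linear over germs in the functions, but it is additive and alternating, hence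
an alternating map over ℤ; this suffices for the sign rule. -/
theorem eval_perm {k : ℕ} (η : formGerm 𝕜 E k p) (g : Fin k → fnGerm 𝕜 E p)
    (π : Equiv.Perm (Fin k)) :
    eval Ω η (g ∘ π) = ((Equiv.Perm.sign π : ℤ) : fnGerm 𝕜 E p) * eval Ω η g := by
  let F : fnGerm 𝕜 E p [⋀^Fin k]→ₗ[ℤ] fnGerm 𝕜 E p :=
    { toFun := eval Ω η
      map_update_add' := fun {inst} g i x y => by
        rw [Subsingleton.elim inst (instDecidableEqFin _), eval_update_add]
      map_update_smul' := fun {inst} g i c x => by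
        obtain rfl : inst = instDecidableEqFin _ := Subsingleton.elim _ _
        exact map_zsmul (AddMonoidHom.mk' (fun x => eval Ω η (Function.update g i x))
          (eval_update_add η g i)) c x
      map_eq_zero_of_eq' := fun g i j h hij => eval_eq_zero_of_eq η g h hij }
  have h := F.map_perm g π
  rw [Units.smul_def, zsmul_eq_mul] at h
  exact h

/-- If `e` is dual to the hamiltonian vector fields of `u`, then `∑_a (ι_{H_{u_a}} η) ∧ e_a` is a
multiple of `η`. -/
theorem sum_wedge_contraction {ι : Type*} [Fintype ι] [DecidableEq ι]
    (hι : Fintype.card ι = Module.finrank 𝕜 E) {u : ι → fnGerm 𝕜 E p}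
    (hu : IsUnit (Matrix.of fun a b => (poisson Ω p).toFun (u a) (u b)).det)
    {e : ι → formGerm 𝕜 E 1 p}
    (he : ∀ a c, eval Ω (e a) (fun _ => u c) = if c = a then 1 else 0) {k : ℕ}
    {η : formGerm 𝕜 E (k + 1) p} {ζ : ι → formGerm 𝕜 E k p}
    (hζ : ∀ a g, eval Ω (ζ a) g = eval Ω η (Fin.cons (u a) g)) :
    ∑ a, formGerm.wedge (ζ a) (e a) = (shuffleFactor k : fnGerm 𝕜 E p) • η := by
  refine eval_injective hι hu fun c => ?_
  rw [eval_sum, eval_smul, ← sum_shuffle_cons (eval Ω η) (eval_perm η)]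
  simp only [eval_wedge]
  rw [Finset.sum_comm]
  refine Finset.sum_congr rfl fun σ _ => ?_
  rw [← Finset.mul_sum]
  congr 1
  -- By duality only the index a that occupies the last slot of the shuffle survives, and the
  -- contraction puts u_a back as first entry of η.
  have h1 : ∀ a, eval Ω (e a) (fun i => u (c (finSumFinEquiv (σ.out (Sum.inr i))))) =
      if c (finSumFinEquiv (σ.out (Sum.inr 0))) = a then 1 else 0 := by
    intro a
    rw [← he]
    congr 1
    ext i
    rw [Subsingleton.elim i 0]
  simp only [hζ, h1, mul_ite, mul_one, mul_zero, Finset.sum_ite_eq, Finset.mem_univ, if_true]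

theorem deRhamIdealMem_of_smul {I : Ideal (fnGerm 𝕜 E p)} {c : fnGerm 𝕜 E p} (hc : IsUnit c)
    {k : ℕ} {η : formGerm 𝕜 E k p} (h : DeRhamIdealMem I k (c • η)) : DeRhamIdealMem I k η := by
  obtain ⟨c', hc'⟩ := hc.exists_left_inv
  have := DeRhamIdealMem.smul c' _ h
  rwa [smul_smul, hc', one_smul] at this

theorem wedge_ofFn {k : ℕ} (η : formGerm 𝕜 E k p) (a : fnGerm 𝕜 E p) :
    formGerm.wedge η (formGerm.ofFn a) =
      (Fintype.card (Equiv.Perm.ModSumCongr (Fin k) (Fin 0)) : fnGerm 𝕜 E p) • a • η := by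
  obtain ⟨η', hη⟩ := η.exists_isRep
  obtain ⟨f, hf⟩ := a.exists_isRep
  have hN := fnGerm.isRep_intCast (𝕜 := 𝕜) (E := E) (p := p)
    (Fintype.card (Equiv.Perm.ModSumCongr (Fin k) (Fin 0)))
  rw [Int.cast_natCast] at hN
  refine (hη.wedge hf.ofFn).ext (formGerm.IsRep.smul hN (formGerm.IsRep.smul hf hη))
    (Eventually.of_forall fun x => ?_)
  ext v
  have h := altWedge_constOfIsEmpty (η' x).toAlternatingMap (f x) v
  refine h.trans ?_
  simp

/-- The ideal is generated from I in degree 0. Up to an integer factor, which is a unit, a • η is η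
∧ a, so I Ω^k is contained in it. -/
theorem deRhamIdealMem_smul {I : Ideal (fnGerm 𝕜 E p)} {a : fnGerm 𝕜 E p} (ha : a ∈ I) {k : ℕ}
    (η : formGerm 𝕜 E k p) : DeRhamIdealMem I k (a • η) := by
  refine deRhamIdealMem_of_smul (fnGerm.isUnit_natCast
    (Fintype.card_ne_zero (α := Equiv.Perm.ModSumCongr (Fin k) (Fin 0)))) ?_
  rw [← wedge_ofFn]
  exact DeRhamIdealMem.wedge_right _ _ (DeRhamIdealMem.ofFn a ha)

/-- A coframe dual to the hamiltonian vector fields of the `f_i` and `y_j`, of which the second half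
vanishes on `L`. -/
theorem exists_coframe {I : Ideal (fnGerm 𝕜 E p)}
    (hI : ∀ f ∈ I, ∀ g ∈ I, (poisson Ω p).toFun f g ∈ I) {n : ℕ} {f y : Fin n → fnGerm 𝕜 E p}
    (hf : ∀ i, f i ∈ I)
    (hA : IsUnit (Matrix.of fun i j => (poisson Ω p).toFun (f i) (y j)).det)
    (hP : IsUnit (Matrix.of fun a b =>
      (poisson Ω p).toFun (Sum.elim f y a) (Sum.elim f y b)).det) :
    ∃ e : Fin n ⊕ Fin n → formGerm 𝕜 E 1 p,
      (∀ a c, eval Ω (e a) (fun _ => Sum.elim f y c) = if c = a then 1 else 0) ∧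
      ∀ j, DeRhamIdealMem I 1 (e (Sum.inr j)) := by
  set A := Matrix.of fun i j => (poisson Ω p).toFun (f i) (y j) with hAdef
  set P := Matrix.of fun a b => (poisson Ω p).toFun (Sum.elim f y a) (Sum.elim f y b) with hPdef
  have hPP : P * P⁻¹ = 1 := Matrix.mul_nonsing_inv P hP
  -- Since du_b(H_{u_c}) = P c b, multiplying the du_b by P⁻¹ gives the dual coframe.
  refine ⟨fun a => ∑ b, P⁻¹ b a • (formGerm.ofFn (Sum.elim f y b)).d, fun a c => ?_, fun j => ?_⟩
  · have h := congrFun (congrFun hPP c) a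
    rw [Matrix.mul_apply, Matrix.one_apply] at h
    rw [eval_sum, ← h]
    refine Finset.sum_congr rfl fun b _ => ?_
    rw [eval_smul, eval_d_ofFn, mul_comm]
    rfl
  -- In row `inl c` and column `inr j` of P P⁻¹ = 1 the brackets {f_c, f_i} are in I. Hence the
  -- entries of A w are in I, and so are those of w because A is invertible.
  · have hw : ∀ l, P⁻¹ (Sum.inr l) (Sum.inr j) ∈ I := by
      set w : Fin n → fnGerm 𝕜 E p := fun l => P⁻¹ (Sum.inr l) (Sum.inr j) with hwdef
      have h1 : ∀ c, A.mulVec w c ∈ I := by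
        intro c
        have h := congrFun (congrFun hPP (Sum.inl c)) (Sum.inr j)
        rw [Matrix.mul_apply, Matrix.one_apply_ne (by simp), Fintype.sum_sum_type] at h
        have h2 : A.mulVec w c = ∑ l, P (Sum.inl c) (Sum.inr l) * P⁻¹ (Sum.inr l) (Sum.inr j) := rfl
        rw [h2, eq_neg_of_add_eq_zero_right h]
        exact neg_mem (sum_mem fun i _ => I.mul_mem_right _ (hI _ (hf c) _ (hf i)))
      have h2 : w = A⁻¹.mulVec (A.mulVec w) := by
        rw [Matrix.mulVec_mulVec, Matrix.nonsing_inv_mul A hA, Matrix.one_mulVec]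
      intro l
      show w l ∈ I
      have h3 : A⁻¹.mulVec (A.mulVec w) l = ∑ i, A⁻¹ l i * A.mulVec w i := rfl
      rw [h2, h3]
      exact Submodule.sum_mem I fun i _ => I.mul_mem_left _ (h1 i)
    -- The summands are multiples of df_i with f_i in I, and multiples of dy_l with coefficient in
    -- I.
    refine (deRhamIdeal I 1).sum_mem fun b _ => ?_
    rcases b with i | l
    · exact DeRhamIdealMem.smul _ _ (DeRhamIdealMem.d _ (DeRhamIdealMem.ofFn _ (hf i)))
    · exact deRhamIdealMem_smul (hw l) _

/-- Induction on the degree through `sum_wedge_contraction`. Contraction with H_{f_i} preserves the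
hypothesis because f_i is in I; the summands for the y_j are in the ideal because their factor e_j
is. -/
theorem deRhamIdealMem_of_eval_mem {I : Ideal (fnGerm 𝕜 E p)}
    {n : ℕ} {f y : Fin n → fnGerm 𝕜 E p} (hf : ∀ i, f i ∈ I)
    (hn : Fintype.card (Fin n ⊕ Fin n) = Module.finrank 𝕜 E)
    (hP : IsUnit (Matrix.of fun a b =>
      (poisson Ω p).toFun (Sum.elim f y a) (Sum.elim f y b)).det)
    {e : Fin n ⊕ Fin n → formGerm 𝕜 E 1 p}
    (he : ∀ a c, eval Ω (e a) (fun _ => Sum.elim f y c) = if c = a then 1 else 0)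
    (he' : ∀ j, DeRhamIdealMem I 1 (e (Sum.inr j))) {k : ℕ} (η : formGerm 𝕜 E k p)
    (h : ∀ g : Fin k → fnGerm 𝕜 E p, (∀ i, g i ∈ I) → eval Ω η g ∈ I) :
    DeRhamIdealMem I k η := by
  induction k with
  | zero =>
    obtain ⟨a, rfl⟩ := η.exists_eq_ofFn
    have := h Fin.elim0 fun i => i.elim0
    rw [eval_ofFn] at this
    exact DeRhamIdealMem.ofFn a this
  | succ k ih =>
    choose ζ hζ using fun a => exists_contraction (Ω := Ω) η (Sum.elim f y a)
    have h1 := sum_wedge_contraction hn hP he hζ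
    refine deRhamIdealMem_of_smul (isUnit_shuffleFactor k) ?_
    rw [← h1]
    refine (deRhamIdeal I (k + 1)).sum_mem fun a _ => ?_
    rcases a with i | j
    · refine DeRhamIdealMem.wedge_left _ _ (ih _ fun g hg => ?_)
      rw [hζ]
      refine h _ fun l => ?_
      refine Fin.cases ?_ (fun l => ?_) l
      · exact hf i
      · exact hg l
    · exact DeRhamIdealMem.wedge_right _ _ (he' j)

theorem exists_sum_toCotangent {R : Type*} [CommRing R] {I : Ideal R} {n : ℕ} {f : Fin n → R}
    (hf : ∀ i, f i ∈ I) (hspan : I = Ideal.span (Set.range f)) (x : I.Cotangent) :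
    ∃ r : Fin n → R ⧸ I, x = ∑ i, r i • I.toCotangent ⟨f i, hf i⟩ := by
  obtain ⟨⟨g, hg⟩, rfl⟩ := I.toCotangent_surjective x
  have hg' := hg
  rw [hspan, Ideal.mem_span_range_iff_exists_fun] at hg'
  obtain ⟨c, hc⟩ := hg'
  refine ⟨fun i => Ideal.Quotient.mk I (c i), ?_⟩
  simp only [SkewBiderivation.mk_smul_toCotangent, ← map_sum]
  congr 1
  ext
  simp [hc]

/-- The f_i generate the conormal module, and up to sign the images of the first half of the coframe
are dual to them. By induction the contractions of φ with the f_i have lifts; wedging these with the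
coframe gives an integer multiple of φ. -/
theorem conormalForm_surjective {I : Ideal (fnGerm 𝕜 E p)}
    {n : ℕ} {f y : Fin n → fnGerm 𝕜 E p} (hf : ∀ i, f i ∈ I)
    (hspan : I = Ideal.span (Set.range f))
    {e : Fin n ⊕ Fin n → formGerm 𝕜 E 1 p}
    (he : ∀ a c, eval Ω (e a) (fun _ => Sum.elim f y c) = if c = a then 1 else 0) (k : ℕ) :
    Function.Surjective (conormalForm Ω I k) := by
  induction k with
  | zero =>
    intro φ
    obtain ⟨a, ha⟩ := Ideal.Quotient.mk_surjective (φ Fin.elim0)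
    refine ⟨formGerm.ofFn a, cotangentForm_ext fun g => ?_⟩
    rw [conormalForm_mk, eval_ofFn, pow_zero, one_mul, ha]
    congr 1
    exact Subsingleton.elim _ _
  | succ k ih =>
    intro φ
    choose ζ hζ using fun i => ih (φ.curryLeft (I.toCotangent ⟨f i, hf i⟩))
    obtain ⟨c, hc⟩ := (isUnit_shuffleFactor (𝕜 := 𝕜) (E := E) (p := p) k).exists_left_inv
    set ψ : Fin n → I.Cotangent →ₗ[fnGerm 𝕜 E p ⧸ I] (fnGerm 𝕜 E p ⧸ I) := fun i =>
      (AlternatingMap.ofSubsingleton _ _ _ (0 : Fin 1)).symm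
        (conormalForm Ω I 1 (e (Sum.inl i))) with hψdef
    have hψ : ∀ i x, ψ i x = conormalForm Ω I 1 (e (Sum.inl i)) fun _ => x := fun i x => rfl
    -- The value -1 is the sign (-1)^k of `conormalForm` in degree 1.
    have hψf : ∀ i j, ψ i (I.toCotangent ⟨f j, hf j⟩) = if j = i then -1 else 0 := by
      intro i j
      rw [hψ]
      refine (conormalForm_mk Ω I _ fun _ => ⟨f j, hf j⟩).trans ?_
      have := he (Sum.inl i) (Sum.inl j)
      simp only [Sum.elim_inl, Sum.inl.injEq] at this
      rw [this]
      split_ifs <;> simp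
    have hdual : ∀ x, ∑ i, ψ i x • I.toCotangent ⟨f i, hf i⟩ = -x := by
      intro x
      obtain ⟨r, rfl⟩ := exists_sum_toCotangent hf hspan x
      simp only [map_sum, map_smul, hψf, smul_eq_mul, mul_ite, mul_neg, mul_one, mul_zero,
        Finset.sum_ite_eq', Finset.mem_univ, if_true, neg_smul, Finset.sum_neg_distrib]
    -- The minus sign makes up for that of `hψf`, and c is the inverse of the integer factor.
    refine ⟨-(c • ∑ i, formGerm.wedge (ζ i) (e (Sum.inl i))), ?_⟩
    have h1 : conormalForm Ω I (k + 1) (∑ i, formGerm.wedge (ζ i) (e (Sum.inl i))) =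
        -((shuffleFactor k : fnGerm 𝕜 E p) • φ) := by
      rw [map_sum]
      simp only [conormalForm_wedge, hζ]
      ext v
      rw [AlternatingMap.neg_apply, AlternatingMap.smul_apply, alternating_sum_apply]
      simp only [altWedge_apply]
      rw [Finset.sum_comm]
      have h2 := sum_shuffle_cons φ (fun v π => by
        rw [φ.map_perm, Units.smul_def, zsmul_eq_mul]) v
      have h3 : (shuffleFactor k : fnGerm 𝕜 E p) • φ v =
          (shuffleFactor k : fnGerm 𝕜 E p ⧸ I) * φ v := by
        rw [← map_intCast (Ideal.Quotient.mk I)]; rfl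
      rw [h3, ← h2, ← Finset.sum_neg_distrib]
      refine Finset.sum_congr rfl fun σ _ => ?_
      rw [← Finset.mul_sum, ← mul_neg]
      congr 1
      set x := v (finSumFinEquiv (σ.out (Sum.inr 0))) with hx
      set w : Fin k → I.Cotangent := fun i => v (finSumFinEquiv (σ.out (Sum.inl i)))
      have h4 : ∀ i, (conormalForm Ω I 1 (e (Sum.inl i)) fun j =>
          v (finSumFinEquiv (σ.out (Sum.inr j)))) = ψ i x := by
        intro i
        rw [hψ]
        congr 1
        ext j
        rw [Subsingleton.elim j 0]
      -- Linearity of φ in its first argument collects the sum over i into the expansion `hdual` of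
      -- -x.
      have h5 : φ.curryLeft (-x) w = -φ (Fin.cons x w) := by
        rw [map_neg]; rfl
      rw [← h5, ← hdual x, map_sum, alternating_sum_apply]
      refine Finset.sum_congr rfl fun i _ => ?_
      rw [h4, map_smul, AlternatingMap.smul_apply, smul_eq_mul, mul_comm]
    rw [map_neg, map_smul, h1, smul_neg, neg_neg, smul_smul, hc, one_smul]

end Isomorphism
end LagrangianDeRham

namespace LagrangianDeRham

/-! ### Frames at smooth points and the passage to sections -/

section SmoothPoints

open Filter TopologicalSpace
open scoped Topology Manifold ContDiff

variable {𝕜 : Type*} [NontriviallyNormedField 𝕜] [IsRCLikeNormedField 𝕜]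
variable {E : Type*} [NormedAddCommGroup E] [NormedSpace 𝕜 E] [FiniteDimensional 𝕜 E]
variable {M : Type*} [TopologicalSpace M] [ChartedSpace E M] [IsManifold 𝓘(𝕜, E) ∞ M]
variable {p : M} {Ω : SymplecticForm 𝕜 E M}

theorem exists_dual_functionals {c : ℕ} {v : Fin c → E} (hv : LinearIndependent 𝕜 v) :
    ∃ l : Fin c → E →L[𝕜] 𝕜, ∀ i j, l j (v i) = if i = j then 1 else 0 := by
  have : CompleteSpace 𝕜 := by
    let _ := IsRCLikeNormedField.rclike 𝕜
    infer_instance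
  obtain ⟨g, hg⟩ := LinearMap.exists_leftInverse_of_injective (Fintype.linearCombination 𝕜 v)
    (LinearMap.ker_eq_bot.2 hv.fintypeLinearCombination_injective)
  refine ⟨fun j => LinearMap.toContinuousLinearMap (LinearMap.proj j ∘ₗ g), fun i j => ?_⟩
  have h := congrArg (fun L : (Fin c → 𝕜) →ₗ[𝕜] (Fin c → 𝕜) => L (Pi.single i 1) j) hg
  simp only [LinearMap.comp_apply, Fintype.linearCombination_apply_single, one_smul,
    LinearMap.id_apply, Pi.single_apply] at h
  rw [LinearMap.coe_toContinuousLinearMap', LinearMap.comp_apply, LinearMap.proj_apply, h]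
  exact if_congr eq_comm rfl rfl

theorem smoothFnAt_chart (p : M) (l : E →L[𝕜] 𝕜) :
    SmoothFnAt E (fun x => l (extChartAt 𝓘(𝕜, E) p x)) p := by
  filter_upwards [extChartAt_source_mem_nhds (I := 𝓘(𝕜, E)) p] with q hq
  have h1 : ContMDiffAt 𝓘(𝕜, E) 𝓘(𝕜, E) ∞ (extChartAt 𝓘(𝕜, E) p) q :=
    contMDiffAt_extChartAt' (by rwa [extChartAt_source] at hq)
  exact l.contMDiff.contMDiffAt.comp q h1

/-- Linear functionals composed with the chart at p supply functions with any prescribed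
differential at p; the y_j are of this kind. -/
theorem fnDeriv_chart (p : M) (l : E →L[𝕜] 𝕜) :
    fnDeriv E (fun x => l (extChartAt 𝓘(𝕜, E) p x)) p = l := by
  rw [fnDeriv_eq (smoothFnAt_chart p l).self_of_nhds]
  have h : (fun x => l (extChartAt 𝓘(𝕜, E) p x)) ∘ (extChartAt 𝓘(𝕜, E) p).symm
      =ᶠ[𝓝 (extChartAt 𝓘(𝕜, E) p p)] l := by
    filter_upwards [extChartAt_target_mem_nhds (I := 𝓘(𝕜, E)) p] with y hy
    simp only [Function.comp_apply, (extChartAt 𝓘(𝕜, E) p).right_inv hy]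
  rw [h.fderiv_eq, ContinuousLinearMap.fderiv]

theorem poissonFn_swap (f g : M → 𝕜) (x : M) :
    poissonFn Ω.toFun f g x = -poissonFn Ω.toFun g f x := by
  rw [poissonFn, poissonFn, ← flat_hamiltonian Ω g, ← flat_hamiltonian Ω f, flat_apply, flat_apply]
  have h := (Ω.toFun x).toAlternatingMap.map_swap
    ![hamiltonian Ω.toFun f x, hamiltonian Ω.toFun g x] (i := 0) (j := 1) (by simp)
  have e : ![hamiltonian Ω.toFun f x, hamiltonian Ω.toFun g x] ∘ Equiv.swap (0 : Fin 2) 1 =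
      ![hamiltonian Ω.toFun g x, hamiltonian Ω.toFun f x] := by
    ext i; fin_cases i <;> simp
  rw [e] at h
  exact h

/-- With D the lower right block, [[0, 1], [-1, D]] has the right inverse [[D, -1], [1, 0]]. Nothing
is asked of D, so the brackets {y_i, y_j} are arbitrary. -/
theorem det_ne_zero_of_blocks {c : ℕ} {P : Matrix (Fin c ⊕ Fin c) (Fin c ⊕ Fin c) 𝕜}
    (h₁₁ : P.toBlocks₁₁ = 0) (h₁₂ : P.toBlocks₁₂ = 1) (h₂₁ : P.toBlocks₂₁ = -1) : P.det ≠ 0 := by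
  have h : P * Matrix.fromBlocks P.toBlocks₂₂ (-1) 1 0 = 1 := by
    conv_lhs => rw [← Matrix.fromBlocks_toBlocks P, h₁₁, h₁₂, h₂₁]
    rw [Matrix.fromBlocks_multiply, ← Matrix.fromBlocks_one]
    simp
  have h2 := congrArg Matrix.det h
  rw [Matrix.det_mul, Matrix.det_one] at h2
  exact left_ne_zero_of_mul_eq_one h2

theorem eventually_det_ne_zero {ι : Type*} [Fintype ι] [DecidableEq ι] {U W : ι → M → 𝕜}
    (hU : ∀ a, SmoothFnAt E (U a) p) (hW : ∀ a, SmoothFnAt E (W a) p)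
    (h : (Matrix.of fun a b => poissonFn Ω.toFun (U a) (W b) p).det ≠ 0) :
    ∀ᶠ q in 𝓝 p, (Matrix.of fun a b => poissonFn Ω.toFun (U a) (W b) q).det ≠ 0 := by
  have hdet := fnGerm.IsRep.det
    (P := Matrix.of fun a b => (poisson Ω p).toFun (fnGerm.mk _ (hU a)) (fnGerm.mk _ (hW b)))
    fun a b => (fnGerm.isRep_mk _ (hU a)).poisson Ω (fnGerm.isRep_mk _ (hW b))
  exact hdet.smooth.self_of_nhds.continuousAt.eventually_ne h

theorem isUnit_det_poisson {ι : Type*} [Fintype ι] [DecidableEq ι] {u w : ι → fnGerm 𝕜 E p}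
    {U W : ι → M → 𝕜} (hU : ∀ a, (u a).IsRep (U a)) (hW : ∀ a, (w a).IsRep (W a))
    (h : (Matrix.of fun a b => poissonFn Ω.toFun (U a) (W b) p).det ≠ 0) :
    IsUnit (Matrix.of fun a b => (poisson Ω p).toFun (u a) (w b)).det := by
  have hdet := fnGerm.IsRep.det (P := Matrix.of fun a b => (poisson Ω p).toFun (u a) (w b))
    fun a b => (hU a).poisson Ω (hW b)
  exact fnGerm.isUnit_of_value_ne_zero (by rwa [hdet.value])

/-- At a smooth point of dimension at most `n`, the generators of the ideal are part of a frame. -/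
theorem IdealSheaf.IsSmoothPoint.exists_frame {I : IdealSheaf 𝕜 E M} (hI : I.IsInvolutive Ω)
    {n d : ℕ} (hn : Module.finrank 𝕜 E = 2 * n) (hd : d ≤ n) (hp : I.IsSmoothPoint p d) :
    ∃ f y : Fin n → M → 𝕜, ∀ᶠ q in 𝓝 p, ∃ hf : ∀ i, SmoothFnAt E (f i) q,
      ∃ hy : ∀ i, SmoothFnAt E (y i) q,
      I.stalk q = Ideal.span (Set.range fun i => fnGerm.mk (f i) (hf i)) ∧
      IsUnit (Matrix.of fun i j => (poisson Ω q).toFun (fnGerm.mk (f i) (hf i))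
        (fnGerm.mk (y j) (hy j))).det ∧
      IsUnit (Matrix.of fun a b => (poisson Ω q).toFun
        (Sum.elim (fun i => fnGerm.mk (f i) (hf i)) (fun i => fnGerm.mk (y i) (hy i)) a)
        (Sum.elim (fun i => fnGerm.mk (f i) (hf i)) (fun i => fnGerm.mk (y i) (hy i)) b)).det := by
  obtain ⟨htop, c, hc, f, hli, hgen⟩ := hp
  -- The linear map v ↦ i_v ω carries H_{f_i} to df_i, so a relation among the former is one among
  -- the latter.
  have hH : LinearIndependent 𝕜 fun i => hamiltonian Ω.toFun (f i) p := by
    rw [Fintype.linearIndependent_iff] at hli ⊢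
    intro r hr
    refine hli r ?_
    have := congrArg (flat (Ω.toFun p)) hr
    simpa only [map_sum, map_smul, flat_hamiltonian, map_zero] using this
  obtain ⟨l, hl⟩ := exists_dual_functionals hH
  set y : Fin c → M → 𝕜 := fun j x => l j (extChartAt 𝓘(𝕜, E) p x) with hydef
  have hy : ∀ j, SmoothFnAt E (y j) p := fun j => smoothFnAt_chart p (l j)
  obtain ⟨hf, hspan⟩ := hgen.self_of_nhds
  have hfI : ∀ i, fnGerm.mk (f i) (hf i) ∈ I.stalk p := fun i => by
    rw [hspan]; exact Ideal.subset_span ⟨i, rfl⟩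
  have hA : ∀ i j, poissonFn Ω.toFun (f i) (y j) p = if i = j then 1 else 0 := fun i j => by
    rw [poissonFn, hydef, fnDeriv_chart, hl]
  -- By involutivity {f_i, f_j} is in I, and as p is in L every germ in I vanishes at p.
  have hF : ∀ i j, poissonFn Ω.toFun (f i) (f j) p = 0 := fun i j => by
    rw [← ((fnGerm.isRep_mk _ (hf i)).poisson Ω (fnGerm.isRep_mk _ (hf j))).value]
    exact fnGerm.value_eq_zero_of_mem htop (hI p _ (hfI i) _ (hfI j))
  have hdetA : (Matrix.of fun i j => poissonFn Ω.toFun (f i) (y j) p).det ≠ 0 := by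
    have : (Matrix.of fun i j => poissonFn Ω.toFun (f i) (y j) p) = 1 := by
      ext i j; rw [Matrix.of_apply, hA, Matrix.one_apply]
    rw [this, Matrix.det_one]
    exact one_ne_zero
  have hdetP : (Matrix.of fun a b =>
      poissonFn Ω.toFun (Sum.elim f y a) (Sum.elim f y b) p).det ≠ 0 := by
    refine det_ne_zero_of_blocks ?_ ?_ ?_
    · ext i j; exact hF i j
    · ext i j; rw [Matrix.one_apply]; exact hA i j
    · ext i j
      rw [Matrix.neg_apply, Matrix.one_apply]
      refine (poissonFn_swap (y i) (f j) p).trans ?_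
      rw [hA]
      exact congrArg _ (if_congr eq_comm rfl rfl)
  -- The 2c hamiltonian vectors at p are independent, so 2c ≤ 2n; with c + d = 2n and d ≤ n this
  -- forces c = n.
  have hcn : c = n := by
    have h1 := (linearIndependent_hamiltonian hdetP).fintype_card_le_finrank
    rw [Fintype.card_sum, Fintype.card_fin] at h1
    omega
  subst hcn
  have hU : ∀ a, SmoothFnAt E (Sum.elim f y a) p := by
    rintro (i | i)
    · exact hf i
    · exact hy i
  have hy' : ∀ᶠ q in 𝓝 p, ∀ i, SmoothFnAt E (y i) q :=
    eventually_all.2 fun i => (hy i).eventually_nhds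
  refine ⟨f, y, ?_⟩
  -- A point q near p may lie outside L, and {f_i, f_j} need not vanish there, so the block form is
  -- lost. Nonvanishing of the two determinants is an open condition and is all that is kept.
  filter_upwards [hgen, hy', eventually_det_ne_zero hf hy hdetA,
    eventually_det_ne_zero hU hU hdetP] with q ⟨hfq, hsq⟩ hyq hAq hPq
  refine ⟨hfq, hyq, hsq, isUnit_det_poisson (fun i => fnGerm.isRep_mk _ (hfq i))
    (fun i => fnGerm.isRep_mk _ (hyq i)) hAq, isUnit_det_poisson ?_ ?_ hPq⟩ <;>
  · rintro (i | i)
    · exact fnGerm.isRep_mk _ (hfq i)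
    · exact fnGerm.isRep_mk _ (hyq i)

theorem deRhamToConormal_bijective {I : IdealSheaf 𝕜 E M} (hI : I.IsInvolutive Ω) {n : ℕ}
    (hn : Module.finrank 𝕜 E = 2 * n) {f y : Fin n → fnGerm 𝕜 E p}
    (hspan : I.stalk p = Ideal.span (Set.range f))
    (hA : IsUnit (Matrix.of fun i j => (poisson Ω p).toFun (f i) (y j)).det)
    (hP : IsUnit (Matrix.of fun a b =>
      (poisson Ω p).toFun (Sum.elim f y a) (Sum.elim f y b)).det) (k : ℕ) :
    Function.Bijective ((deRhamToConormal I hI).toFun k p) := by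
  have hf : ∀ i, f i ∈ I.stalk p := fun i => by rw [hspan]; exact Ideal.subset_span ⟨i, rfl⟩
  obtain ⟨e, he, he'⟩ := exists_coframe (hI p) hf hA hP
  have hcard : Fintype.card (Fin n ⊕ Fin n) = Module.finrank 𝕜 E := by
    rw [Fintype.card_sum, Fintype.card_fin, hn, two_mul]
  constructor
  · rw [injective_iff_map_eq_zero]
    intro x hx
    obtain ⟨η, rfl⟩ := Submodule.Quotient.mk_surjective _ x
    refine (Submodule.Quotient.mk_eq_zero _).2 ?_
    refine deRhamIdealMem_of_eval_mem hf hcard hP he he' η fun g hg => ?_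
    have h1 := conormalForm_mk Ω (I.stalk p) η fun i => ⟨g i, hg i⟩
    have h2 : conormalForm Ω (I.stalk p) k η = 0 := hx
    rw [h2, AlternatingMap.zero_apply] at h1
    have h3 := (I.stalk p).mul_mem_left ((-1) ^ k) (Ideal.Quotient.eq_zero_iff_mem.1 h1.symm)
    rwa [← mul_assoc, ← pow_add, ← two_mul, pow_mul, neg_one_sq, one_pow, one_mul] at h3
  · intro φ
    obtain ⟨η, hη⟩ := conormalForm_surjective hf hspan he k φ
    exact ⟨IdealSheaf.OmegaStalk.mk I η, hη⟩

/-- Only surjectivity needs more than the stalks. The stalkwise preimage of φ is induced at p by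
some form η, and J(η) must agree with φ near p as well. On a tuple of generators both are induced by
functions near p; their difference is in I at p, hence in I at nearby points by `IdealSheaf.isOpen`.
-/
theorem deRhamToConormal_bijOn {I : IdealSheaf 𝕜 E M} (hI : I.IsInvolutive Ω) {n : ℕ}
    {f : Fin n → M → 𝕜} {W : Opens M}
    (hgen : ∀ q ∈ W, ∃ hf : ∀ i, SmoothFnAt E (f i) q,
      I.stalk q = Ideal.span (Set.range fun i => fnGerm.mk (f i) (hf i))) {k : ℕ}
    (hbij : ∀ q ∈ W, Function.Bijective ((deRhamToConormal I hI).toFun k q)) :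
    Set.BijOn (fun (s : ∀ q : W, I.OmegaStalk k q.1) (q : W) =>
      (deRhamToConormal I hI).toFun k q.1 (s q)) (I.omegaSections W k) (I.cSections W k) := by
  refine ⟨fun s hs => (deRhamToConormal I hI).map_sections W k s hs, ?_, ?_⟩
  · intro s _ t _ hst
    ext q
    exact (hbij q.1 q.2).1 (congrFun hst q)
  · intro φ hφ
    choose s hs using fun q : W => (hbij q.1 q.2).2 (φ q)
    refine ⟨s, fun p => ?_, funext hs⟩
    have hsm : ∀ i (q : W), SmoothFnAt E (f i) q.1 := fun i q => (hgen q.1 q.2).choose i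
    have hspan : ∀ q : W, I.stalk q.1 =
        Ideal.span (Set.range fun i => fnGerm.mk (f i) (hsm i q)) :=
      fun q => (hgen q.1 q.2).choose_spec
    have hmem : ∀ i (q : W), fnGerm.mk (f i) (hsm i q) ∈ I.stalk q.1 := fun i q => by
      rw [hspan]; exact Ideal.subset_span ⟨i, rfl⟩
    obtain ⟨a, ha⟩ := Submodule.Quotient.mk_surjective _ (s p)
    obtain ⟨η, hη, rfl⟩ := a.exists_rep
    refine ⟨η, ?_⟩
    have hval : ∀ (q : W) (hq : SmoothFormAt η q.1) (a : Fin k → Fin n),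
        ∃ hG : SmoothFnAt E (fun x => (-1) ^ k * η x fun i =>
          hamiltonian Ω.toFun (f (a i)) x) q.1,
        (deRhamToConormal I hI).toFun k q.1 (IdealSheaf.OmegaStalk.mk I (formGerm.mk η hq))
          (fun i => (I.stalk q.1).toCotangent ⟨_, hmem (a i) q⟩) =
            IdealSheaf.OStalk.mk I (fnGerm.mk _ hG) := by
      intro q hq a
      have hrep := (fnGerm.isRep_neg_one_pow (𝕜 := 𝕜) (E := E) (p := q.1) k).mul
        ((formGerm.isRep_mk η hq).eval (Ω := Ω) fun i => fnGerm.isRep_mk (f (a i)) (hsm (a i) q))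
      refine ⟨hrep.smooth, ?_⟩
      rw [← hrep.eq_mk]
      exact conormalForm_mk Ω (I.stalk q.1) _ fun i => ⟨_, hmem (a i) q⟩
    have hloc : ∀ a : Fin k → Fin n, ∀ᶠ q : W in 𝓝 p, ∀ hq : SmoothFormAt η q.1,
        φ q (fun i => (I.stalk q.1).toCotangent ⟨_, hmem (a i) q⟩) =
          (deRhamToConormal I hI).toFun k q.1 (IdealSheaf.OmegaStalk.mk I (formGerm.mk η hq))
            (fun i => (I.stalk q.1).toCotangent ⟨_, hmem (a i) q⟩) := by
      intro a
      obtain ⟨F, hF⟩ := hφ W le_rfl (fun i => f (a i)) (fun i => hsm (a i)) (fun i => hmem (a i)) p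
      obtain ⟨hFp, hFp'⟩ := hF.self_of_nhds
      obtain ⟨hGp, hGp'⟩ := hval p hη a
      have hsub := (fnGerm.isRep_mk F hFp).sub (fnGerm.isRep_mk _ hGp)
      -- F induces the values of φ and the explicit function those of J(η); at p these are the same
      -- class in O_L.
      have hdiff : fnGerm.mk _ hsub.smooth ∈ I.stalk p.1 := by
        rw [← hsub.eq_mk, ← Ideal.Quotient.eq]
        refine hFp'.symm.trans (Eq.trans ?_ hGp')
        show φ p _ = _
        rw [← hs p, ← ha]
      filter_upwards [hF, continuous_subtype_val.continuousAt.eventually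
        (I.isOpen p.1 _ hsub.smooth hdiff)] with q ⟨hFq, hFq'⟩ ⟨hq1, hq2⟩ hq
      obtain ⟨hGq, hGq'⟩ := hval q hq a
      rw [hGq']
      refine hFq'.trans (Ideal.Quotient.eq.2 ?_)
      rwa [((fnGerm.isRep_mk F hFq).sub (fnGerm.isRep_mk _ hGq)).eq_mk]
    -- There are finitely many tuples of generators, so one neighbourhood serves for all of them.
    filter_upwards [eventually_all.2 hloc,
      continuous_subtype_val.continuousAt.eventually hη.eventually_nhds] with q h1 h2
    refine ⟨h2, (hbij q.1 q.2).1 ?_⟩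
    rw [hs q]
    exact alternating_ext_of_span (exists_sum_toCotangent (fun i => hmem i q) (hspan q))
      fun a => h1 a h2

end SmoothPoints
end LagrangianDeRham

open scoped Manifold ContDiff in
open LagrangianDeRham in
theorem mainTheorem5 {𝕜 : Type*} [NontriviallyNormedField 𝕜] [IsRCLikeNormedField 𝕜]
    {E : Type*} [NormedAddCommGroup E] [NormedSpace 𝕜 E] [FiniteDimensional 𝕜 E]
    {M : Type*} [TopologicalSpace M] [ChartedSpace E M] [IsManifold 𝓘(𝕜, E) ∞ M]
    (n : ℕ) (hn : Module.finrank 𝕜 E = 2 * n) (Ω : SymplecticForm 𝕜 E M)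
    (I : IdealSheaf 𝕜 E M) (hI : I.IsInvolutive Ω)
    (hdim : ∀ (p : M) (d : ℕ), I.IsSmoothPoint p d → d ≤ n) :
    ∃ J : DGAMorphism I hI,
      (∀ (p : M) (f : fnGerm 𝕜 E p) (g : I.stalk p),
        J.toFun 1 p (IdealSheaf.OmegaStalk.mk I (formGerm.ofFn f).d)
            (fun _ => (I.stalk p).toCotangent g) =
          IdealSheaf.OStalk.mk I ((poisson Ω p).toFun f g)) ∧
      ∀ (p : M) (d : ℕ), I.IsSmoothPoint p d → J.IsIsoAt p := by
  refine ⟨deRhamToConormal I hI, deRhamToConormal_d_ofFn I hI, fun p d hp => ?_⟩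
  obtain ⟨f, y, hfy⟩ := hp.exists_frame hI hn (hdim p d hp)
  -- The neighbourhood comes from the frame alone, so the same V works in every degree.
  obtain ⟨V, hV, hVo, hpV⟩ := eventually_nhds_iff.1 hfy
  have hbij : ∀ k, ∀ q ∈ V, Function.Bijective ((deRhamToConormal I hI).toFun k q) := by
    intro k q hq
    obtain ⟨hf, hy, hspan, hA, hP⟩ := hV q hq
    exact deRhamToConormal_bijective hI hn hspan hA hP k
  refine ⟨⟨V, hVo⟩, hpV, fun k => ⟨hbij k, fun W hW => ?_⟩⟩
  refine deRhamToConormal_bijOn hI (f := f) (fun q hq => ?_) fun q hq => hbij k q (hW hq)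
  obtain ⟨hf, hy, hspan, hA, hP⟩ := hV q (hW hq)
  exact ⟨hf, hspan⟩
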